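/- **Setting.** Let $d\in\mathbb N$ and let $p$ be an irreducible, translation invariant transition probability on $\mathbb Z^d$. Let $a:\mathbb Z^d\to(0,\infty)$ satisfy $\sum_x a_x<\infty$ and $\sum_y p(x,y)a_y+\sum_y a_y p(y,x)\le M a_x$ for all $x$ and some constant $M$; put $\|\eta-\zeta\|=\sum_x|\eta(x)-\zeta(x)|a_x$ and $\mathfrak X=\{\eta\in\mathbb N^{\mathbb Z^d}:\|\eta\|<\infty\}$, and let $\mathbf L$ be the set of functions $f:\mathfrak X\to\mathbb R$ that are Lipschitz for $\|\cdot-\cdot\|$. A mass migration target process (MM-TP) has rates $g^k_{\alpha,\beta}=\mathbf 1_{[k\le\alpha]}\,g^k_{*,\beta}$, where $g^k_{*,\beta}\ge0$ for $k\ge1$, $\beta\ge0$: from a site $x$ with $\alpha$ particles, $k$ particles jump together to a site $y\ne x$ with $\beta$ particles at rate $p(x,y)g^k_{\alpha,\beta}$. With $S^k_{x,y}\eta$ the configuration after the jump, its generator is $$\mathcal Lf(\eta)=\sum_{x\neq y}\sum_{k=1}^{\eta(x)}p(x,y)\,g^k_{\eta(x),\eta(y)}\bigl(f(S^k_{x,y}\eta)-f(\eta)\bigr).$$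 The growth condition (G) is: for some $C>0$, $\sum_{k=1}^{\alpha}k\,g^k_{*,\beta}\le C(\alpha+\beta)$ for all $\alpha>0,\ \beta\ge0$. A Markov semigroup of the process is a family $(S(t))_{t\ge0}$, $S(t)f(\eta)=\int f\,dP_t(\eta,\cdot)$, with $P_t$ Markov kernels on $\mathfrak X$ satisfying the Chapman–Kolmogorov equations, such that, for some $c>0$, all $t\ge0$ and every $f\in\mathbf L$ with constant $L_f$, $S(t)f$ is well defined (i.e. $f$ is integrable), belongs to $\mathbf L$ with constant $L_fe^{ct}$, and satisfies $S(t)f=f+\int_0^t\mathcal LS(s)f\,ds$ pointwise. A probability measure $\bar\mu$ on $\mathbb N^{\mathbb Z^d}$ is *invariant for* $S$ if $\bar\mu(\mathfrak X)=1$ and $\int S(t)f\,d\bar\mu=\int f\,d\bar\mu$ for all bounded $f\in\mathbf L$, $t\ge0$. It is *infinitesimally invariant* if $\bar\mu(\mathfrak X)=1$ and, for every bounded cylinder function $f$, $\mathcal Lf$ is $\bar\mu$-integrable with $\int\mathcal Lf\,d\bar\mu=0$. Below, "$\bar\mu$ is invariant" as a conclusion means that $\bar\mu$ is infinitesimally invariant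 and is invariant for every Markov semigroup of the process; as a hypothesis it means that $\bar\mu$ is infinitesimally invariant or is invariant for some Markov semigroup of the process. For a probability measure $\mu$ on $\mathbb N$, $\bar\mu$ denotes the product measure on $\mathbb N^{\mathbb Z^d}$ with all marginals equal to $\mu$. **(a)** Let $\mu$ be a probability measure on $\mathbb N$ with $\mu(\alpha)>0$ for all $\alpha$ and $\sum_n n\mu(n)<\infty$, and let $g^\alpha_{*,0}>0$, $\alpha\ge1$, be arbitrary. Put $\Delta_r(s)=\frac{\mu(r+s)}{\mu(r)}-\frac{\mu(r+s-1)}{\mu(r-1)}$ for $r>0$, $s\ge0$, and $$H_\alpha(\beta,\beta)=\Delta_\alpha(\beta)\mu(0),\qquad H_\alpha(\beta,k)=\Delta_\alpha(k)\mu(\beta-k)+\sum_{l=1}^{\beta-k}\Delta_\alpha(l)H_l(\beta-l,k)\quad(1\le k<\beta),$$ $$g^\alpha_{*,\beta}=g^\alpha_{*,0}+\frac1{\mu(\beta)}\sum_{k=1}^{\beta}H_\alpha(\beta,k)\,g^k_{*,0}\qquad(\alpha,\beta\ge1).$$ If all these $g^\alpha_{*,\beta}$ are nonnegative and (G) holds,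 then $\bar\mu$ is invariant for the MM-TP with these rates. Moreover (for fully supported $\mu$, without any moment or growth assumption), the $g^\alpha_{*,\beta}$ are nonnegative as soon as $\Delta_r(s)\ge0$ for all $r>0$, $s\ge0$; and the latter is equivalent to $\mu(n+1)/\mu(n)$ being a nondecreasing function of $n$. **(b)** Given rates $g^k_{*,\beta}\ge 0$, put $w(0)=1$, $w(1)=g^1_{*,0}$, and $w(\alpha)=g^1_{*,0}g^1_{*,1}\prod_{k=2}^{\alpha-1}\bigl(g^1_{*,1}+\sum_{i=2}^k(g^i_{*,1}-g^i_{*,0})\bigr)$ for $\alpha\ge2$. Consider the conditions $$(1)\qquad g^1_{*,0}\,g^1_{*,1}\neq0,\qquad g^1_{*,1}+\sum_{k=2}^{\alpha}(g^k_{*,1}-g^k_{*,0})>0\quad\text{for all }\alpha\ge2,$$ $$(2)\qquad g^\alpha_{*,\beta}=g^\alpha_{*,0}+\sum_{k=1}^{\beta}H^*_\alpha(\beta,k)\,g^k_{*,0}\quad\text{for all }\alpha,\beta\ge1,$$ where $\Delta^*_r(s)=\frac{w(r+s)}{w(r)}-\frac{w(r+s-1)}{w(r-1)}$, $H^*_\alpha(\beta,\beta)=\frac{w(0)}{w(\beta)}\Delta^*_\alpha(\beta)$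 and $H^*_\alpha(\beta,k)=\frac{w(\beta-k)}{w(\beta)}\Delta^*_\alpha(k)+\sum_{l=1}^{\beta-k}\frac{w(\beta-l)}{w(\beta)}\Delta^*_\alpha(l)H^*_l(\beta-l,k)$ for $1\le k<\beta$. *Sufficiency.* Suppose that (G), (1) and (2) hold. Call a fully supported probability measure $\mu$ on $\mathbb N$ a reference marginal if $\mu(\alpha)=\mu(0)\tilde\varphi_\mu^{\alpha}w(\alpha)$ for all $\alpha$, where $\tilde\varphi_\mu=\frac1{g^1_{*,0}}\frac{\mu(1)}{\mu(0)}$. Then there is a reference marginal with finite first moment. For every reference marginal $\mu$, let $\varphi_c\in[1,\infty]$ be the radius of convergence of $Z_\varphi=\sum_n\varphi^n\mu(n)$, and let $\mathrm{Rad}(Z')$ be the set of the real numbers $\varphi>0$ with $\varphi<\varphi_c$, together with $\varphi=\varphi_c$ if $\varphi_c<\infty$ and $\sum_n n\varphi_c^n\mu(n)<\infty$. Then, for every $\varphi\in\mathrm{Rad}(Z')$, $Z_\varphi=\mu(0)\sum_n(\varphi\tilde\varphi_\mu)^nw(n)<\infty$, the formula $$\mu_\varphi(\alpha)=\frac{\mu(0)}{Z_\varphi}(\varphi\tilde\varphi_\mu)^\alpha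 w(\alpha),\qquad\alpha\ge0,$$ defines a probability measure on $\mathbb N$, and the product measure $\bar\mu_\varphi$ is invariant for the MM-TP. *Necessity.* Suppose that $p$ is asymmetric, i.e. $p(x,y)\neq p(y,x)$ for some $x,y$, that (G) holds and that $g^1_{*,0}\neq0$. If, for some probability measure $\mu$ on $\mathbb N$ with full support and finite first moment, the product measure $\bar\mu$ is invariant for the MM-TP, then (1) and (2) hold. -/

import Mathlib

open MeasureTheory ProbabilityTheory
open scoped NNReal ENNReal

noncomputable section

namespace MMP

/-! ### Configurations and the mass migration generator -/

/-- `p` is a transition probability on the set of sites `X`. -/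
structure IsTransitionProbability {X : Type*} (p : X → X → ℝ) : Prop where
  nonneg : ∀ x y, 0 ≤ p x y
  hasSum_one : ∀ x, HasSum (fun y => p x y) 1

/-- Every site can be reached from every site in finitely many steps of positive probability. -/
def IsIrreducibleWalk {X : Type*} (p : X → X → ℝ) : Prop :=
  ∀ x y, Relation.ReflTransGen (fun u v => 0 < p u v) x y

/-- Translation invariance of the transition probability. -/
def IsTranslationInvariant {X : Type*} [Add X] (p : X → X → ℝ) : Prop :=
  ∀ x y z, p (x + z) (y + z) = p x y

/-- A positive summable weight `a` on the sites with
`∑ y, p x y * a y + ∑ y, a y * p y x ≤ M * a x` for some constant `M`. -/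
structure IsWeight {X : Type*} (p : X → X → ℝ) (a : X → ℝ) : Prop where
  pos : ∀ x, 0 < a x
  summable : Summable a
  summable_out : ∀ x, Summable fun y => p x y * a y
  summable_in : ∀ x, Summable fun y => a y * p y x
  bound : ∃ M : ℝ, ∀ x, (∑' y, p x y * a y) + (∑' y, a y * p y x) ≤ M * a x

/-- The set of configurations `η : X → ℕ` with `‖η‖ = ∑ x, η x * a x < ∞`. -/
def configSet {X : Type*} (a : X → ℝ) : Set (X → ℕ) :=
  {η | Summable fun x => (η x : ℝ) * a x}

/-- The state space, with the σ-algebra induced by the product σ-algebra. -/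
abbrev Config {X : Type*} (a : X → ℝ) : Type _ := ↥(configSet a)

/-- `‖η - ζ‖ = ∑ x, |η x - ζ x| * a x`. -/
def configDist {X : Type*} {a : X → ℝ} (η ζ : Config a) : ℝ :=
  ∑' x, |(η.1 x : ℝ) - (ζ.1 x : ℝ)| * a x

/-- `f` is a Lipschitz function on the state space, with Lipschitz constant `K`. -/
def IsLip {X : Type*} {a : X → ℝ} (K : ℝ) (f : Config a → ℝ) : Prop :=
  ∀ η ζ, |f η - f ζ| ≤ K * configDist η ζ

/-- The configuration after `k` particles jump from `x` to `y`; nothing changes if there are fewer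
than `k` particles on `x`, or if `x = y`. -/
def jump {X : Type*} [DecidableEq X] (x y : X) (k : ℕ) (η : X → ℕ) : X → ℕ := fun z =>
  if x ≠ y ∧ k ≤ η x then
    if z = x then η x - k else if z = y then η y + k else η z
  else η z

theorem jump_mem {X : Type*} [DecidableEq X] {a : X → ℝ} (x y : X) (k : ℕ) {η : X → ℕ}
    (h : η ∈ configSet a) : jump x y k η ∈ configSet a := by
  refine Summable.congr_cofinite (f := fun z => (η z : ℝ) * a z) h ?_
  rw [Filter.EventuallyEq, Filter.eventually_cofinite]
  refine Set.Finite.subset (Set.toFinite {x, y}) ?_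
  intro z hz
  by_contra hne
  simp only [Set.mem_insert_iff, Set.mem_singleton_iff, not_or] at hne
  apply hz
  simp [jump, hne.1, hne.2]

/-- The jump as a map of the state space. -/
def jumpConfig {X : Type*} [DecidableEq X] {a : X → ℝ} (x y : X) (k : ℕ) (η : Config a) :
    Config a :=
  ⟨jump x y k η.1, jump_mem x y k η.2⟩

/-- The generator of the mass migration process; `g k α β` is the rate at which `k` particles jump
from a site with `α` particles to a site with `β` particles. -/
def generator {X : Type*} [DecidableEq X] {a : X → ℝ} (p : X → X → ℝ) (g : ℕ → ℕ → ℕ → ℝ)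
    (f : Config a → ℝ) (η : Config a) : ℝ :=
  ∑' q : X × X, ∑ k ∈ Finset.Icc 1 (η.1 q.1),
    p q.1 q.2 * g k (η.1 q.1) (η.1 q.2) * (f (jumpConfig q.1 q.2 k η) - f η)

/-- The linear growth condition `∑_{k ≤ α} k g^k_{α,β} ≤ C (α + β)` on the rates. -/
def RateBound (g : ℕ → ℕ → ℕ → ℝ) : Prop :=
  ∃ C : ℝ, 0 < C ∧ ∀ α β : ℕ, 0 < α →
    ∑ k ∈ Finset.Icc 1 α, (k : ℝ) * g k α β ≤ C * ((α : ℝ) + (β : ℝ))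

/-! ### The process and its invariant measures -/

/-- The Markov semigroup `S(t) f (η) = ∫ f(ζ) P_t(η, dζ)` of a mass migration process, given by its
transition kernels `P_t` (`t ≥ 0`) on the state space: it maps Lipschitz functions to Lipschitz
functions with at most exponential growth of the constants, and solves the Kolmogorov equation
`S(t) f = f + ∫_0^t L S(s) f ds` for every Lipschitz `f`, where `L` is the generator. -/
structure MarkovSemigroup {X : Type*} [DecidableEq X] (a : X → ℝ) (p : X → X → ℝ)
    (g : ℕ → ℕ → ℕ → ℝ) where
  kernel : ℝ → Kernel (Config a) (Config a)
  markov : ∀ t, 0 ≤ t → IsMarkovKernel (kernel t)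
  chapman_kolmogorov : ∀ s t, 0 ≤ s → 0 ≤ t → kernel (s + t) = kernel s ∘ₖ kernel t
  integrable : ∀ t, 0 ≤ t → ∀ (K : ℝ) (f : Config a → ℝ), IsLip K f →
    ∀ η, Integrable f (kernel t η)
  lip : ∃ c : ℝ, 0 < c ∧ ∀ t, 0 ≤ t → ∀ (K : ℝ) (f : Config a → ℝ), IsLip K f →
    IsLip (K * Real.exp (c * t)) (fun η => ∫ ζ, f ζ ∂(kernel t η))
  kolmogorov : ∀ t, 0 ≤ t → ∀ (K : ℝ) (f : Config a → ℝ), IsLip K f → ∀ η,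
    IntervalIntegrable (fun s => generator p g (fun ξ => ∫ ζ, f ζ ∂(kernel s ξ)) η) volume 0 t ∧
    ∫ ζ, f ζ ∂(kernel t η) =
      f η + ∫ s in (0 : ℝ)..t, generator p g (fun ξ => ∫ ζ, f ζ ∂(kernel s ξ)) η

/-- `ν` is supported on the state space. -/
def SupportedOn {X : Type*} (a : X → ℝ) (ν : Measure (X → ℕ)) : Prop :=
  ∀ᵐ η ∂ν, η ∈ configSet a

/-- `ν` is invariant for the process with semigroup `S`: it is supported on the state space and
`∫ S(t) f dν = ∫ f dν` for all `t ≥ 0` and all bounded Lipschitz `f`. -/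
def IsInvariantFor {X : Type*} [DecidableEq X] {a : X → ℝ} {p : X → X → ℝ} {g : ℕ → ℕ → ℕ → ℝ}
    (S : MarkovSemigroup a p g) (ν : Measure (X → ℕ)) : Prop :=
  SupportedOn a ν ∧
  ∀ f : Config a → ℝ, (∃ K, IsLip K f) → (∃ m, ∀ η, |f η| ≤ m) → ∀ t, 0 ≤ t →
    ∫ η : Config a, (∫ ζ, f ζ ∂(S.kernel t η)) ∂(ν.comap Subtype.val) =
      ∫ η : Config a, f η ∂(ν.comap Subtype.val)

/-- `ν` is supported on the state space and `∫ L f dν = 0` for every bounded cylinder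
function `f`. -/
def IsInfinitesimallyInvariant {X : Type*} [DecidableEq X] (a : X → ℝ) (p : X → X → ℝ)
    (g : ℕ → ℕ → ℕ → ℝ) (ν : Measure (X → ℕ)) : Prop :=
  SupportedOn a ν ∧
  ∀ f : (X → ℕ) → ℝ, (∃ V : Finset X, DependsOn f (V : Set X)) → (∃ m, ∀ η, |f η| ≤ m) →
    Integrable (fun η : Config a => generator p g (fun ζ : Config a => f ζ.1) η)
      (ν.comap Subtype.val) ∧
    ∫ η : Config a, generator p g (fun ζ : Config a => f ζ.1) η ∂(ν.comap Subtype.val) = 0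

/-- The translation invariant product measure with single site marginal `μ`. -/
def productMeasure (X : Type*) (μ : PMF ℕ) : Measure (X → ℕ) :=
  Measure.infinitePi fun _ : X => μ.toMeasure

/-! ### Single site marginals -/

/-- The weights `μ(n)` of a probability measure on `ℕ` as real numbers. -/
def weight (μ : PMF ℕ) (n : ℕ) : ℝ := (μ n).toReal

/-- `μ(n) > 0` for all `n`. -/
def FullSupport (μ : PMF ℕ) : Prop := ∀ n, 0 < weight μ n

/-- `∑ n μ(n) < ∞`. -/
def FiniteMean (μ : PMF ℕ) : Prop := Summable fun n : ℕ => (n : ℝ) * weight μ n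

/-- `Z_φ = ∑ φ^n m(n)`. -/
def partitionFn (m : ℕ → ℝ) (φ : ℝ) : ℝ := ∑' n : ℕ, φ ^ n * m n

/-- The radius of convergence `φ_c` of `∑ φ^n m(n)`, for nonnegative `m`. -/
def criticalFugacity (m : ℕ → ℝ) : ℝ≥0∞ :=
  ⨆ (φ : ℝ≥0) (_ : Summable fun n : ℕ => (φ : ℝ) ^ n * m n), (φ : ℝ≥0∞)

/-- `Rad(Z')`: the interval `(0, φ_c]` if `∑ n φ_c^n m(n) < ∞`, and `(0, φ_c)` otherwise. -/
def radPrime (m : ℕ → ℝ) : Set ℝ :=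
  {φ | 0 < φ ∧ (ENNReal.ofReal φ < criticalFugacity m ∨
    (ENNReal.ofReal φ = criticalFugacity m ∧ Summable fun n : ℕ => (n : ℝ) * φ ^ n * m n))}

/-! ### Mass migration target processes -/

/-- The rates `g^k_{α,β} = 1_{[k ≤ α]} g^k_{*,β}` of a target process; `h k β` is `g^k_{*,β}`. -/
def targetRates (h : ℕ → ℕ → ℝ) (k α β : ℕ) : ℝ := if 1 ≤ k ∧ k ≤ α then h k β else 0

/-- `Δ_r(s) = v(r+s)/v(r) - v(r+s-1)/v(r-1)`, for `r > 0` and `s ≥ 0`. -/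
def delta (v : ℕ → ℝ) (r s : ℕ) : ℝ := v (r + s) / v r - v (r + s - 1) / v (r - 1)

/-- The coefficients `H_α(β, k)`, `1 ≤ k ≤ β`, associated with the weights `v`. -/
def coeffH (v : ℕ → ℝ) (α β k : ℕ) : ℝ :=
  if k = β then delta v α β * v 0
  else delta v α k * v (β - k) +
    ∑ l : Finset.Icc 1 (β - k), delta v α l.1 * coeffH v l.1 (β - l.1) k
termination_by β
decreasing_by
  have := Finset.mem_Icc.mp l.2
  omega

theorem coeffH_self (v : ℕ → ℝ) (α β : ℕ) : coeffH v α β β = delta v α β * v 0 := by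
  rw [coeffH]; simp

theorem coeffH_of_ne (v : ℕ → ℝ) (α β k : ℕ) (h : k ≠ β) :
    coeffH v α β k = delta v α k * v (β - k) +
      ∑ l ∈ Finset.Icc 1 (β - k), delta v α l * coeffH v l (β - l) k := by
  rw [coeffH, if_neg h]
  congr 1
  exact Finset.sum_coe_sort (Finset.Icc 1 (β - k))
    (fun l => delta v α l * coeffH v l (β - l) k)

/-- The normalized coefficients `H*_α(β, k)`, `1 ≤ k ≤ β`, associated with the weights `w`. -/
def coeffHStar (w : ℕ → ℝ) (α β k : ℕ) : ℝ :=
  if k = β then w 0 / w β * delta w α β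
  else w (β - k) / w β * delta w α k +
    ∑ l : Finset.Icc 1 (β - k), w (β - l.1) / w β * delta w α l.1 * coeffHStar w l.1 (β - l.1) k
termination_by β
decreasing_by
  have := Finset.mem_Icc.mp l.2
  omega

theorem coeffHStar_self (w : ℕ → ℝ) (α β : ℕ) :
    coeffHStar w α β β = w 0 / w β * delta w α β := by
  rw [coeffHStar]; simp

theorem coeffHStar_of_ne (w : ℕ → ℝ) (α β k : ℕ) (h : k ≠ β) :
    coeffHStar w α β k = w (β - k) / w β * delta w α k +
      ∑ l ∈ Finset.Icc 1 (β - k), w (β - l) / w β * delta w α l * coeffHStar w l (β - l) k := by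
  rw [coeffHStar, if_neg h]
  congr 1
  exact Finset.sum_coe_sort (Finset.Icc 1 (β - k))
    (fun l => w (β - l) / w β * delta w α l * coeffHStar w l (β - l) k)

/-- The target rates `g^α_{*,β}` determined by `μ` and by the prescribed `g^α_{*,0} = c α`:
`g^α_{*,β} = g^α_{*,0} + (1/μ(β)) ∑_{k=1}^β H_α(β,k) g^k_{*,0}` for `β ≥ 1`. -/
def recursiveRates (μ : PMF ℕ) (c : ℕ → ℝ) (α β : ℕ) : ℝ :=
  if β = 0 then c α
  else c α + 1 / weight μ β * ∑ k ∈ Finset.Icc 1 β, coeffH (weight μ) α β k * c k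

/-- The weights `w(α)` determined by the rates `g^k_{*,0}` and `g^k_{*,1}`. -/
def rateWeight (h : ℕ → ℕ → ℝ) (α : ℕ) : ℝ :=
  if α = 0 then 1
  else if α = 1 then h 1 0
  else h 1 0 * h 1 1 *
    ∏ k ∈ Finset.Icc 2 (α - 1), (h 1 1 + ∑ i ∈ Finset.Icc 2 k, (h i 1 - h i 0))

/-- `g^1_{*,0} g^1_{*,1} ≠ 0`, and `g^1_{*,1} + ∑_{k=2}^α (g^k_{*,1} - g^k_{*,0}) > 0` for
all `α ≥ 2`. -/
def PositivityCondition (h : ℕ → ℕ → ℝ) : Prop :=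
  h 1 0 * h 1 1 ≠ 0 ∧
  ∀ α, 2 ≤ α → 0 < h 1 1 + ∑ k ∈ Finset.Icc 2 α, (h k 1 - h k 0)

/-- The compatibility relations
`g^α_{*,β} = g^α_{*,0} + ∑_{k=1}^β H*_α(β,k) g^k_{*,0}` for `α, β ≥ 1`, where `H*` is built from
the weights `w` of the rates themselves. -/
def CompatibilityCondition (h : ℕ → ℕ → ℝ) : Prop :=
  ∀ α β, 1 ≤ α → 1 ≤ β →
    h α β = h α 0 + ∑ k ∈ Finset.Icc 1 β, coeffHStar (rateWeight h) α β k * h k 0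

/-- `φ̃_μ = (1 / g^1_{*,0}) * μ(1) / μ(0)`. -/
def phiTilde (h : ℕ → ℕ → ℝ) (μ : PMF ℕ) : ℝ := 1 / h 1 0 * (weight μ 1 / weight μ 0)

/-- `μ` is a reference marginal for the rates: it is fully supported and
`μ(α) = μ(0) φ̃_μ^α w(α)` for all `α`. -/
def IsReference (h : ℕ → ℕ → ℝ) (μ : PMF ℕ) : Prop :=
  FullSupport μ ∧ ∀ α, weight μ α = weight μ 0 * phiTilde h μ ^ α * rateWeight h α

end MMP

end

open MMP

/-! Everything reduces to an identity for two sites. Give a pair of occupation numbers the weight `v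
a * v b`, let particles jump from the first site to the second, and put ψ = `emptyRate h`.
`IsGradientFlux` says that the net flux into (a, b) equals v(a) v(b) (ψ(b) - ψ(a)). Dividing by v(a)
and taking the increment in a turns this into `RateRecursion`, an explicit formula for the rates.
Conversely the recursion recovers the identity, because jumps conserve a + b and this fixes the
values at a = 0 (`RateRecursion.isGradientFlux`). Unrolling the recursion gives the coefficients H
and H*, and multiplying v by a geometric factor does not change it, which accounts for the
one-parameter family of measures.

Gradient flux implies stationarity. For a cylinder function F, the jumps from x to y contribute
p(x,y) (c_y - c_x) to the integral of the generator, where c_x is the integral of ψ(η_x) F up to a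
constant and has finite support. A translation invariant p is doubly stochastic, so these terms sum
to zero. Cutting a configuration off outside finite sets extends this to bounded Lipschitz
functions, in particular to S(s)f, and the integrated Kolmogorov equation then gives invariance
under every semigroup. In the other direction, invariance under one semigroup gives infinitesimal
invariance by differentiating at time 0.

Necessity tests stationarity on indicators of one and of two occupation numbers. The one-site test
relates the two marginal fluxes; the two-site test gives a linear system for the defect D(α,β),
D(β,α) with determinant p(u,v)² - p(v,u)². Asymmetry forces D = 0, and the values at β = 0 identify
the marginal flux with ψ up to a constant. At β = 1 the gradient identity shows that the weights are
w up to a geometric factor.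

A reference marginal exists once w grows at most exponentially (`rateWeight_le_pow`). The growth
condition alone only bounds w(k+1)/w(k) linearly in k. However, this ratio rises at k by at most
g^k_{*,1}. Where that rate is below 1/k², the total rise is summable; where it is at least 1/k², the
flux identity at (m, k+1) makes w nearly submultiplicative at k. `exists_pow_bound` combines the two
alternatives across scales. -/

namespace MMP

/-! ### Stationary flux through pairs of sites -/

/-- The total rate of jumps onto an empty site. -/
noncomputable def emptyRate (h : ℕ → ℕ → ℝ) (n : ℕ) : ℝ := ∑ k ∈ Finset.Icc 1 n, h k 0

/-- The flux into the pair state `(a, b)` under the product weights `v a * v b`. -/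
noncomputable def inFlux (v : ℕ → ℝ) (h : ℕ → ℕ → ℝ) (a b : ℕ) : ℝ :=
  ∑ k ∈ Finset.Icc 1 b, h k (b - k) * v (a + k) * v (b - k)

/-- The flux out of the pair state `(a, b)` under the product weights `v a * v b`. -/
noncomputable def outFlux (v : ℕ → ℝ) (h : ℕ → ℕ → ℝ) (a b : ℕ) : ℝ :=
  v a * v b * ∑ k ∈ Finset.Icc 1 a, h k b

/-- The net flux into the pair state `(a, b)`. -/
noncomputable def netFlux (v : ℕ → ℝ) (h : ℕ → ℕ → ℝ) (a b : ℕ) : ℝ :=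
  inFlux v h a b - outFlux v h a b

/-- The net flux is the gradient of the one-site function `emptyRate h`. -/
def IsGradientFlux (v : ℕ → ℝ) (h : ℕ → ℕ → ℝ) : Prop :=
  ∀ a b, netFlux v h a b = v a * v b * (emptyRate h b - emptyRate h a)

/-- The recursion which determines the rates from the weights and the rates onto empty sites. -/
def RateRecursion (v : ℕ → ℝ) (h : ℕ → ℕ → ℝ) : Prop :=
  ∀ α β, 1 ≤ α → 1 ≤ β →
    h α β = h α 0 + 1 / v β * ∑ k ∈ Finset.Icc 1 β, h k (β - k) * v (β - k) * delta v α k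

/-- A jump of k particles preserves a + b, so (a, b, k) ↦ (a + k, b - k, k) matches arrivals at a
state with departures from its predecessor. This is the finite adjointness behind all later flux
computations. -/
theorem sum_antidiagonal_inFlux (v : ℕ → ℝ) (h : ℕ → ℕ → ℝ) (φ : ℕ → ℕ → ℝ) (n : ℕ) :
    ∑ q ∈ Finset.HasAntidiagonal.antidiagonal n, inFlux v h q.1 q.2 * φ q.1 q.2 =
      ∑ q ∈ Finset.HasAntidiagonal.antidiagonal n,
        v q.1 * v q.2 * ∑ k ∈ Finset.Icc 1 q.1, h k q.2 * φ (q.1 - k) (q.2 + k) := by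
  simp only [inFlux, Finset.sum_mul, Finset.mul_sum]
  rw [Finset.sum_sigma', Finset.sum_sigma']
  refine Finset.sum_bij' (fun x _ => ⟨(x.1.1 + x.2, x.1.2 - x.2), x.2⟩)
    (fun x _ => ⟨(x.1.1 - x.2, x.1.2 + x.2), x.2⟩) ?_ ?_ ?_ ?_ ?_
  · rintro ⟨⟨a, b⟩, k⟩ hx
    simp only [Finset.mem_sigma, Finset.HasAntidiagonal.mem_antidiagonal, Finset.mem_Icc] at hx ⊢
    omega
  · rintro ⟨⟨a, b⟩, k⟩ hx
    simp only [Finset.mem_sigma, Finset.HasAntidiagonal.mem_antidiagonal, Finset.mem_Icc] at hx ⊢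
    omega
  · rintro ⟨⟨a, b⟩, k⟩ hx
    simp only [Finset.mem_sigma, Finset.HasAntidiagonal.mem_antidiagonal, Finset.mem_Icc] at hx
    have h1 : a + k - k = a := by omega
    have h2 : b - k + k = b := by omega
    simp [h1, h2]
  · rintro ⟨⟨a, b⟩, k⟩ hx
    simp only [Finset.mem_sigma, Finset.HasAntidiagonal.mem_antidiagonal, Finset.mem_Icc] at hx
    have h1 : a - k + k = a := by omega
    have h2 : b + k - k = b := by omega
    simp [h1, h2]
  · rintro ⟨⟨a, b⟩, k⟩ hx
    simp only [Finset.mem_sigma, Finset.HasAntidiagonal.mem_antidiagonal, Finset.mem_Icc] at hx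
    have h1 : a + k - k = a := by omega
    have h2 : b - k + k = b := by omega
    simp only [h1, h2]
    ring

theorem sum_antidiagonal_netFlux (v : ℕ → ℝ) (h : ℕ → ℕ → ℝ) (n : ℕ) :
    ∑ q ∈ Finset.HasAntidiagonal.antidiagonal n, netFlux v h q.1 q.2 = 0 := by
  have := sum_antidiagonal_inFlux v h (fun _ _ => 1) n
  simp only [mul_one] at this
  simp only [netFlux, outFlux, Finset.sum_sub_distrib, this, sub_self]

/-- The summand is antisymmetric under exchanging the two sites. -/
theorem sum_antidiagonal_gradient (v ψ : ℕ → ℝ) (n : ℕ) :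
    ∑ q ∈ Finset.HasAntidiagonal.antidiagonal n, v q.1 * v q.2 * (ψ q.2 - ψ q.1) = 0 := by
  have : ∑ q ∈ Finset.HasAntidiagonal.antidiagonal n, v q.1 * v q.2 * (ψ q.2 - ψ q.1) =
      ∑ q ∈ Finset.HasAntidiagonal.antidiagonal n, v q.2 * v q.1 * (ψ q.1 - ψ q.2) :=
    (Finset.Nat.sum_antidiagonal_swap (f := fun q : ℕ × ℕ => v q.1 * v q.2 * (ψ q.2 - ψ q.1))).symm
  have h2 : ∑ q ∈ Finset.HasAntidiagonal.antidiagonal n, v q.2 * v q.1 * (ψ q.1 - ψ q.2) =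
      -∑ q ∈ Finset.HasAntidiagonal.antidiagonal n, v q.1 * v q.2 * (ψ q.2 - ψ q.1) := by
    rw [← Finset.sum_neg_distrib]
    exact Finset.sum_congr rfl fun q _ => by ring
  linarith

theorem sum_Icc_one_succ (f : ℕ → ℝ) (n : ℕ) :
    ∑ k ∈ Finset.Icc 1 (n + 1), f k = ∑ k ∈ Finset.Icc 1 n, f k + f (n + 1) :=
  Finset.sum_Icc_succ_top (by omega) f

/-- The increment in `a` of the flux identity at `(a, b)` is the rate recursion. -/
theorem netFlux_div_succ_sub {v : ℕ → ℝ} (hv : ∀ n, 0 < v n) (h : ℕ → ℕ → ℝ) (a b : ℕ) :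
    netFlux v h (a + 1) b / v (a + 1) - netFlux v h a b / v a =
      ∑ k ∈ Finset.Icc 1 b, h k (b - k) * v (b - k) * delta v (a + 1) k - v b * h (a + 1) b := by
  have h1 := (hv (a + 1)).ne'
  have h2 := (hv a).ne'
  have e : ∀ k, delta v (a + 1) k = v (a + 1 + k) / v (a + 1) - v (a + k) / v a := by
    intro k
    simp only [delta]
    congr 3
    omega
  have e1 : ∀ c, inFlux v h c b / v c =
      ∑ k ∈ Finset.Icc 1 b, h k (b - k) * v (b - k) * (v (c + k) / v c) := by
    intro c
    rw [inFlux, Finset.sum_div]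
    exact Finset.sum_congr rfl fun k _ => by ring
  have e2 : ∀ c, outFlux v h c b / v c = v b * ∑ k ∈ Finset.Icc 1 c, h k b := by
    intro c
    rw [outFlux, mul_assoc, mul_div_cancel_left₀ _ (hv c).ne']
  simp only [netFlux, sub_div, e1, e2, sum_Icc_one_succ, e, mul_sub, Finset.sum_sub_distrib]
  ring

/-- Strong induction on b, and for fixed b induction on a. The recursion is exactly the increment in
a, so only the start a = 0 needs another argument, namely conservation of a + b. -/
theorem RateRecursion.isGradientFlux {v : ℕ → ℝ} (hv : ∀ n, 0 < v n) {h : ℕ → ℕ → ℝ}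
    (hr : RateRecursion v h) : IsGradientFlux v h := by
  intro a b
  induction b using Nat.strong_induction_on generalizing a with
  | _ b ih =>
  induction a with
  | zero =>
    -- Both sides of the identity have zero sum over the antidiagonal a + b = const. Every other
    -- state on it has a smaller second coordinate and is covered by the induction hypothesis, so
    -- (0, b) is left alone.
    have h0 : ∑ q ∈ Finset.HasAntidiagonal.antidiagonal b,
        (netFlux v h q.1 q.2 - v q.1 * v q.2 * (emptyRate h q.2 - emptyRate h q.1)) = 0 := by
      rw [Finset.sum_sub_distrib, sum_antidiagonal_netFlux, sum_antidiagonal_gradient, sub_zero]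
    rw [Finset.sum_eq_single (0, b)] at h0
    · exact sub_eq_zero.mp h0
    · rintro ⟨x, y⟩ hq hne
      rw [Finset.HasAntidiagonal.mem_antidiagonal] at hq
      have hy : y < b := by
        by_contra hlt
        simp only at hq
        apply hne
        ext <;> simp <;> omega
      exact sub_eq_zero.mpr (ih y hy x)
    · simp
  | succ a iha =>
    have key := netFlux_div_succ_sub hv h a b
    rw [iha] at key
    have h1 := (hv (a + 1)).ne'
    have h2 := (hv a).ne'
    have h3 := (hv b).ne'
    have hrec : ∑ k ∈ Finset.Icc 1 b, h k (b - k) * v (b - k) * delta v (a + 1) k =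
        v b * (h (a + 1) b - h (a + 1) 0) := by
      rcases Nat.eq_zero_or_pos b with rfl | hb
      · simp
      · rw [hr (a + 1) b (by omega) hb]
        field_simp
        ring
    rw [hrec] at key
    have hpsi : emptyRate h (a + 1) = emptyRate h a + h (a + 1) 0 := sum_Icc_one_succ _ _
    rw [hpsi]
    have : netFlux v h (a + 1) b / v (a + 1) =
        v b * (emptyRate h b - (emptyRate h a + h (a + 1) 0)) := by
      have e : v a * v b * (emptyRate h b - emptyRate h a) / v a =
        v b * (emptyRate h b - emptyRate h a) := by field_simp
      rw [e] at key
      linarith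
    rw [div_eq_iff h1] at this
    rw [this]
    ring

/-- Dividing the identity by v(a) and subtracting consecutive values of a leaves only the term ψ(a +
1) - ψ(a), the rate of a jump of a + 1 particles onto an empty site. -/
theorem IsGradientFlux.rateRecursion {v : ℕ → ℝ} (hv : ∀ n, 0 < v n) {h : ℕ → ℕ → ℝ}
    (hg : IsGradientFlux v h) : RateRecursion v h := by
  intro α β hα hβ
  obtain ⟨a, rfl⟩ : ∃ a, α = a + 1 := ⟨α - 1, by omega⟩
  have key := netFlux_div_succ_sub hv h a β
  rw [hg, hg] at key
  have h1 := (hv (a + 1)).ne'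
  have h2 := (hv a).ne'
  have h3 := (hv β).ne'
  have hpsi : emptyRate h (a + 1) = emptyRate h a + h (a + 1) 0 := sum_Icc_one_succ _ _
  have e1 : v (a + 1) * v β * (emptyRate h β - emptyRate h (a + 1)) / v (a + 1) =
    v β * (emptyRate h β - emptyRate h (a + 1)) := by field_simp
  have e2 : v a * v β * (emptyRate h β - emptyRate h a) / v a =
    v β * (emptyRate h β - emptyRate h a) := by field_simp
  rw [e1, e2, hpsi] at key
  have : ∑ k ∈ Finset.Icc 1 β, h k (β - k) * v (β - k) * delta v (a + 1) k =
      v β * (h (a + 1) β - h (a + 1) 0) := by linarith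
  rw [this]
  field_simp
  ring

/-! ### The coefficients `H` and `H*` -/

/-- Exchanging the sums over k and l isolates the first jump size l; the bracket is what the formula
for the rates gives at the smaller target occupation β - l. -/
theorem sum_coeffH_mul (v c : ℕ → ℝ) (α β : ℕ) :
    ∑ k ∈ Finset.Icc 1 β, coeffH v α β k * c k =
      ∑ l ∈ Finset.Icc 1 β, delta v α l *
        (v (β - l) * c l + ∑ k ∈ Finset.Icc 1 (β - l), coeffH v l (β - l) k * c k) := by
  have e : ∀ k ∈ Finset.Icc 1 β, coeffH v α β k * c k = delta v α k * (v (β - k) * c k) +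
      ∑ l ∈ Finset.Icc 1 (β - k), delta v α l * (coeffH v l (β - l) k * c k) := by
    intro k hk
    by_cases hkb : k = β
    · subst hkb
      simp [coeffH_self]
      ring
    · rw [coeffH_of_ne v α β k hkb, add_mul, Finset.sum_mul]
      congr 1
      · ring
      · exact Finset.sum_congr rfl fun l _ => by ring
  rw [Finset.sum_congr rfl e, Finset.sum_add_distrib]
  simp only [mul_add, Finset.sum_add_distrib, Finset.mul_sum]
  congr 1
  apply Finset.sum_comm'
  intro x y
  simp only [Finset.mem_Icc]
  omega

/-- The normalizations in the recursion for H* telescope: the factor w(β - l) / w(β) cancels the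
denominator of the inner coefficient. -/
theorem coeffHStar_eq_div {w : ℕ → ℝ} (hw : ∀ n, 0 < w n) (β : ℕ) :
    ∀ α k, 1 ≤ k → k ≤ β → coeffHStar w α β k = coeffH w α β k / w β := by
  induction β using Nat.strong_induction_on with
  | _ β ih =>
  intro α k hk hkb
  by_cases h : k = β
  · subst h
    rw [coeffHStar_self, coeffH_self]
    ring
  · rw [coeffHStar_of_ne w α β k h, coeffH_of_ne w α β k h, add_div, Finset.sum_div]
    congr 1
    · ring
    · refine Finset.sum_congr rfl fun l hl => ?_
      rw [Finset.mem_Icc] at hl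
      rw [ih (β - l) (by omega) l k hk (by omega)]
      have := (hw (β - l)).ne'
      field_simp

/-- Rates satisfy the rate recursion iff they are given by the coefficients `H`. -/
theorem rateRecursion_iff_coeffH {v : ℕ → ℝ} (hv : ∀ n, 0 < v n) (h : ℕ → ℕ → ℝ) :
    RateRecursion v h ↔ ∀ α β, 1 ≤ α → 1 ≤ β →
      h α β = h α 0 + 1 / v β * ∑ k ∈ Finset.Icc 1 β, coeffH v α β k * h k 0 := by
  -- The formula is needed only at targets m < β, so this step serves both the inductive direction
  -- and the direct one.
  have step : ∀ α β, (∀ l m, 1 ≤ l → 1 ≤ m → m < β →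
      h l m = h l 0 + 1 / v m * ∑ k ∈ Finset.Icc 1 m, coeffH v l m k * h k 0) →
      ∑ k ∈ Finset.Icc 1 β, coeffH v α β k * h k 0 =
        ∑ k ∈ Finset.Icc 1 β, h k (β - k) * v (β - k) * delta v α k := by
    intro α β H
    rw [sum_coeffH_mul]
    refine Finset.sum_congr rfl fun l hl => ?_
    rw [Finset.mem_Icc] at hl
    have hne := (hv (β - l)).ne'
    rcases Nat.eq_zero_or_pos (β - l) with h0 | h0
    · rw [h0]
      simp
      ring
    · rw [H l (β - l) hl.1 h0 (by omega)]
      field_simp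
  constructor
  · intro hr α β
    induction β using Nat.strong_induction_on generalizing α with
    | _ β ih =>
    intro hα hβ
    rw [hr α β hα hβ, step α β fun l m hl hm hmb => ih m hmb l hl hm]
  · intro H α β hα hβ
    rw [H α β hα hβ, step α β fun l m hl hm _ => H l m hl hm]

theorem recursiveRates_rateRecursion {μ : PMF ℕ} (hμ : FullSupport μ) (c : ℕ → ℝ) :
    RateRecursion (weight μ) (recursiveRates μ c) := by
  rw [rateRecursion_iff_coeffH hμ]
  intro α β _ hβ
  have h0 : ∀ k, recursiveRates μ c k 0 = c k := fun k => by simp [recursiveRates]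
  simp only [h0]
  rw [recursiveRates, if_neg (by omega)]

theorem compatibilityCondition_iff {h : ℕ → ℕ → ℝ} (hw : ∀ n, 0 < rateWeight h n) :
    CompatibilityCondition h ↔ RateRecursion (rateWeight h) h := by
  rw [rateRecursion_iff_coeffH hw]
  refine forall₂_congr fun α β => forall₂_congr fun hα hβ => ?_
  have : ∑ k ∈ Finset.Icc 1 β, coeffHStar (rateWeight h) α β k * h k 0 =
      1 / rateWeight h β * ∑ k ∈ Finset.Icc 1 β, coeffH (rateWeight h) α β k * h k 0 := by
    rw [Finset.mul_sum]
    refine Finset.sum_congr rfl fun k hk => ?_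
    rw [Finset.mem_Icc] at hk
    rw [coeffHStar_eq_div hw β α k hk.1 hk.2]
    ring
  rw [this]

/-- The rate recursion only depends on the weights up to a geometric factor. -/
theorem rateRecursion_geometric {v w : ℕ → ℝ} {c φ : ℝ} (hc : c ≠ 0) (hφ : φ ≠ 0)
    (hvw : ∀ n, v n = c * φ ^ n * w n) (h : ℕ → ℕ → ℝ) :
    RateRecursion v h ↔ RateRecursion w h := by
  refine forall₂_congr fun α β => forall₂_congr fun hα hβ => ?_
  -- The factor φ^k gained by Δ cancels against the φ^(-k) coming from v(β - k) / v(β).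
  have hd : ∀ k, delta v α k = φ ^ k * delta w α k := by
    intro k
    obtain ⟨a, rfl⟩ : ∃ a, α = a + 1 := ⟨α - 1, by omega⟩
    have e : a + 1 + k - 1 = a + k := by omega
    simp only [delta, hvw, e, Nat.add_sub_cancel, pow_add, pow_one, mul_sub]
    have hcancel : ∀ A B X : ℝ, B ≠ 0 → A = φ ^ k * B → A / B * X = φ ^ k * X := by
      intro A B X hB hA
      rw [hA, mul_div_cancel_right₀ _ hB]
    have h1 := pow_ne_zero a hφ
    congr 1
    · rw [mul_div_mul_comm]
      exact hcancel _ _ _ (mul_ne_zero hc (mul_ne_zero h1 hφ)) (by ring)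
    · rw [mul_div_mul_comm]
      exact hcancel _ _ _ (mul_ne_zero hc h1) (by ring)
  have : 1 / v β * ∑ k ∈ Finset.Icc 1 β, h k (β - k) * v (β - k) * delta v α k =
      1 / w β * ∑ k ∈ Finset.Icc 1 β, h k (β - k) * w (β - k) * delta w α k := by
    rw [Finset.mul_sum, Finset.mul_sum]
    refine Finset.sum_congr rfl fun k hk => ?_
    rw [Finset.mem_Icc] at hk
    have e : φ ^ β = φ ^ (β - k) * φ ^ k := by rw [← pow_add]; congr 1; omega
    rw [hd, hvw, hvw, e]
    have h1 := pow_ne_zero (β - k) hφ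
    have h2 := pow_ne_zero k hφ
    -- If w(β) = 0 then v(β) = 0 as well, and both sides vanish by the convention for division by
    -- zero.
    by_cases h3 : w β = 0
    · simp [h3]
    · field_simp
  rw [this]

/-! ### Monotone ratios -/

/-- The case s = 1 is monotonicity of the ratios. For general s, v(r + s) / v(r) is a product of s
consecutive ratios, and shifting r by one does not decrease any of the factors. -/
theorem delta_nonneg_iff {v : ℕ → ℝ} (hv : ∀ n, 0 < v n) :
    (∀ r s, 0 < r → 0 ≤ delta v r s) ↔ Monotone fun n : ℕ => v (n + 1) / v n := by
  constructor
  · intro H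
    refine monotone_nat_of_le_succ fun n => ?_
    have := H (n + 1) 1 (by omega)
    simp only [delta, Nat.add_sub_cancel] at this
    linarith
  · intro H r s hr
    obtain ⟨r, rfl⟩ : ∃ a, r = a + 1 := ⟨r - 1, by omega⟩
    simp only [delta, Nat.add_sub_cancel, sub_nonneg]
    have e : r + 1 + s - 1 = r + s := by omega
    rw [e]
    induction s with
    | zero => simp [(hv _).ne']
    | succ s ih =>
      have e1 : v (r + (s + 1)) / v r = v (r + s) / v r * (v (r + s + 1) / v (r + s)) := by
        have := (hv (r + s)).ne'
        have := (hv r).ne'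
        rw [← add_assoc]
        field_simp
      have e2 : v (r + 1 + (s + 1)) / v (r + 1) =
          v (r + 1 + s) / v (r + 1) * (v (r + 1 + s + 1) / v (r + 1 + s)) := by
        have := (hv (r + 1 + s)).ne'
        have := (hv (r + 1)).ne'
        rw [← add_assoc]
        field_simp
      rw [e1, e2]
      exact mul_le_mul (ih (by omega)) (H (by omega)) (div_pos (hv _) (hv _)).le
        (div_pos (hv _) (hv _)).le

theorem coeffH_nonneg {v : ℕ → ℝ} (hv : ∀ n, 0 < v n)
    (hd : ∀ r s, 0 < r → 0 ≤ delta v r s) (β : ℕ) :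
    ∀ α k, 1 ≤ α → 0 ≤ coeffH v α β k := by
  induction β using Nat.strong_induction_on with
  | _ β ih =>
  intro α k hα
  by_cases h : k = β
  · subst h
    rw [coeffH_self]
    exact mul_nonneg (hd _ _ hα) (hv _).le
  · rw [coeffH_of_ne v α β k h]
    refine add_nonneg (mul_nonneg (hd _ _ hα) (hv _).le) (Finset.sum_nonneg fun l hl => ?_)
    rw [Finset.mem_Icc] at hl
    exact mul_nonneg (hd _ _ hα) (ih (β - l) (by omega) l k hl.1)

theorem recursiveRates_nonneg {μ : PMF ℕ} (hμ : FullSupport μ) {c : ℕ → ℝ}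
    (hc : ∀ α, 1 ≤ α → 0 < c α) (hd : ∀ r s, 0 < r → 0 ≤ delta (weight μ) r s) {α : ℕ}
    (hα : 1 ≤ α) (β : ℕ) : 0 ≤ recursiveRates μ c α β := by
  rw [recursiveRates]
  split_ifs
  · exact (hc α hα).le
  · refine add_nonneg (hc α hα).le (mul_nonneg (one_div_nonneg.mpr (hμ β).le)
      (Finset.sum_nonneg fun k hk => mul_nonneg (coeffH_nonneg hμ hd β α k hα) ?_))
    exact (hc k (Finset.mem_Icc.mp hk).1).le

/-! ### The weights of the rates -/

theorem rateWeight_zero (h : ℕ → ℕ → ℝ) : rateWeight h 0 = 1 := by simp [rateWeight]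

theorem rateWeight_one (h : ℕ → ℕ → ℝ) : rateWeight h 1 = h 1 0 := by simp [rateWeight]

/-- The ratio `w(α + 1) / w(α)` for `α ≥ 1`. -/
noncomputable def rateRatio (h : ℕ → ℕ → ℝ) (α : ℕ) : ℝ :=
  h 1 1 + ∑ i ∈ Finset.Icc 2 α, (h i 1 - h i 0)

theorem rateWeight_succ (h : ℕ → ℕ → ℝ) {α : ℕ} (hα : 1 ≤ α) :
    rateWeight h (α + 1) = rateWeight h α * rateRatio h α := by
  rcases hα.eq_or_lt with rfl | hα
  · simp [rateWeight, rateRatio]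
  · obtain ⟨m, rfl⟩ : ∃ m, α = m + 2 := ⟨α - 2, by omega⟩
    simp only [rateWeight, rateRatio]
    rw [if_neg (by omega), if_neg (by omega), if_neg (by omega), if_neg (by omega)]
    have e1 : m + 2 + 1 - 1 = m + 1 + 1 := by omega
    have e2 : m + 2 - 1 = m + 1 := by omega
    rw [e1, e2, Finset.prod_Icc_succ_top (by omega)]
    ring

theorem rateRatio_succ (h : ℕ → ℕ → ℝ) {α : ℕ} (hα : 1 ≤ α) :
    rateRatio h (α + 1) = rateRatio h α + (h (α + 1) 1 - h (α + 1) 0) := by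
  rw [rateRatio, Finset.sum_Icc_succ_top (by omega), rateRatio]
  ring

theorem rateRatio_one (h : ℕ → ℕ → ℝ) : rateRatio h 1 = h 1 1 := by simp [rateRatio]

theorem rateRatio_eq_sub (h : ℕ → ℕ → ℝ) {α : ℕ} (hα : 1 ≤ α) :
    rateRatio h α = ∑ k ∈ Finset.Icc 1 α, h k 1 + h 1 0 - emptyRate h α := by
  induction α, hα using Nat.le_induction with
  | base => simp [rateRatio, emptyRate]
  | succ n hn ih =>
    rw [rateRatio_succ h hn, ih, emptyRate, emptyRate, sum_Icc_one_succ, sum_Icc_one_succ]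
    ring

theorem rateWeight_pos {h : ℕ → ℕ → ℝ} (h10 : 0 < h 1 0) (hr : ∀ α, 1 ≤ α → 0 < rateRatio h α) :
    ∀ n, 0 < rateWeight h n
  | 0 => by simp [rateWeight_zero]
  | 1 => by rwa [rateWeight_one]
  | n + 2 => by
    rw [rateWeight_succ h (by omega)]
    exact mul_pos (rateWeight_pos h10 hr (n + 1)) (hr _ (by omega))

theorem PositivityCondition.rateRatio_pos {h : ℕ → ℕ → ℝ} (hh : ∀ k β, 1 ≤ k → 0 ≤ h k β)
    (H : PositivityCondition h) {α : ℕ} (hα : 1 ≤ α) : 0 < rateRatio h α := by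
  rcases hα.eq_or_lt with rfl | hα
  · rw [rateRatio_one]
    exact lt_of_le_of_ne (hh 1 1 le_rfl) (right_ne_zero_of_mul H.1).symm
  · exact H.2 α hα

theorem PositivityCondition.rateWeight_pos {h : ℕ → ℕ → ℝ} (hh : ∀ k β, 1 ≤ k → 0 ≤ h k β)
    (H : PositivityCondition h) (n : ℕ) : 0 < rateWeight h n :=
  MMP.rateWeight_pos (lt_of_le_of_ne (hh 1 0 le_rfl) (left_ne_zero_of_mul H.1).symm)
    (fun _ hα => H.rateRatio_pos hh hα) n

/-- A stationary product weight determines the ratios of the weights of the rates. -/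
theorem IsGradientFlux.succ_eq {v : ℕ → ℝ} {h : ℕ → ℕ → ℝ}
    (hg : IsGradientFlux v h) {α : ℕ} (hα : 1 ≤ α) :
    h 1 0 * v (α + 1) * v 0 = v α * v 1 * rateRatio h α := by
  have := hg α 1
  have e : emptyRate h 1 = h 1 0 := by simp [emptyRate]
  simp only [netFlux, inFlux, outFlux, Finset.Icc_self, Finset.sum_singleton, Nat.sub_self, e]
    at this
  rw [rateRatio_eq_sub h hα]
  linarith

/-- At second occupation number 1 the in-flux has a single term, so the identity determines v(α + 1)
/ v(α) as a positive multiple of `rateRatio h α`. This gives positivity and v(n) = v(0) φ^n w(n),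
and the recursion passes from v to w. -/
theorem IsGradientFlux.positivity_and_compatibility {v : ℕ → ℝ} (hv : ∀ n, 0 < v n)
    {h : ℕ → ℕ → ℝ} (h10 : 0 < h 1 0) (hg : IsGradientFlux v h) :
    PositivityCondition h ∧ CompatibilityCondition h := by
  have hr : ∀ α, 1 ≤ α → 0 < rateRatio h α := by
    intro α hα
    have := hg.succ_eq hα
    have h1 : 0 < v α * v 1 * rateRatio h α := by
      rw [← this]
      exact mul_pos (mul_pos h10 (hv _)) (hv _)
    exact (pos_iff_pos_of_mul_pos h1).mp (mul_pos (hv _) (hv _))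
  have hw := rateWeight_pos h10 hr
  refine ⟨⟨?_, fun α hα => hr α (by omega)⟩, ?_⟩
  · have := hr 1 le_rfl
    rw [rateRatio_one] at this
    exact (mul_pos h10 this).ne'
  · rw [compatibilityCondition_iff hw]
    have hφ : 0 < 1 / h 1 0 * (v 1 / v 0) :=
      mul_pos (one_div_pos.mpr h10) (div_pos (hv _) (hv _))
    refine (rateRecursion_geometric (hv 0).ne' hφ.ne' ?_ h).mp (hg.rateRecursion hv)
    intro n
    have h0 := (hv 0).ne'
    have h1 := h10.ne'
    induction n with
    | zero => simp [rateWeight_zero]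
    | succ n ih =>
      rcases Nat.eq_zero_or_pos n with rfl | hn
      · simp only [zero_add, pow_one, rateWeight_one]
        field_simp
      · rw [rateWeight_succ h hn, pow_succ]
        have := hg.succ_eq hn
        have e : v (n + 1) = v n * (1 / h 1 0 * (v 1 / v 0)) * rateRatio h n := by
          field_simp
          linarith
        rw [e, ih]
        ring

/-! ### Exponential growth of nearly submultiplicative weights -/

section Growth

variable {w : ℕ → ℝ} {J : Set ℕ} {A : ℝ}

/-- Off J the ratio may rise by 1/j² per step. Adding 1/j compensates, so after any gap of J the
ratio exceeds its earlier value by at most 1/i. -/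
theorem ratio_add_inv_antitone
    (hJ : ∀ i, 2 ≤ i → i ∉ J → w (i + 1) / w i ≤ w i / w (i - 1) + 1 / (i : ℝ) ^ 2)
    {m : ℕ} (hm : 1 ≤ m) {i : ℕ} (hi : m ≤ i) {j : ℕ} (hij : i ≤ j)
    (hgap : ∀ l, m ≤ l → l ≤ j → l ∉ J) :
    w (j + 1) / w j + 1 / (j : ℝ) ≤ w (i + 1) / w i + 1 / (i : ℝ) := by
  induction j, hij using Nat.le_induction with
  | base => exact le_rfl
  | succ j hj ih =>
    have h1 := hJ (j + 1) (by omega) (hgap (j + 1) (by omega) le_rfl)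
    have h2 := ih fun l hl hlj => hgap l hl (by omega)
    rw [Nat.add_sub_cancel] at h1
    have hj0 : (0 : ℝ) < j := by
      have : 0 < j := by omega
      exact_mod_cast this
    -- The telescoping bound 1/(j+1)² ≤ 1/j - 1/(j+1).
    have h3 : 1 / ((j + 1 : ℕ) : ℝ) ^ 2 + 1 / ((j + 1 : ℕ) : ℝ) ≤ 1 / (j : ℝ) := by
      push_cast
      rw [div_add_div _ _ (by positivity) (by positivity), div_le_div_iff₀ (by positivity)
        (by positivity)]
      nlinarith [sq_nonneg (j : ℝ)]
    linarith

/-- A window in which the product of the ratios is small contains a small ratio. -/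
theorem exists_ratio_le (hw : ∀ n, 0 < w n) (m : ℕ) {k : ℕ} (hk : 0 < k) {L : ℝ}
    (hL : Real.log (w (m + k)) ≤ Real.log (w m) + k * L) :
    ∃ i, m ≤ i ∧ i < m + k ∧ w (i + 1) / w i ≤ Real.exp L := by
  by_contra! H
  have key : ∀ l, l ≤ k → 0 < l → Real.log (w m) + l * L < Real.log (w (m + l)) := by
    intro l
    induction l with
    | zero => intro _ h; omega
    | succ l ih =>
      intro hl _
      have h1 := H (m + l) (by omega) (by omega)
      have h2 : L < Real.log (w (m + l + 1)) - Real.log (w (m + l)) := by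
        rw [← Real.log_div (hw _).ne' (hw _).ne']
        exact (Real.lt_log_iff_exp_lt (div_pos (hw _) (hw _))).mpr h1
      push_cast
      rcases Nat.eq_zero_or_pos l with rfl | h0
      · simp only [add_zero] at h2
        simp only [zero_add, Nat.cast_zero, one_mul]
        linarith
      · have := ih (by omega) h0
        rw [← add_assoc]
        linarith
  linarith [key k le_rfl hk]

theorem log_le_of_submultiplicative (hw : ∀ n, 0 < w n) (hA : 1 ≤ A)
    (hsub : ∀ k ∈ J, ∀ m : ℕ, w (m + k) ≤ w m * w k * (A * ((m : ℝ) + k + 1) ^ 4))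
    {k : ℕ} (hk : k ∈ J) (m N : ℕ) (hN : m + k ≤ N) :
    Real.log (w (m + k)) ≤
      Real.log (w m) + Real.log (w k) + (Real.log A + 4 * Real.log (N + 1)) := by
  have h1 := Real.log_le_log (hw _) (hsub k hk m)
  have hp : (0 : ℝ) < (m : ℝ) + k + 1 := by positivity
  rw [Real.log_mul (mul_pos (hw _) (hw _)).ne' (by positivity), Real.log_mul (hw _).ne' (hw _).ne',
    Real.log_mul (by positivity) (by positivity), Real.log_pow] at h1
  have h2 : Real.log ((m : ℝ) + k + 1) ≤ Real.log (N + 1) := by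
    apply Real.log_le_log hp
    have : ((m + k : ℕ) : ℝ) ≤ N := by exact_mod_cast hN
    push_cast at this
    linarith
  push_cast at h1
  linarith

/-- Blocks of length k are peeled off n one at a time. Each costs the logarithm of the polynomial
factor, which is that logarithm divided by k per unit of length. -/
theorem log_le_mul_add (hw : ∀ n, 0 < w n) (hA : 1 ≤ A)
    (hsub : ∀ k ∈ J, ∀ m : ℕ, w (m + k) ≤ w m * w k * (A * ((m : ℝ) + k + 1) ^ 4))
    {k : ℕ} (hk : k ∈ J) (hk0 : 0 < k) {V : ℝ} (hV : ∀ n ≤ k, Real.log (w n) ≤ n * V) (N : ℕ) :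
    ∀ n ≤ N, Real.log (w n) ≤ n * (V + (Real.log A + 4 * Real.log (N + 1)) / k) := by
  have hk' : (0 : ℝ) < k := by exact_mod_cast hk0
  have hΛ : 0 ≤ Real.log A + 4 * Real.log (N + 1) := by
    have := Real.log_nonneg hA
    have : 0 ≤ Real.log ((N : ℝ) + 1) := Real.log_nonneg (by linarith [N.cast_nonneg (α := ℝ)])
    linarith
  intro n
  induction n using Nat.strong_induction_on with
  | _ n ih =>
  intro hn
  rcases le_or_gt n k with hnk | hnk
  · refine (hV n hnk).trans (mul_le_mul_of_nonneg_left ?_ (Nat.cast_nonneg _))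
    have := div_nonneg hΛ hk'.le
    linarith
  · obtain ⟨m, rfl⟩ : ∃ m, n = m + k := ⟨n - k, by omega⟩
    have h1 := log_le_of_submultiplicative hw hA hsub hk m N hn
    have h2 := ih m (by omega) (by omega)
    have h3 := hV k le_rfl
    push_cast
    have h4 : (k : ℝ) * ((Real.log A + 4 * Real.log (N + 1)) / k) =
      Real.log A + 4 * Real.log (N + 1) := by field_simp
    linarith

/-- Here log(k⁴ + 1) ≤ 5 log k = 10 log √k ≤ 10 √k, so a prefix as long as k⁴ still costs only
O(1/√k) per unit of length. -/
theorem window_error_le (hA : 1 ≤ A) {k : ℕ} (hk : 2 ≤ k) :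
    (Real.log A + 4 * Real.log (((k ^ 4 : ℕ) : ℝ) + 1)) / k ≤ (Real.log A + 40) / √(k : ℝ) := by
  have hk2 : (2 : ℝ) ≤ k := by exact_mod_cast hk
  have hs : 0 < √(k : ℝ) := Real.sqrt_pos.mpr (by linarith)
  have hsq : √(k : ℝ) * √(k : ℝ) = k := Real.mul_self_sqrt (by linarith)
  have hs1 : 1 ≤ √(k : ℝ) := by
    rw [Real.one_le_sqrt]
    linarith
  have hA0 := Real.log_nonneg hA
  have h1 : Real.log (((k ^ 4 : ℕ) : ℝ) + 1) ≤ 10 * √(k : ℝ) := by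
    have e : ((k ^ 4 : ℕ) : ℝ) + 1 ≤ (k : ℝ) ^ 5 := by
      push_cast
      have : (1 : ℝ) ≤ (k : ℝ) ^ 4 := one_le_pow₀ (by linarith)
      nlinarith
    have h2 := Real.log_le_log (by positivity) e
    have hlk : Real.log (k : ℝ) = Real.log √(k : ℝ) + Real.log √(k : ℝ) := by
      rw [← Real.log_mul hs.ne' hs.ne', hsq]
    rw [Real.log_pow, hlk] at h2
    have h3 := Real.log_le_sub_one_of_pos hs
    push_cast at h2 ⊢
    linarith
  rw [div_le_div_iff₀ (by linarith) hs]
  calc (Real.log A + 4 * Real.log (((k ^ 4 : ℕ) : ℝ) + 1)) * √(k : ℝ)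
      ≤ (Real.log A * √(k : ℝ) + 40 * √(k : ℝ)) * √(k : ℝ) := by
        apply mul_le_mul_of_nonneg_right _ hs.le
        nlinarith
    _ = (Real.log A + 40) * (√(k : ℝ) * √(k : ℝ)) := by ring
    _ = (Real.log A + 40) * k := by rw [hsq]

/-- From one good index to the next: an exponential bound up to `k ∈ J` extends with a small loss
either to all indices, or up to some `k' ∈ J` which is much larger than `k`. -/
theorem growth_step (hw : ∀ n, 0 < w n) (hA : 1 ≤ A)
    (hsub : ∀ k ∈ J, ∀ m : ℕ, w (m + k) ≤ w m * w k * (A * ((m : ℝ) + k + 1) ^ 4))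
    (hJ : ∀ i, 2 ≤ i → i ∉ J → w (i + 1) / w i ≤ w i / w (i - 1) + 1 / (i : ℝ) ^ 2)
    {k : ℕ} (hk : k ∈ J) (hk2 : 2 ≤ k) {V : ℝ} (hV0 : 0 ≤ V)
    (hV : ∀ n ≤ k, Real.log (w n) ≤ n * V) :
    (∀ n : ℕ, Real.log (w n) ≤ n * (V + (Real.log A + 41) / √(k : ℝ))) ∨
      ∃ k' ∈ J, k ^ 2 ≤ k' ∧
        ∀ n ≤ k', Real.log (w n) ≤ n * (V + (Real.log A + 41) / √(k : ℝ)) := by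
  have hkR : (2 : ℝ) ≤ k := by exact_mod_cast hk2
  have hs1 : 1 ≤ √(k : ℝ) := by
    rw [Real.one_le_sqrt]
    linarith
  have hsq : √(k : ℝ) * √(k : ℝ) = k := Real.mul_self_sqrt (by linarith)
  have hA0 := Real.log_nonneg hA
  set Λ := Real.log A + 4 * Real.log (((k ^ 4 : ℕ) : ℝ) + 1) with hΛ
  have hΛ0 : 0 ≤ Λ := by
    have : 0 ≤ Real.log (((k ^ 4 : ℕ) : ℝ) + 1) :=
      Real.log_nonneg (by linarith [(k ^ 4).cast_nonneg (α := ℝ)])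
    linarith
  have hΛk0 : 0 ≤ Λ / k := div_nonneg hΛ0 (by linarith)
  have herr : Λ / k ≤ (Real.log A + 40) / √(k : ℝ) := window_error_le hA hk2
  have herr2 : Λ / k + 1 / (k : ℝ) ^ 2 ≤ (Real.log A + 41) / √(k : ℝ) := by
    have : 1 / (k : ℝ) ^ 2 ≤ 1 / √(k : ℝ) := by
      apply one_div_le_one_div_of_le (by linarith)
      nlinarith
    have e : (Real.log A + 41) / √(k : ℝ) = (Real.log A + 40) / √(k : ℝ) + 1 / √(k : ℝ) := by
      ring
    linarith
  have hprefix := log_le_mul_add hw hA hsub hk (by omega) hV (k ^ 4)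
  have hprefix' : ∀ n ≤ k ^ 4, Real.log (w n) ≤ n * (V + (Real.log A + 41) / √(k : ℝ)) := by
    intro n hn
    refine (hprefix n hn).trans (mul_le_mul_of_nonneg_left ?_ (Nat.cast_nonneg _))
    have : 0 ≤ 1 / (k : ℝ) ^ 2 := by positivity
    linarith
  -- If J meets [k², k⁴], the bound up to k⁴ already reaches a suitable k'.
  by_cases hex : ∃ k' ∈ J, k ^ 2 ≤ k' ∧ k' ≤ k ^ 4
  · obtain ⟨k', h1, h2, h3⟩ := hex
    exact Or.inr ⟨k', h1, h2, fun n hn => hprefix' n (hn.trans h3)⟩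
  have hno : ∀ l, k ^ 2 ≤ l → l ≤ k ^ 4 → l ∉ J := fun l h1 h2 h3 => hex ⟨l, h3, h1, h2⟩
  -- The window of the last k indices before k⁴ lies entirely above k².
  have hpow : k ^ 2 + k ≤ k ^ 4 := by nlinarith [pow_pos (by omega : 0 < k) 2]
  have hk21 : 1 ≤ k ^ 2 := Nat.one_le_pow _ _ (by omega)
  obtain ⟨m, hm⟩ : ∃ m, k ^ 4 = m + k := ⟨k ^ 4 - k, by omega⟩
  -- Submultiplicativity bounds the product of the ratios over this window by exp(kV + Λ), so one of
  -- them is at most exp(V + Λ/k). It controls all later ratios for as long as J is avoided.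
  obtain ⟨i, hi1, hi2, hi3⟩ := exists_ratio_le (w := w) hw m (k := k) (by omega)
    (L := V + Λ / k) (by
      have h1 := log_le_of_submultiplicative hw hA hsub hk m (k ^ 4) hm.ge
      have h2 := hV k le_rfl
      have h3 : (k : ℝ) * (Λ / k) = Λ := by field_simp
      rw [mul_add, h3]
      linarith)
  have hik : k ^ 2 ≤ i := by omega
  have hratio : ∀ j, k ^ 4 ≤ j → (∀ l, k ^ 2 ≤ l → l ≤ j → l ∉ J) →
      Real.log (w (j + 1)) ≤ Real.log (w j) + (V + (Real.log A + 41) / √(k : ℝ)) := by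
    intro j hj hgap
    have h1 := ratio_add_inv_antitone hJ hk21 hik (by omega : i ≤ j) hgap
    have h2 : 1 / (i : ℝ) ≤ 1 / (k : ℝ) ^ 2 := by
      apply one_div_le_one_div_of_le (by positivity)
      exact_mod_cast hik
    have h3 : w (j + 1) / w j ≤ Real.exp (V + Λ / k) + 1 / (k : ℝ) ^ 2 := by
      have : 0 ≤ 1 / (j : ℝ) := by positivity
      linarith
    -- Since V ≥ 0, the exponential is at least 1, so the additive error 1/k² fits into the
    -- exponent.
    have h4 : Real.exp (V + Λ / k) + 1 / (k : ℝ) ^ 2 ≤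
        Real.exp (V + Λ / k + 1 / (k : ℝ) ^ 2) := by
      rw [Real.exp_add _ (1 / (k : ℝ) ^ 2)]
      have h5 : 1 ≤ Real.exp (V + Λ / k) := Real.one_le_exp (by linarith)
      have h6 := Real.add_one_le_exp (1 / (k : ℝ) ^ 2)
      have h7 : 0 ≤ 1 / (k : ℝ) ^ 2 := by positivity
      nlinarith
    have h5 := Real.log_le_log (div_pos (hw _) (hw _)) (h3.trans h4)
    rw [Real.log_exp, Real.log_div (hw _).ne' (hw _).ne'] at h5
    linarith
  have hext : ∀ n, k ^ 4 ≤ n → (∀ l, k ^ 2 ≤ l → l < n → l ∉ J) →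
      Real.log (w n) ≤ n * (V + (Real.log A + 41) / √(k : ℝ)) := by
    intro n hn
    induction n, hn using Nat.le_induction with
    | base => intro _; exact hprefix' _ le_rfl
    | succ n hn ih =>
      intro hgap
      have h1 := ih fun l h1 h2 => hgap l h1 (by omega)
      have h2 := hratio n hn fun l h1 h2 => hgap l h1 (by omega)
      push_cast
      linarith
  -- The extension runs up to the first element of J beyond k², or forever if there is none.
  by_cases hnext : ∃ k', k ^ 2 ≤ k' ∧ k' ∈ J
  · right
    classical
    refine ⟨Nat.find hnext, (Nat.find_spec hnext).2, (Nat.find_spec hnext).1, fun n hn => ?_⟩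
    rcases le_total n (k ^ 4) with h | h
    · exact hprefix' n h
    · refine hext n h fun l h1 h2 h3 => ?_
      exact Nat.find_min hnext (lt_of_lt_of_le h2 hn) ⟨h1, h3⟩
  · left
    intro n
    rcases le_total n (k ^ 4) with h | h
    · exact hprefix' n h
    · exact hext n h fun l h1 _ h3 => hnext ⟨l, h1, h3⟩

/-- Weights whose ratios increase noticeably only at indices at which the weights are nearly
submultiplicative grow at most exponentially. -/
theorem exists_pow_bound (hw0 : w 0 = 1) (hw : ∀ n, 0 < w n) (hA : 1 ≤ A)
    (hsub : ∀ k ∈ J, ∀ m : ℕ, w (m + k) ≤ w m * w k * (A * ((m : ℝ) + k + 1) ^ 4))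
    (hJ : ∀ i, 2 ≤ i → i ∉ J → w (i + 1) / w i ≤ w i / w (i - 1) + 1 / (i : ℝ) ^ 2) :
    ∃ B : ℝ, 0 < B ∧ ∀ n, w n ≤ B ^ n := by
  suffices H : ∃ K : ℝ, ∀ n : ℕ, Real.log (w n) ≤ n * K by
    obtain ⟨K, hK⟩ := H
    refine ⟨Real.exp K, Real.exp_pos _, fun n => ?_⟩
    rw [← Real.exp_nat_mul]
    exact (Real.log_le_iff_le_exp (hw n)).mp (hK n)
  have hfin : ∀ N : ℕ, ∃ V : ℝ, 0 ≤ V ∧ ∀ n ≤ N, Real.log (w n) ≤ n * V := by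
    intro N
    refine ⟨∑ i ∈ Finset.range (N + 1), |Real.log (w i)|,
      Finset.sum_nonneg fun _ _ => abs_nonneg _, fun n hn => ?_⟩
    rcases Nat.eq_zero_or_pos n with rfl | h0
    · simp [hw0]
    · have h1 : |Real.log (w n)| ≤ ∑ i ∈ Finset.range (N + 1), |Real.log (w i)| :=
        Finset.single_le_sum (f := fun i => |Real.log (w i)|) (fun _ _ => abs_nonneg _)
          (Finset.mem_range.mpr (by omega))
      have h2 : (1 : ℝ) ≤ n := by exact_mod_cast h0
      have h3 := le_abs_self (Real.log (w n))
      nlinarith [abs_nonneg (Real.log (w n))]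
  by_cases hex : ∃ k ∈ J, 4 ≤ k
  · obtain ⟨k₀, hk₀, hk₀4⟩ := hex
    obtain ⟨V₀, hV₀0, hV₀⟩ := hfin k₀
    set c := Real.log A + 41 with hc
    have hc0 : 0 ≤ c := by linarith [Real.log_nonneg hA]
    -- From one scale to the next √k at least doubles, so the losses c/√k are dominated by a
    -- geometric series with total at most 2c/√k₀.
    set K := V₀ + 2 * c / √(k₀ : ℝ) with hK
    have hsq : ∀ {k : ℕ}, 4 ≤ k → 0 < √(k : ℝ) := by
      intro k hk
      apply Real.sqrt_pos.mpr
      have : 0 < k := by omega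
      exact_mod_cast this
    refine ⟨K, ?_⟩
    -- If the global bound K failed, `growth_step` could never stop with a bound for all n. It would
    -- then produce prefixes of unbounded length on which K does hold. The term 2c/√k in the
    -- iterated bound is the reserve for losses still to come.
    by_contra hcon
    have iter : ∀ N : ℕ, ∃ k ∈ J, N ≤ k ∧ k₀ ≤ k ∧
        ∀ n ≤ k, Real.log (w n) ≤ n * (K - 2 * c / √(k : ℝ)) := by
      intro N
      induction N with
      | zero => exact ⟨k₀, hk₀, by omega, le_rfl, by simpa [hK] using hV₀⟩
      | succ N ih =>
        obtain ⟨k, hk, hNk, hk0, hV⟩ := ih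
        have hk4 : 4 ≤ k := by omega
        have hsk := hsq hk4
        have hVnn : 0 ≤ K - 2 * c / √(k : ℝ) := by
          have : 2 * c / √(k : ℝ) ≤ 2 * c / √(k₀ : ℝ) := by
            apply div_le_div_of_nonneg_left (by linarith) (hsq hk₀4)
            exact Real.sqrt_le_sqrt (by exact_mod_cast hk0)
          linarith
        rcases growth_step hw hA hsub hJ hk (by omega) hVnn hV with h | ⟨k', hk', hkk', h⟩
        · exfalso
          apply hcon
          intro n
          refine (h n).trans (mul_le_mul_of_nonneg_left ?_ (Nat.cast_nonneg _))
          have e : 2 * c / √(k : ℝ) = c / √(k : ℝ) + c / √(k : ℝ) := by ring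
          have : 0 ≤ c / √(k : ℝ) := div_nonneg hc0 hsk.le
          rw [e]
          linarith
        -- Since k ≥ 4, k' ≥ k² ≥ 4k. Hence √k' ≥ 2√k, and the reserve left at k' is at most half of
        -- the one at k.
        · have h4k : 4 * k ≤ k' := by nlinarith
          refine ⟨k', hk', by omega, by omega, fun n hn => (h n hn).trans
            (mul_le_mul_of_nonneg_left ?_ (Nat.cast_nonneg _))⟩
          have hs2 : 2 * √(k : ℝ) ≤ √(k' : ℝ) := by
            apply Real.le_sqrt_of_sq_le
            rw [mul_pow, Real.sq_sqrt (Nat.cast_nonneg _)]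
            have : ((4 * k : ℕ) : ℝ) ≤ k' := by exact_mod_cast h4k
            push_cast at this
            linarith
          have e1 : 2 * c / √(k' : ℝ) ≤ 2 * c / (2 * √(k : ℝ)) :=
            div_le_div_of_nonneg_left (by linarith) (by linarith) hs2
          have e2 : 2 * c / (2 * √(k : ℝ)) = c / √(k : ℝ) := by
            rw [mul_div_mul_left _ _ two_ne_zero]
          have e3 : 2 * c / √(k : ℝ) = c / √(k : ℝ) + c / √(k : ℝ) := by ring
          linarith
    apply hcon
    intro n
    obtain ⟨k, _, hnk, hk0, hV⟩ := iter n
    refine (hV n hnk).trans (mul_le_mul_of_nonneg_left ?_ (Nat.cast_nonneg _))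
    have : 0 ≤ 2 * c / √(k : ℝ) := div_nonneg (by linarith) (Real.sqrt_nonneg _)
    linarith
  · have hno : ∀ l, 4 ≤ l → l ∉ J := fun l h1 h2 => hex ⟨l, h2, h1⟩
    obtain ⟨V, hV0, hV⟩ := hfin 4
    -- J has no elements from 4 on, so all later ratios are bounded by R.
    set R := w (4 + 1) / w 4 + 1 / ((4 : ℕ) : ℝ)
    refine ⟨max V (Real.log R), fun n => ?_⟩
    rcases le_total n 4 with h | h
    · exact (hV n h).trans (mul_le_mul_of_nonneg_left (le_max_left _ _) (Nat.cast_nonneg _))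
    · induction n, h using Nat.le_induction with
      | base =>
        exact (hV 4 le_rfl).trans
          (mul_le_mul_of_nonneg_left (le_max_left _ _) (Nat.cast_nonneg _))
      | succ n hn ih =>
        have h1 := ratio_add_inv_antitone hJ (m := 4) (by omega) le_rfl hn
          fun l hl _ => hno l hl
        have h2 : w (n + 1) / w n ≤ R := by
          have : 0 ≤ 1 / (n : ℝ) := by positivity
          exact (le_add_of_nonneg_right this).trans h1
        have h3 := Real.log_le_log (div_pos (hw _) (hw _)) h2
        rw [Real.log_div (hw _).ne' (hw _).ne'] at h3
        have h4 := le_max_right V (Real.log R)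
        push_cast
        linarith

end Growth

/-! ### Growth of the weights under the growth condition on the rates -/

theorem RateBound.exists_target {h : ℕ → ℕ → ℝ} (hG : RateBound (targetRates h)) :
    ∃ C : ℝ, 0 < C ∧ ∀ α β : ℕ, ∑ k ∈ Finset.Icc 1 α, (k : ℝ) * h k β ≤ C * ((α : ℝ) + β) := by
  obtain ⟨C, hC, H⟩ := hG
  refine ⟨C, hC, fun α β => ?_⟩
  rcases Nat.eq_zero_or_pos α with rfl | hα
  · simpa using mul_nonneg hC.le (Nat.cast_nonneg β)
  · refine le_trans (le_of_eq (Finset.sum_congr rfl fun k hk => ?_)) (H α β hα)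
    rw [Finset.mem_Icc] at hk
    rw [targetRates, if_pos hk]

theorem sum_rates_le {h : ℕ → ℕ → ℝ} (hh : ∀ k β, 1 ≤ k → 0 ≤ h k β) {C : ℝ}
    (hC : ∀ α β : ℕ, ∑ k ∈ Finset.Icc 1 α, (k : ℝ) * h k β ≤ C * ((α : ℝ) + β)) (α β : ℕ) :
    ∑ k ∈ Finset.Icc 1 α, h k β ≤ C * ((α : ℝ) + β) := by
  refine (Finset.sum_le_sum fun k hk => ?_).trans (hC α β)
  have h1 : (1 : ℝ) ≤ k := by exact_mod_cast (Finset.mem_Icc.mp hk).1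
  nlinarith [hh k β (Finset.mem_Icc.mp hk).1]

theorem emptyRate_nonneg {h : ℕ → ℕ → ℝ} (hh : ∀ k β, 1 ≤ k → 0 ≤ h k β) (n : ℕ) :
    0 ≤ emptyRate h n :=
  Finset.sum_nonneg fun k hk => hh k 0 (Finset.mem_Icc.mp hk).1

/-- The growth condition forces the weights to grow at most exponentially. -/
theorem rateWeight_le_pow {h : ℕ → ℕ → ℝ} (hh : ∀ k β, 1 ≤ k → 0 ≤ h k β)
    (hG : RateBound (targetRates h)) (hw : ∀ n, 0 < rateWeight h n)
    (hg : IsGradientFlux (rateWeight h) h) :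
    ∃ B : ℝ, 0 < B ∧ ∀ n, rateWeight h n ≤ B ^ n := by
  obtain ⟨C, hC0, hC⟩ := hG.exists_target
  have hS := sum_rates_le hh hC
  set w := rateWeight h with hwdef
  have hratio : ∀ k, 1 ≤ k → w (k + 1) / w k = rateRatio h k := by
    intro k hk
    rw [hwdef, rateWeight_succ h hk, mul_div_cancel_left₀ _ (hw k).ne']
  have hw1 := hw 1
  have hr_le : ∀ k, 1 ≤ k → rateRatio h k ≤ C * ((k : ℝ) + 1) := by
    intro k hk
    have h1 := hS k 1
    rw [rateRatio_eq_sub h hk]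
    have : h 1 0 ≤ emptyRate h k :=
      Finset.single_le_sum (f := fun k => h k 0) (fun i hi => hh i 0 (Finset.mem_Icc.mp hi).1)
        (Finset.mem_Icc.mpr ⟨le_rfl, hk⟩)
    push_cast at h1
    linarith
  have hA0 : 0 ≤ C * (2 * C) / w 1 := by positivity
  -- J consists of the indices where g^k_{*,1} is at least 1/k²: a threshold small enough to be
  -- summable and large enough to divide by at polynomial cost.
  refine exists_pow_bound (J := {k | 1 ≤ k ∧ 1 / (k : ℝ) ^ 2 ≤ h k 1})
    (A := 1 + C * (2 * C) / w 1) (rateWeight_zero h) hw (by linarith) ?_ ?_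
  · rintro k ⟨hk, hkh⟩ m
    have hk1 : (1 : ℝ) ≤ k := by exact_mod_cast hk
    have hE := hg m (k + 1)
    -- Only the term i = k of the in-flux at (m, k + 1) is kept; it contains w(m + k) and leaves one
    -- particle on the second site before the jump.
    have hterm : h k 1 * w (m + k) * w 1 ≤ inFlux w h m (k + 1) := by
      have : (fun i => h i (k + 1 - i) * w (m + i) * w (k + 1 - i)) k ≤ inFlux w h m (k + 1) :=
        Finset.single_le_sum (f := fun i => h i (k + 1 - i) * w (m + i) * w (k + 1 - i))
          (fun i hi => mul_nonneg (mul_nonneg (hh _ _ (Finset.mem_Icc.mp hi).1) (hw _).le)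
            (hw _).le) (Finset.mem_Icc.mpr ⟨hk, by omega⟩)
      simpa using this
    rw [netFlux, sub_eq_iff_eq_add, outFlux] at hE
    have hT : h k 1 * w (m + k) * w 1 ≤ w m * w (k + 1) * (2 * C * ((m : ℝ) + k + 1)) := by
      have hb1 := hS m (k + 1)
      have hb2 : emptyRate h (k + 1) ≤ C * (((k + 1 : ℕ) : ℝ) + (0 : ℕ)) := hS (k + 1) 0
      have hb3 := emptyRate_nonneg hh m
      have hm0 : (0 : ℝ) ≤ m := Nat.cast_nonneg m
      push_cast at hb1 hb2
      calc h k 1 * w (m + k) * w 1 ≤ inFlux w h m (k + 1) := hterm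
        _ = w m * w (k + 1) *
            (∑ i ∈ Finset.Icc 1 m, h i (k + 1) + emptyRate h (k + 1) - emptyRate h m) := by
          rw [hE]; ring
        _ ≤ w m * w (k + 1) * (2 * C * ((m : ℝ) + k + 1)) := by
          apply mul_le_mul_of_nonneg_left _ (mul_pos (hw _) (hw _)).le
          nlinarith
    have hwk : w (k + 1) ≤ w k * (C * ((k : ℝ) + 1)) := by
      have := hr_le k hk
      rw [← hratio k hk, div_le_iff₀ (hw k)] at this
      linarith
    have hlow : w (m + k) * w 1 ≤ (k : ℝ) ^ 2 * (h k 1 * w (m + k) * w 1) := by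
      have h1 : 1 ≤ (k : ℝ) ^ 2 * h k 1 := by
        rwa [div_le_iff₀ (by positivity), mul_comm] at hkh
      have h2 : 0 ≤ w (m + k) * w 1 := (mul_pos (hw _) (hw _)).le
      nlinarith
    have hfin : w (m + k) * w 1 ≤
        w m * w k * (C * (2 * C) * ((m : ℝ) + k + 1) ^ 4) := by
      have hm0 : (0 : ℝ) ≤ m := Nat.cast_nonneg m
      -- The fourth power collects k² from the threshold, k + 1 from w(k + 1) / w(k), and m + k + 1
      -- from the total flux.
      have hpoly : (k : ℝ) ^ 2 * (((k : ℝ) + 1) * ((m : ℝ) + k + 1)) ≤ ((m : ℝ) + k + 1) ^ 4 := by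
        have a1 : (k : ℝ) ^ 2 ≤ ((m : ℝ) + k + 1) ^ 2 := by gcongr; linarith
        have a2 : ((k : ℝ) + 1) * ((m : ℝ) + k + 1) ≤ ((m : ℝ) + k + 1) ^ 2 := by nlinarith
        calc _ ≤ ((m : ℝ) + k + 1) ^ 2 * ((m : ℝ) + k + 1) ^ 2 :=
              mul_le_mul a1 a2 (by positivity) (by positivity)
          _ = _ := by ring
      calc w (m + k) * w 1 ≤ (k : ℝ) ^ 2 * (h k 1 * w (m + k) * w 1) := hlow
        _ ≤ (k : ℝ) ^ 2 * (w m * (w k * (C * ((k : ℝ) + 1))) * (2 * C * ((m : ℝ) + k + 1))) := by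
          apply mul_le_mul_of_nonneg_left _ (by positivity)
          refine hT.trans (mul_le_mul_of_nonneg_right ?_ (by positivity))
          exact mul_le_mul_of_nonneg_left hwk (hw m).le
        _ = w m * w k * (C * (2 * C) * ((k : ℝ) ^ 2 * (((k : ℝ) + 1) * ((m : ℝ) + k + 1)))) := by
          ring
        _ ≤ _ := by
          apply mul_le_mul_of_nonneg_left _ (mul_pos (hw _) (hw _)).le
          exact mul_le_mul_of_nonneg_left hpoly (by positivity)
    rw [← le_div_iff₀ hw1] at hfin
    refine hfin.trans ?_
    rw [mul_div_assoc]
    apply mul_le_mul_of_nonneg_left _ (mul_pos (hw _) (hw _)).le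
    rw [mul_div_right_comm]
    apply mul_le_mul_of_nonneg_right _ (by positivity)
    linarith
  -- The ratio rises at i by g^i_{*,1} - g^i_{*,0}, which is at most g^i_{*,1} and hence below 1/i²
  -- outside J.
  · intro i hi hiJ
    have h1 : h i 1 < 1 / (i : ℝ) ^ 2 := by
      by_contra hlt
      exact hiJ ⟨by omega, not_lt.mp hlt⟩
    obtain ⟨j, rfl⟩ : ∃ j, i = j + 1 := ⟨i - 1, by omega⟩
    rw [Nat.add_sub_cancel, hratio (j + 1) (by omega), hratio j (by omega),
      rateRatio_succ h (by omega)]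
    have := hh (j + 1) 0 (by omega)
    linarith

/-! ### Series over pairs of occupation numbers -/

theorem summable_antidiagonal_iff {f : ℕ × ℕ → ℝ} :
    Summable (fun x : Σ n : ℕ, Finset.HasAntidiagonal.antidiagonal n => f x.2.1) ↔ Summable f :=
  (Finset.HasAntidiagonal.sigmaAntidiagonalEquivProd (A := ℕ)).summable_iff (f := f)

theorem tsum_coe_antidiagonal (f : ℕ × ℕ → ℝ) (n : ℕ) :
    ∑' q : Finset.HasAntidiagonal.antidiagonal n, f q.1 =
      ∑ q ∈ Finset.HasAntidiagonal.antidiagonal n, f q := by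
  rw [tsum_fintype]
  exact Finset.sum_coe_sort (Finset.HasAntidiagonal.antidiagonal n) (fun q => f q)

theorem tsum_antidiagonal {f : ℕ × ℕ → ℝ} (hf : Summable f) :
    ∑' q, f q = ∑' n, ∑ q ∈ Finset.HasAntidiagonal.antidiagonal n, f q := by
  rw [← (Finset.HasAntidiagonal.sigmaAntidiagonalEquivProd (A := ℕ)).tsum_eq f]
  refine ((summable_antidiagonal_iff.mpr hf).tsum_sigma'
    (fun n => (hasSum_fintype _).summable)).trans ?_
  exact tsum_congr fun n => tsum_coe_antidiagonal f n

theorem summable_of_antidiagonal {f : ℕ × ℕ → ℝ} (hf0 : ∀ q, 0 ≤ f q)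
    (hf : Summable fun n => ∑ q ∈ Finset.HasAntidiagonal.antidiagonal n, f q) : Summable f := by
  refine summable_antidiagonal_iff.mp ((summable_sigma_of_nonneg (fun _ => hf0 _)).mpr
    ⟨fun n => (hasSum_fintype _).summable, hf.congr fun n => ?_⟩)
  exact (tsum_coe_antidiagonal f n).symm

theorem sum_antidiagonal_of_summable {f : ℕ × ℕ → ℝ} (hf : Summable f) :
    Summable fun n => ∑ q ∈ Finset.HasAntidiagonal.antidiagonal n, f q :=
  (summable_antidiagonal_iff.mpr hf).sigma.congr fun n => tsum_coe_antidiagonal f n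

/-! ### Summability of the fluxes and duality between jumps and net flux -/

section Flux

variable {v : ℕ → ℝ} {h : ℕ → ℕ → ℝ} {C : ℝ}

theorem summable_weight_mul_add (hv : ∀ n, 0 ≤ v n) (hv1 : Summable v)
    (hvm : Summable fun n : ℕ => (n : ℝ) * v n) :
    Summable fun q : ℕ × ℕ => v q.1 * v q.2 * ((q.1 : ℝ) + q.2) := by
  have h1 := hvm.mul_of_nonneg hv1 (fun n => mul_nonneg n.cast_nonneg (hv n)) hv
  have h2 := hv1.mul_of_nonneg hvm hv (fun n => mul_nonneg n.cast_nonneg (hv n))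
  refine (h1.add h2).congr fun q => ?_
  ring

theorem outFlux_nonneg (hv : ∀ n, 0 ≤ v n) (hh : ∀ k β, 1 ≤ k → 0 ≤ h k β) (m n : ℕ) :
    0 ≤ outFlux v h m n :=
  mul_nonneg (mul_nonneg (hv _) (hv _))
    (Finset.sum_nonneg fun k hk => hh k n (Finset.mem_Icc.mp hk).1)

theorem inFlux_nonneg (hv : ∀ n, 0 ≤ v n) (hh : ∀ k β, 1 ≤ k → 0 ≤ h k β) (m n : ℕ) :
    0 ≤ inFlux v h m n :=
  Finset.sum_nonneg fun k hk =>
    mul_nonneg (mul_nonneg (hh k _ (Finset.mem_Icc.mp hk).1) (hv _)) (hv _)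

variable (hv : ∀ n, 0 ≤ v n) (hv1 : Summable v) (hvm : Summable fun n : ℕ => (n : ℝ) * v n)
  (hh : ∀ k β, 1 ≤ k → 0 ≤ h k β)
  (hC : ∀ α β : ℕ, ∑ k ∈ Finset.Icc 1 α, (k : ℝ) * h k β ≤ C * ((α : ℝ) + β))

include hv hv1 hvm hh hC

theorem summable_outFlux : Summable fun q : ℕ × ℕ => outFlux v h q.1 q.2 := by
  refine Summable.of_nonneg_of_le (fun q => outFlux_nonneg hv hh _ _) (fun q => ?_)
    ((summable_weight_mul_add hv hv1 hvm).mul_left C)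
  rw [outFlux, ← mul_assoc, mul_comm C, mul_assoc (v q.1 * v q.2)]
  exact mul_le_mul_of_nonneg_left (sum_rates_le hh hC _ _) (mul_nonneg (hv _) (hv _))

/-- A nonnegative series may be grouped along antidiagonals, where in-flux and out-flux have the
same sums. -/
theorem summable_inFlux : Summable fun q : ℕ × ℕ => inFlux v h q.1 q.2 := by
  refine summable_of_antidiagonal (fun q => inFlux_nonneg hv hh _ _) ?_
  refine (sum_antidiagonal_of_summable (summable_outFlux hv hv1 hvm hh hC)).congr fun n => ?_
  have := sum_antidiagonal_inFlux v h (fun _ _ => 1) n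
  simp only [mul_one] at this
  rw [this]
  rfl

/-- Mean change of a function of two occupation numbers under a jump. -/
theorem tsum_jump_eq_tsum_netFlux {φ : ℕ → ℕ → ℝ} {B : ℝ} (hφ : ∀ m n, |φ m n| ≤ B) :
    ∑' q : ℕ × ℕ, v q.1 * v q.2 *
        ∑ k ∈ Finset.Icc 1 q.1, h k q.2 * (φ (q.1 - k) (q.2 + k) - φ q.1 q.2) =
      ∑' q : ℕ × ℕ, netFlux v h q.1 q.2 * φ q.1 q.2 := by
  have hB : 0 ≤ B := (abs_nonneg _).trans (hφ 0 0)
  have hout := summable_outFlux hv hv1 hvm hh hC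
  have hin := summable_inFlux hv hv1 hvm hh hC
  have s1 : Summable fun q : ℕ × ℕ => v q.1 * v q.2 *
      ∑ k ∈ Finset.Icc 1 q.1, h k q.2 * φ (q.1 - k) (q.2 + k) := by
    refine Summable.of_norm_bounded (hout.mul_right B) fun q => ?_
    rw [Real.norm_eq_abs, abs_mul, abs_of_nonneg (mul_nonneg (hv _) (hv _)), outFlux,
      mul_assoc (v q.1 * v q.2), Finset.sum_mul]
    refine mul_le_mul_of_nonneg_left ?_ (mul_nonneg (hv _) (hv _))
    refine (Finset.abs_sum_le_sum_abs _ _).trans (Finset.sum_le_sum fun k hk => ?_)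
    have := hh k q.2 (Finset.mem_Icc.mp hk).1
    rw [abs_mul, abs_of_nonneg this]
    exact mul_le_mul_of_nonneg_left (hφ _ _) this
  have s2 : Summable fun q : ℕ × ℕ => outFlux v h q.1 q.2 * φ q.1 q.2 := by
    refine Summable.of_norm_bounded (hout.mul_right B) fun q => ?_
    rw [Real.norm_eq_abs, abs_mul, abs_of_nonneg (outFlux_nonneg hv hh _ _)]
    exact mul_le_mul_of_nonneg_left (hφ _ _) (outFlux_nonneg hv hh _ _)
  have s3 : Summable fun q : ℕ × ℕ => inFlux v h q.1 q.2 * φ q.1 q.2 := by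
    refine Summable.of_norm_bounded (hin.mul_right B) fun q => ?_
    rw [Real.norm_eq_abs, abs_mul, abs_of_nonneg (inFlux_nonneg hv hh _ _)]
    exact mul_le_mul_of_nonneg_left (hφ _ _) (inFlux_nonneg hv hh _ _)
  have e : ∑' q : ℕ × ℕ, v q.1 * v q.2 *
      ∑ k ∈ Finset.Icc 1 q.1, h k q.2 * φ (q.1 - k) (q.2 + k) =
      ∑' q : ℕ × ℕ, inFlux v h q.1 q.2 * φ q.1 q.2 := by
    -- Absolute summability permits grouping by a + b, and on each finite antidiagonal the
    -- reindexing of jumps applies.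
    rw [tsum_antidiagonal s1, tsum_antidiagonal s3]
    exact tsum_congr fun n => (sum_antidiagonal_inFlux v h φ n).symm
  simp only [netFlux, sub_mul, mul_sub, Finset.sum_sub_distrib]
  rw [s3.tsum_sub s2, ← e, ← s1.tsum_sub]
  · refine tsum_congr fun q => ?_
    rw [outFlux, ← Finset.sum_mul, mul_assoc (v q.1 * v q.2)]
  · exact s2.congr fun q => by rw [outFlux, mul_assoc (v q.1 * v q.2)]

theorem tsum_netFlux : ∑' q : ℕ × ℕ, netFlux v h q.1 q.2 = 0 := by
  have := tsum_jump_eq_tsum_netFlux hv hv1 hvm hh hC (φ := fun _ _ => 1) (B := 1)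
    (fun _ _ => by simp)
  simpa using this.symm

end Flux

/-! ### Doubly stochastic transition probabilities -/

/-- Translation by y - x turns p(x, y) into p(y, 2y - x), so column sums are row sums after the
reflection x ↦ 2y - x. -/
theorem IsTransitionProbability.swap_of_translationInvariant {X : Type*} [AddCommGroup X]
    {p : X → X → ℝ} (hp : IsTransitionProbability p) (ht : IsTranslationInvariant p) :
    IsTransitionProbability fun x y => p y x := by
  refine ⟨fun x y => hp.nonneg y x, fun y => ?_⟩
  have h1 := (Equiv.subLeft (y + y)).hasSum_iff.mpr (hp.hasSum_one y)
  refine h1.congr_fun ?_ |> id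
  intro x
  have := ht x y (y - x)
  simp only [Function.comp, Equiv.subLeft_apply]
  rw [← this]
  congr 1 <;> abel

section DoublyStochastic

variable {X : Type*} {p : X → X → ℝ}

theorem IsTransitionProbability.summable_fst (hp : IsTransitionProbability p) {s : X → ℝ}
    (hs : Summable s) : Summable fun q : X × X => p q.1 q.2 * s q.1 := by
  rw [← summable_abs_iff]
  rw [summable_prod_of_nonneg fun _ => abs_nonneg _]
  have e : ∀ x y, |p x y * s x| = p x y * |s x| := fun x y => by
    rw [abs_mul, abs_of_nonneg (hp.nonneg x y)]
  simp only [e]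
  refine ⟨fun x => (hp.hasSum_one x).summable.mul_right _, hs.abs.congr fun x => ?_⟩
  rw [tsum_mul_right, (hp.hasSum_one x).tsum_eq, one_mul]

theorem IsTransitionProbability.hasSum_fst (hp : IsTransitionProbability p) {s : X → ℝ}
    (hs : Summable s) : HasSum (fun q : X × X => p q.1 q.2 * s q.1) (∑' x, s x) := by
  have h1 := hp.summable_fst hs
  have h2 : ∑' q : X × X, p q.1 q.2 * s q.1 = ∑' x, s x := by
    rw [h1.tsum_prod]
    refine tsum_congr fun x => ?_
    simp only
    rw [tsum_mul_right, (hp.hasSum_one x).tsum_eq, one_mul]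
  exact h2 ▸ h1.hasSum

theorem IsTransitionProbability.hasSum_snd (hq : IsTransitionProbability fun x y => p y x)
    {s : X → ℝ} (hs : Summable s) :
    HasSum (fun q : X × X => p q.1 q.2 * s q.2) (∑' x, s x) :=
  (Equiv.prodComm X X).hasSum_iff.mp (hq.hasSum_fst hs)

/-- The product splits into four sums: the terms s_x a_x and s_y a_y use that p is doubly
stochastic, the two cross terms use the weight condition with constant M. It provides the dominating
series both pointwise (s = η) and in mean (s constant). -/
theorem summable_weight_pair (hp : IsTransitionProbability p)
    (hq : IsTransitionProbability fun x y => p y x) {a : X → ℝ} (ha : IsWeight p a)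
    {s : X → ℝ} (hs0 : ∀ x, 0 ≤ s x) (hs : Summable fun x => s x * a x) :
    Summable fun q : X × X => p q.1 q.2 * ((s q.1 + s q.2) * (a q.1 + a q.2)) := by
  obtain ⟨M, hM⟩ := ha.bound
  have hout0 : ∀ x, 0 ≤ ∑' y, p x y * a y := fun x =>
    tsum_nonneg fun y => mul_nonneg (hp.nonneg _ _) (ha.pos y).le
  have hin0 : ∀ x, 0 ≤ ∑' y, a y * p y x := fun x =>
    tsum_nonneg fun y => mul_nonneg (ha.pos y).le (hp.nonneg _ _)
  have h1 := (hp.hasSum_fst hs).summable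
  have h2 := (hq.hasSum_snd hs).summable
  have h3 : Summable fun q : X × X => s q.1 * (p q.1 q.2 * a q.2) := by
    have hnn : ∀ q : X × X, 0 ≤ s q.1 * (p q.1 q.2 * a q.2) := fun q =>
      mul_nonneg (hs0 _) (mul_nonneg (hp.nonneg _ _) (ha.pos _).le)
    refine (summable_prod_of_nonneg hnn).mpr ⟨?_, ?_⟩
    · exact fun x => (ha.summable_out x).mul_left (s x)
    refine Summable.of_nonneg_of_le (fun x => ?_) (fun x => ?_) (hs.mul_left M)
    · simp only [tsum_mul_left]
      exact mul_nonneg (hs0 x) (hout0 x)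
    · simp only [tsum_mul_left]
      calc s x * ∑' y, p x y * a y ≤ s x * (M * a x) :=
            mul_le_mul_of_nonneg_left (by linarith [hM x, hin0 x]) (hs0 x)
        _ = _ := by ring
  have h4 : Summable fun q : X × X => s q.1 * (a q.2 * p q.2 q.1) := by
    have hnn : ∀ q : X × X, 0 ≤ s q.1 * (a q.2 * p q.2 q.1) := fun q =>
      mul_nonneg (hs0 _) (mul_nonneg (ha.pos _).le (hp.nonneg _ _))
    refine (summable_prod_of_nonneg hnn).mpr ⟨?_, ?_⟩
    · exact fun x => (ha.summable_in x).mul_left (s x)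
    refine Summable.of_nonneg_of_le (fun x => ?_) (fun x => ?_) (hs.mul_left M)
    · simp only [tsum_mul_left]
      exact mul_nonneg (hs0 x) (hin0 x)
    · simp only [tsum_mul_left]
      calc s x * ∑' y, a y * p y x ≤ s x * (M * a x) :=
            mul_le_mul_of_nonneg_left (by linarith [hM x, hout0 x]) (hs0 x)
        _ = _ := by ring
  have h5 : Summable fun q : X × X => s q.2 * (a q.1 * p q.1 q.2) :=
    (Equiv.prodComm X X).summable_iff.mpr h4
  refine (((h1.add h2).add h3).add h5).congr fun q => ?_
  ring

end DoublyStochastic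

open Filter Topology

/-! ### Configurations -/

section Config

variable {X : Type*} {a : X → ℝ}

theorem IsWeight.nonneg {p : X → X → ℝ} (ha : IsWeight p a) (x : X) : 0 ≤ a x := (ha.pos x).le

theorem summable_configDist (ha : ∀ x, 0 ≤ a x) (η ζ : Config a) :
    Summable fun x => |(η.1 x : ℝ) - (ζ.1 x : ℝ)| * a x := by
  refine Summable.of_nonneg_of_le (fun x => mul_nonneg (abs_nonneg _) (ha x)) (fun x => ?_)
    (η.2.add ζ.2)
  rw [← add_mul]
  refine mul_le_mul_of_nonneg_right ?_ (ha x)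
  refine (abs_sub _ _).trans ?_
  simp

theorem configDist_nonneg (ha : ∀ x, 0 ≤ a x) (η ζ : Config a) : 0 ≤ configDist η ζ :=
  tsum_nonneg fun x => mul_nonneg (abs_nonneg _) (ha x)

theorem IsLip.mono (ha : ∀ x, 0 ≤ a x) {K K' : ℝ} {f : Config a → ℝ} (hf : IsLip K f)
    (hK : K ≤ K') : IsLip K' f := fun η ζ =>
  (hf η ζ).trans (mul_le_mul_of_nonneg_right hK (configDist_nonneg ha η ζ))

/-- The configuration with all particles outside of `V` removed. -/
noncomputable def restrictTo (a : X → ℝ) (V : Finset X) (η : X → ℕ) : Config a :=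
  ⟨fun x => by classical exact if x ∈ V then η x else 0, by
    refine summable_of_hasFiniteSupport ?_
    refine V.finite_toSet.subset fun x hx => ?_
    by_contra h
    simp [Finset.mem_coe.not.mp h] at hx⟩

theorem restrictTo_apply_mem {V : Finset X} {x : X} (hx : x ∈ V) (η : X → ℕ) :
    (restrictTo a V η).1 x = η x := by simp [restrictTo, hx]

theorem restrictTo_apply_not_mem {V : Finset X} {x : X} (hx : x ∉ V) (η : X → ℕ) :
    (restrictTo a V η).1 x = 0 := by simp [restrictTo, hx]

theorem configDist_restrictTo_le (ha : ∀ x, 0 ≤ a x) (V : Finset X) (η ζ : Config a) :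
    configDist (restrictTo a V η.1) (restrictTo a V ζ.1) ≤ configDist η ζ := by
  refine (summable_configDist ha _ _).tsum_le_tsum (fun x => ?_) (summable_configDist ha _ _)
  by_cases hx : x ∈ V
  · simp only [restrictTo_apply_mem hx, le_refl]
  · simp only [restrictTo_apply_not_mem hx, Nat.cast_zero, sub_self, abs_zero, zero_mul]
    exact mul_nonneg (abs_nonneg _) (ha x)

theorem tendsto_configDist_restrictTo (ha : ∀ x, 0 ≤ a x) (η : Config a) :
    Tendsto (fun V : Finset X => configDist (restrictTo a V η.1) η) atTop (𝓝 0) := by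
  have h1 : Tendsto (fun V : Finset X => ∑' x, (η.1 x : ℝ) * a x - ∑ x ∈ V, (η.1 x : ℝ) * a x)
      atTop (𝓝 0) := by
    have h2 : HasSum (fun x => (η.1 x : ℝ) * a x) (∑' x, (η.1 x : ℝ) * a x) :=
      Summable.hasSum η.2
    simpa using (tendsto_const_nhds (x := ∑' x, (η.1 x : ℝ) * a x)).sub h2
  refine squeeze_zero (fun V => configDist_nonneg ha _ _) (fun V => ?_) h1
  rw [configDist]
  have e : ∀ x, |((restrictTo a V η.1).1 x : ℝ) - (η.1 x : ℝ)| * a x =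
      (η.1 x : ℝ) * a x - (by classical exact if x ∈ V then (η.1 x : ℝ) * a x else 0) := by
    intro x
    by_cases hx : x ∈ V
    · simp [restrictTo_apply_mem hx, hx]
    · simp [restrictTo_apply_not_mem hx, hx]
  have hV : HasSum (fun x => (by classical exact if x ∈ V then (η.1 x : ℝ) * a x else 0 : ℝ))
      (∑ x ∈ V, (η.1 x : ℝ) * a x) := by
    classical
    have : HasSum (fun x => if x ∈ V then (η.1 x : ℝ) * a x else 0)
        (∑ x ∈ V, if x ∈ V then (η.1 x : ℝ) * a x else 0) :=
      hasSum_sum_of_ne_finset_zero fun x hx => by simp [hx]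
    rwa [Finset.sum_congr rfl (g := fun x => (η.1 x : ℝ) * a x)
      (fun x hx => by simp [hx])] at this
  simp only [e]
  rw [Summable.tsum_sub η.2 hV.summable, hV.tsum_eq]

variable {f : Config a → ℝ} {K : ℝ}

theorem IsLip.restrictTo (ha : ∀ x, 0 ≤ a x) (hK : 0 ≤ K) (hf : IsLip K f) (V : Finset X) :
    IsLip K fun η : Config a => f (restrictTo a V η.1) := fun η ζ =>
  (hf _ _).trans (mul_le_mul_of_nonneg_left (configDist_restrictTo_le ha V η ζ) hK)

theorem IsLip.tendsto_restrictTo (ha : ∀ x, 0 ≤ a x) (hf : IsLip K f) (η : Config a) :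
    Tendsto (fun V : Finset X => f (MMP.restrictTo a V η.1)) atTop (𝓝 (f η)) := by
  rw [tendsto_iff_dist_tendsto_zero]
  have h1 := (tendsto_configDist_restrictTo ha η).const_mul K
  rw [mul_zero] at h1
  exact squeeze_zero (fun V => dist_nonneg) (fun V => hf _ _) h1

theorem measurable_of_dependsOn {X : Type*} {F : (X → ℕ) → ℝ} {V : Finset X}
    (hF : DependsOn F (V : Set X)) : Measurable F := by
  classical
  have e : F = (fun z : V → ℕ => F fun x => if h : x ∈ V then z ⟨x, h⟩ else 0) ∘
      (fun η (x : V) => η x.1) := by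
    funext η
    refine hF fun x hx => ?_
    have : x ∈ V := hx
    simp [this]
  rw [e]
  refine Measurable.comp (measurable_of_countable _) ?_
  exact measurable_pi_lambda _ fun x => measurable_pi_apply _

theorem dependsOn_restrictTo (f : Config a → ℝ) (V : Finset X) :
    DependsOn (fun η : X → ℕ => f (MMP.restrictTo a V η)) (V : Set X) := by
  intro η ζ h
  have : MMP.restrictTo a V η = MMP.restrictTo a V ζ := by
    apply Subtype.ext
    funext x
    by_cases hx : x ∈ V
    · rw [restrictTo_apply_mem hx, restrictTo_apply_mem hx]
      exact h x hx
    · rw [restrictTo_apply_not_mem hx, restrictTo_apply_not_mem hx]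
  simp only [this]

/-- A Lipschitz function is the pointwise limit of the cylinder functions obtained by emptying the
complement of finite sets; countably many sites make this limit measurable. -/
theorem IsLip.measurable [Countable X] (ha : ∀ x, 0 ≤ a x) (hf : IsLip K f) : Measurable f := by
  refine measurable_of_tendsto_metrizable' (atTop : Filter (Finset X))
    (f := fun V η => f (MMP.restrictTo a V η.1)) (fun V => ?_)
    (tendsto_pi_nhds.mpr fun η => hf.tendsto_restrictTo ha η)
  exact (measurable_of_dependsOn (dependsOn_restrictTo f V)).comp measurable_subtype_coe

/-- Bounded cylinder functions are Lipschitz. -/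
theorem isLip_of_dependsOn (ha : ∀ x, 0 < a x) {F : (X → ℕ) → ℝ} {V : Finset X}
    (hF : DependsOn F (V : Set X)) {m : ℝ} (hm : ∀ η, |F η| ≤ m) :
    ∃ K, 0 ≤ K ∧ IsLip K fun η : Config a => F η.1 := by
  have hm0 : 0 ≤ m := (abs_nonneg _).trans (hm 0)
  rcases V.eq_empty_or_nonempty with rfl | hV
  · refine ⟨0, le_rfl, fun η ζ => ?_⟩
    have : F η.1 = F ζ.1 := hF fun x hx => by simp at hx
    simp [this]
  · obtain ⟨x₀, hx₀, hmin⟩ := V.exists_min_image a hV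
    have h0 := ha x₀
    -- Configurations that disagree on V differ there by at least one particle, so their distance is
    -- at least the minimum a(x₀) of the weight on V.
    refine ⟨2 * m / a x₀, by positivity, fun η ζ => ?_⟩
    have ha' : ∀ x, 0 ≤ a x := fun x => (ha x).le
    by_cases heq : ∀ x ∈ V, η.1 x = ζ.1 x
    · have : F η.1 = F ζ.1 := hF fun x hx => heq x hx
      simp only [this, sub_self, abs_zero]
      exact mul_nonneg (by positivity) (configDist_nonneg ha' _ _)
    · push Not at heq
      obtain ⟨x, hx, hne⟩ := heq
      have h1 : a x₀ ≤ configDist η ζ := by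
        have h2 : |(η.1 x : ℝ) - (ζ.1 x : ℝ)| * a x ≤ configDist η ζ :=
          (summable_configDist ha' η ζ).le_tsum x
            fun y _ => mul_nonneg (abs_nonneg _) (ha' y)
        have h3 : (1 : ℝ) ≤ |(η.1 x : ℝ) - (ζ.1 x : ℝ)| := by
          have : (1 : ℤ) ≤ |(η.1 x : ℤ) - (ζ.1 x : ℤ)| := Int.one_le_abs (by omega)
          exact_mod_cast this
        have := hmin x hx
        have := ha x
        nlinarith
      have h2 : |F η.1 - F ζ.1| ≤ 2 * m := by
        have h3 := abs_le.mp (hm η.1)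
        have h4 := abs_le.mp (hm ζ.1)
        rw [abs_le]
        constructor <;> linarith
      calc |F η.1 - F ζ.1| ≤ 2 * m := h2
        _ = 2 * m / a x₀ * a x₀ := by field_simp
        _ ≤ _ := mul_le_mul_of_nonneg_left h1 (by positivity)

end Config

/-! ### Jumps -/

section Jump

variable {X : Type*} [DecidableEq X] {a : X → ℝ}

theorem configDist_jump_le (ha : ∀ x, 0 ≤ a x) (x y : X) (k : ℕ) (η : Config a) :
    configDist (jumpConfig x y k η) η ≤ k * (a x + a y) := by
  by_cases hc : x ≠ y ∧ k ≤ η.1 x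
  · have hsum : configDist (jumpConfig x y k η) η =
        ∑ z ∈ ({x, y} : Finset X), |((jumpConfig x y k η).1 z : ℝ) - (η.1 z : ℝ)| * a z := by
      rw [configDist]
      refine tsum_eq_sum fun z hz => ?_
      simp only [Finset.mem_insert, Finset.mem_singleton, not_or] at hz
      simp [jumpConfig, jump, hz.1, hz.2]
    rw [hsum, Finset.sum_pair hc.1]
    have e1 : ((jumpConfig x y k η).1 x : ℝ) = η.1 x - k := by
      simp [jumpConfig, jump, hc.1, hc.2]
    have e2 : ((jumpConfig x y k η).1 y : ℝ) = η.1 y + k := by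
      simp [jumpConfig, jump, hc.1, hc.2, hc.1.symm]
    rw [e1, e2]
    have e3 : |(η.1 x : ℝ) - k - η.1 x| = k := by
      rw [sub_sub_cancel_left, abs_neg, Nat.abs_cast]
    have e4 : |(η.1 y : ℝ) + k - η.1 y| = k := by
      rw [add_sub_cancel_left, Nat.abs_cast]
    rw [e3, e4, mul_add]
  · have : jumpConfig x y k η = η := by
      apply Subtype.ext
      funext z
      simp only [jumpConfig, jump]
      rw [if_neg hc]
    rw [this]
    simp only [configDist, sub_self, abs_zero, zero_mul, tsum_zero]
    exact mul_nonneg k.cast_nonneg (add_nonneg (ha x) (ha y))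

theorem measurable_jump (x y : X) (k : ℕ) : Measurable (jump x y k) := by
  refine measurable_pi_lambda _ fun z => ?_
  have e : (fun η : X → ℕ => jump x y k η z) =
      (fun t : ℕ × ℕ × ℕ => if x ≠ y ∧ k ≤ t.1 then
        if z = x then t.1 - k else if z = y then t.2.1 + k else t.2.2 else t.2.2) ∘
      (fun η => (η x, η y, η z)) := rfl
  rw [e]
  exact (measurable_of_countable _).comp
    ((measurable_pi_apply x).prodMk ((measurable_pi_apply y).prodMk (measurable_pi_apply z)))

theorem measurable_jumpConfig (x y : X) (k : ℕ) :
    Measurable (jumpConfig x y k : Config a → Config a) :=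
  ((measurable_jump x y k).comp measurable_subtype_coe).subtype_mk

theorem jump_self (x : X) (k : ℕ) (η : X → ℕ) : jump x x k η = η := by
  funext z
  simp [jump]

end Jump

/-! ### The generator on Lipschitz functions -/

section Generator

variable {X : Type*} [DecidableEq X] {a : X → ℝ} {p : X → X → ℝ} {h : ℕ → ℕ → ℝ} {C K : ℝ}
  {f : Config a → ℝ}

/-- The contribution to the generator of the jumps from `q.1` to `q.2`. -/
noncomputable def pairTerm (p : X → X → ℝ) (h : ℕ → ℕ → ℝ) (f : Config a → ℝ) (q : X × X)
    (η : Config a) : ℝ :=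
  p q.1 q.2 * ∑ k ∈ Finset.Icc 1 (η.1 q.1),
    h k (η.1 q.2) * (f (jumpConfig q.1 q.2 k η) - f η)

theorem generator_eq_tsum (p : X → X → ℝ) (h : ℕ → ℕ → ℝ) (f : Config a → ℝ) (η : Config a) :
    generator p (targetRates h) f η = ∑' q, pairTerm p h f q η := by
  refine tsum_congr fun q => ?_
  rw [pairTerm, Finset.mul_sum]
  refine Finset.sum_congr rfl fun k hk => ?_
  rw [targetRates, if_pos (Finset.mem_Icc.mp hk)]
  ring

/-- A bound for `pairTerm` on functions with Lipschitz constant `1`. -/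
noncomputable def pairBound (a : X → ℝ) (p : X → X → ℝ) (C : ℝ) (q : X × X) (η : X → ℕ) : ℝ :=
  C * (p q.1 q.2 * (((η q.1 : ℝ) + η q.2) * (a q.1 + a q.2)))

/-- A bound for the generator on functions with Lipschitz constant `1`. -/
noncomputable def generatorBound (a : X → ℝ) (p : X → X → ℝ) (C : ℝ) (η : X → ℕ) : ℝ :=
  ∑' q, pairBound a p C q η

theorem abs_pairTerm_le (hp0 : ∀ x y, 0 ≤ p x y) (ha : ∀ x, 0 ≤ a x)
    (hh : ∀ k β, 1 ≤ k → 0 ≤ h k β)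
    (hC : ∀ α β : ℕ, ∑ k ∈ Finset.Icc 1 α, (k : ℝ) * h k β ≤ C * ((α : ℝ) + β))
    (hK : 0 ≤ K) (hf : IsLip K f) (q : X × X) (η : Config a) :
    |pairTerm p h f q η| ≤ K * pairBound a p C q η.1 := by
  have haa : 0 ≤ a q.1 + a q.2 := add_nonneg (ha _) (ha _)
  have h1 : |∑ k ∈ Finset.Icc 1 (η.1 q.1),
      h k (η.1 q.2) * (f (jumpConfig q.1 q.2 k η) - f η)| ≤
      (∑ k ∈ Finset.Icc 1 (η.1 q.1), (k : ℝ) * h k (η.1 q.2)) * (K * (a q.1 + a q.2)) := by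
    rw [Finset.sum_mul]
    refine (Finset.abs_sum_le_sum_abs _ _).trans (Finset.sum_le_sum fun k hk => ?_)
    have hk0 := hh k (η.1 q.2) (Finset.mem_Icc.mp hk).1
    rw [abs_mul, abs_of_nonneg hk0]
    calc h k (η.1 q.2) * |f (jumpConfig q.1 q.2 k η) - f η|
        ≤ h k (η.1 q.2) * (K * (k * (a q.1 + a q.2))) :=
          mul_le_mul_of_nonneg_left ((hf _ _).trans
            (mul_le_mul_of_nonneg_left (configDist_jump_le ha _ _ _ _) hK)) hk0
      _ = _ := by ring
  rw [pairTerm, abs_mul, abs_of_nonneg (hp0 _ _)]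
  calc p q.1 q.2 * _ ≤ p q.1 q.2 * ((C * ((η.1 q.1 : ℝ) + η.1 q.2)) * (K * (a q.1 + a q.2))) :=
        mul_le_mul_of_nonneg_left (h1.trans
          (mul_le_mul_of_nonneg_right (hC _ _) (mul_nonneg hK haa))) (hp0 _ _)
    _ = K * pairBound a p C q η.1 := by rw [pairBound]; ring

omit [DecidableEq X] in
theorem pairBound_nonneg (hp0 : ∀ x y, 0 ≤ p x y) (ha : ∀ x, 0 ≤ a x) (hC0 : 0 ≤ C) (q : X × X)
    (η : X → ℕ) : 0 ≤ pairBound a p C q η :=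
  mul_nonneg hC0 (mul_nonneg (hp0 _ _) (mul_nonneg (by positivity) (add_nonneg (ha _) (ha _))))

variable (hp : IsTransitionProbability p) (hq : IsTransitionProbability fun x y => p y x)
  (ha : IsWeight p a) (hh : ∀ k β, 1 ≤ k → 0 ≤ h k β) (hC0 : 0 ≤ C)
  (hC : ∀ α β : ℕ, ∑ k ∈ Finset.Icc 1 α, (k : ℝ) * h k β ≤ C * ((α : ℝ) + β))

omit [DecidableEq X] in
include hp hq ha in
theorem summable_pairBound (C : ℝ) (η : Config a) :
    Summable fun q => pairBound a p C q η.1 :=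
  (summable_weight_pair hp hq ha (s := fun x => (η.1 x : ℝ)) (fun _ => Nat.cast_nonneg _)
    η.2).mul_left C

include hp hq ha hh hC

theorem summable_pairTerm (hK : 0 ≤ K) (hf : IsLip K f) (η : Config a) :
    Summable fun q => pairTerm p h f q η :=
  Summable.of_norm_bounded ((summable_pairBound hp hq ha C η).mul_left K)
    fun q => abs_pairTerm_le hp.nonneg ha.nonneg hh hC hK hf q η

theorem abs_generator_le (hK : 0 ≤ K) (hf : IsLip K f) (η : Config a) :
    |generator p (targetRates h) f η| ≤ K * generatorBound a p C η.1 := by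
  rw [generator_eq_tsum, generatorBound, ← tsum_mul_left, ← Real.norm_eq_abs]
  exact tsum_of_norm_bounded ((summable_pairBound hp hq ha C η).mul_left K).hasSum
    fun q => abs_pairTerm_le hp.nonneg ha.nonneg hh hC hK hf q η

theorem tendsto_generator {ι : Type*} {l : Filter ι} {F : ι → Config a → ℝ} (hK : 0 ≤ K)
    (hF : ∀ᶠ n in l, IsLip K (F n)) (hlim : ∀ η, Tendsto (fun n => F n η) l (𝓝 (f η)))
    (η : Config a) :
    Tendsto (fun n => generator p (targetRates h) (F n) η) l
      (𝓝 (generator p (targetRates h) f η)) := by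
  simp only [generator_eq_tsum]
  refine tendsto_tsum_of_dominated_convergence
    ((summable_pairBound hp hq ha C η).mul_left K) (fun q => ?_) ?_
  · simp only [pairTerm]
    refine Tendsto.const_mul _ (tendsto_finsetSum _ fun k _ => ?_)
    exact ((hlim _).sub (hlim _)).const_mul _
  · filter_upwards [hF] with n hn q
    exact abs_pairTerm_le hp.nonneg ha.nonneg hh hC hK hn q η

omit hp hq ha hh hC in
theorem measurable_pairTerm {S : Type*} [MeasurableSpace S] {F : S → Config a → ℝ}
    (hF : Measurable (Function.uncurry F)) (q : X × X) :
    Measurable fun z : S × Config a => pairTerm p h (F z.1) q z.2 := by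
  have hcoord : ∀ x : X, Measurable fun z : S × Config a => z.2.1 x := fun x =>
    (measurable_pi_apply x).comp (measurable_subtype_coe.comp measurable_snd)
  have hterm : ∀ n b : ℕ, Measurable fun z : S × Config a =>
      p q.1 q.2 * ∑ k ∈ Finset.Icc 1 n, h k b * (F z.1 (jumpConfig q.1 q.2 k z.2) - F z.1 z.2) := by
    intro n b
    refine Measurable.const_mul (Finset.measurable_sum _ fun k _ => ?_) _
    refine Measurable.const_mul (Measurable.sub ?_ hF) _
    exact hF.comp (measurable_fst.prodMk ((measurable_jumpConfig q.1 q.2 k).comp measurable_snd))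
  -- The random summation range and rates are handled by treating the two occupation numbers as a
  -- separate countable parameter.
  have hall : Measurable fun w : (ℕ × ℕ) × (S × Config a) =>
      p q.1 q.2 * ∑ k ∈ Finset.Icc 1 w.1.1,
        h k w.1.2 * (F w.2.1 (jumpConfig q.1 q.2 k w.2.2) - F w.2.1 w.2.2) :=
    measurable_from_prod_countable_right fun nb => hterm nb.1 nb.2
  exact hall.comp (((hcoord q.1).prodMk (hcoord q.2)).prodMk measurable_id)

theorem measurable_generator [Countable X] {S : Type*} [MeasurableSpace S]
    {F : S → Config a → ℝ} (hF : Measurable (Function.uncurry F))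
    (hL : ∀ s, ∃ K, 0 ≤ K ∧ IsLip K (F s)) :
    Measurable fun z : S × Config a => generator p (targetRates h) (F z.1) z.2 := by
  refine measurable_of_tendsto_metrizable' (atTop : Filter (Finset (X × X)))
    (f := fun V z => ∑ q ∈ V, pairTerm p h (F z.1) q z.2)
    (fun V => Finset.measurable_sum _ fun q _ => measurable_pairTerm hF q)
    (tendsto_pi_nhds.mpr fun z => ?_)
  obtain ⟨K, hK, hLz⟩ := hL z.1
  rw [generator_eq_tsum]
  exact (summable_pairTerm hp hq ha hh hC hK hLz z.2).hasSum

theorem measurable_generator_of_isLip [Countable X] (hK : 0 ≤ K) (hf : IsLip K f) :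
    Measurable fun η => generator p (targetRates h) f η :=
  (measurable_generator (S := Unit) (F := fun _ => f) hp hq ha hh hC
    ((hf.measurable ha.nonneg).comp measurable_snd) fun _ => ⟨K, hK, hf⟩).comp
    (measurable_const.prodMk measurable_id : Measurable fun η : Config a => ((), η))

end Generator

theorem integrable_tsum_of_nonneg {ι Ω : Type*} [Countable ι] [MeasurableSpace Ω]
    {P : Measure Ω} {f : ι → Ω → ℝ} (h0 : ∀ i x, 0 ≤ f i x) (hint : ∀ i, Integrable (f i) P)
    (hsum : ∀ x, Summable fun i => f i x) (hS : Summable fun i => ∫ x, f i x ∂P) :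
    Integrable (fun x => ∑' i, f i x) P := by
  constructor
  · refine aestronglyMeasurable_of_tendsto_ae (atTop : Filter (Finset ι))
      (f := fun s x => ∑ i ∈ s, f i x)
      (fun s => Finset.aestronglyMeasurable_fun_sum _ fun i _ => (hint i).1)
      (Eventually.of_forall fun x => (hsum x).hasSum)
  · rw [hasFiniteIntegral_iff_ofReal (Eventually.of_forall fun x => tsum_nonneg fun i => h0 i x)]
    have e : ∀ x, ENNReal.ofReal (∑' i, f i x) = ∑' i, ENNReal.ofReal (f i x) := fun x =>
      ENNReal.ofReal_tsum_of_nonneg (fun i => h0 i x) (hsum x)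
    simp only [e]
    rw [lintegral_tsum fun i => (hint i).1.aemeasurable.ennreal_ofReal]
    have e2 : ∀ i, ∫⁻ x, ENNReal.ofReal (f i x) ∂P = ENNReal.ofReal (∫ x, f i x ∂P) := fun i =>
      (ofReal_integral_eq_lintegral_ofReal (hint i) (Eventually.of_forall (h0 i))).symm
    simp only [e2]
    rw [← ENNReal.ofReal_tsum_of_nonneg (fun i => integral_nonneg (h0 i)) hS]
    exact ENNReal.ofReal_lt_top

/-! ### Single site marginals -/

section Marginal

variable {μ : PMF ℕ}

theorem weight_nonneg (μ : PMF ℕ) (n : ℕ) : 0 ≤ weight μ n := ENNReal.toReal_nonneg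

theorem hasSum_weight (μ : PMF ℕ) : HasSum (weight μ) 1 := by
  have h : ∑' n, weight μ n = 1 := by
    rw [← ENNReal.toReal_one, ← μ.tsum_coe, ENNReal.tsum_toReal_eq fun n => μ.apply_ne_top n]
    rfl
  rw [← h]
  exact (ENNReal.summable_toReal (by rw [μ.tsum_coe]; exact ENNReal.one_ne_top)).hasSum

theorem toMeasure_real_singleton (μ : PMF ℕ) (n : ℕ) : μ.toMeasure.real {n} = weight μ n := by
  rw [measureReal_def, PMF.toMeasure_apply_singleton _ _ (measurableSet_singleton _), weight]

theorem integrable_toMeasure_of_nonneg {f : ℕ → ℝ} (hf0 : ∀ n, 0 ≤ f n)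
    (hf : Summable fun n => f n * weight μ n) : Integrable f μ.toMeasure := by
  refine ⟨(measurable_of_countable f).aestronglyMeasurable, ?_⟩
  rw [hasFiniteIntegral_iff_ofReal (Eventually.of_forall hf0), lintegral_countable']
  have e : ∀ n, ENNReal.ofReal (f n) * μ.toMeasure {n} = ENNReal.ofReal (f n * weight μ n) := by
    intro n
    rw [PMF.toMeasure_apply_singleton _ _ (measurableSet_singleton _), ENNReal.ofReal_mul (hf0 n),
      weight, ENNReal.ofReal_toReal (μ.apply_ne_top n)]
  simp only [e]
  rw [← ENNReal.ofReal_tsum_of_nonneg (fun n => mul_nonneg (hf0 n) (weight_nonneg μ n)) hf]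
  exact ENNReal.ofReal_lt_top

theorem FiniteMean.integrable (hμ : FiniteMean μ) :
    Integrable (fun n : ℕ => (n : ℝ)) μ.toMeasure :=
  integrable_toMeasure_of_nonneg (fun n => n.cast_nonneg) hμ

end Marginal

/-! ### Product measures -/

section Product

variable {X : Type*} {μ : PMF ℕ}

instance : IsProbabilityMeasure (productMeasure X μ) := by
  unfold productMeasure
  infer_instance

theorem measurePreserving_coord (μ : PMF ℕ) (x : X) :
    MeasurePreserving (fun η : X → ℕ => η x) (productMeasure X μ) μ.toMeasure :=
  measurePreserving_eval_infinitePi _ x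

theorem FiniteMean.integrable_coord (hμ : FiniteMean μ) (x : X) :
    Integrable (fun η : X → ℕ => (η x : ℝ)) (productMeasure X μ) :=
  (measurePreserving_coord μ x).integrable_comp_of_integrable hμ.integrable

theorem integral_coord (μ : PMF ℕ) (x : X) :
    ∫ η : X → ℕ, (η x : ℝ) ∂(productMeasure X μ) = ∫ n : ℕ, (n : ℝ) ∂μ.toMeasure := by
  rw [← (measurePreserving_coord μ x).map_eq, integral_map]
  · exact (measurable_pi_apply x).aemeasurable
  · exact (measurable_of_countable _).aestronglyMeasurable

variable [DecidableEq X]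

/-- Resampling the occupation number of one site preserves the product measure. -/
theorem measurePreserving_update (μ : PMF ℕ) (x : X) :
    MeasurePreserving (fun z : (X → ℕ) × ℕ => Function.update z.1 x z.2)
      ((productMeasure X μ).prod μ.toMeasure) (productMeasure X μ) := by
  have hm : Measurable fun z : (X → ℕ) × ℕ => Function.update z.1 x z.2 := by
    refine measurable_pi_lambda _ fun y => ?_
    by_cases hy : y = x
    · subst hy
      simpa using measurable_snd
    · simp only [Function.update_of_ne hy]
      exact (measurable_pi_apply y).comp measurable_fst
  refine ⟨hm, Measure.eq_infinitePi _ fun s t ht => ?_⟩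
  rw [Measure.map_apply hm (MeasurableSet.pi s.countable_toSet fun i _ => ht i)]
  by_cases hx : x ∈ s
  · have e : (fun z : (X → ℕ) × ℕ => Function.update z.1 x z.2) ⁻¹' (Set.pi (s : Set X) t) =
        (Set.pi ((s.erase x : Finset X) : Set X) t) ×ˢ (t x) := by
      ext z
      simp only [Set.mem_preimage, Set.mem_pi, Set.mem_prod, Finset.mem_coe, Finset.mem_erase]
      constructor
      · intro H
        refine ⟨fun i hi => ?_, ?_⟩
        · simpa [Function.update_of_ne hi.1] using H i hi.2
        · simpa using H x hx
      · rintro ⟨H1, H2⟩ i hi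
        by_cases hix : i = x
        · subst hix
          simpa using H2
        · simpa [Function.update_of_ne hix] using H1 i ⟨hix, hi⟩
    rw [e, Measure.prod_prod, productMeasure, Measure.infinitePi_pi _ fun i _ => ht i, mul_comm,
      Finset.mul_prod_erase s (fun i => μ.toMeasure (t i)) hx]
  · have e : (fun z : (X → ℕ) × ℕ => Function.update z.1 x z.2) ⁻¹' (Set.pi (s : Set X) t) =
        (Set.pi (s : Set X) t) ×ˢ Set.univ := by
      ext z
      simp only [Set.mem_preimage, Set.mem_pi, Set.mem_prod, Finset.mem_coe, Set.mem_univ, and_true]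
      refine forall₂_congr fun i hi => ?_
      rw [Function.update_of_ne (by rintro rfl; exact hx hi)]
    rw [e, Measure.prod_prod, measure_univ, mul_one, productMeasure,
      Measure.infinitePi_pi _ fun i _ => ht i]

theorem integral_update {G : (X → ℕ) → ℝ} (hG : Integrable G (productMeasure X μ)) (x : X) :
    ∫ η, G η ∂(productMeasure X μ) =
      ∫ η, (∫ n, G (Function.update η x n) ∂μ.toMeasure) ∂(productMeasure X μ) := by
  have h1 := measurePreserving_update μ x
  have h2 := h1.integrable_comp_of_integrable hG
  have h3 : ∫ η, G η ∂(productMeasure X μ) = ∫ z, G (Function.update z.1 x z.2)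
      ∂((productMeasure X μ).prod μ.toMeasure) := by
    conv_lhs => rw [← h1.map_eq]
    exact integral_map h1.measurable.aemeasurable (by rw [h1.map_eq]; exact hG.1)
  exact h3.trans (integral_prod _ h2)

/-- Replacing the occupation numbers of two sites. -/
def updateTwo (x y : X) (η : X → ℕ) (q : ℕ × ℕ) : X → ℕ :=
  Function.update (Function.update η x q.1) y q.2

theorem measurePreserving_updateTwo (μ : PMF ℕ) (x y : X) :
    MeasurePreserving (fun z : (X → ℕ) × (ℕ × ℕ) => updateTwo x y z.1 z.2)
      ((productMeasure X μ).prod (μ.toMeasure.prod μ.toMeasure)) (productMeasure X μ) := by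
  have h1 := (measurePreserving_prodAssoc (productMeasure X μ) μ.toMeasure μ.toMeasure).symm
  have h2 := (measurePreserving_update μ x).prod (MeasurePreserving.id μ.toMeasure)
  exact (measurePreserving_update μ y).comp (h2.comp h1)

/-- Resampling the occupation numbers of two sites. -/
theorem integral_updateTwo {G : (X → ℕ) → ℝ} (hG : Integrable G (productMeasure X μ)) (x y : X) :
    ∫ η, G η ∂(productMeasure X μ) =
      ∫ η, (∑' q : ℕ × ℕ, weight μ q.1 * weight μ q.2 * G (updateTwo x y η q))
        ∂(productMeasure X μ) := by
  have h1 := measurePreserving_updateTwo μ x y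
  have h2 := h1.integrable_comp_of_integrable hG
  have h3 : ∫ η, G η ∂(productMeasure X μ) = ∫ z, G (updateTwo x y z.1 z.2)
      ∂((productMeasure X μ).prod (μ.toMeasure.prod μ.toMeasure)) := by
    conv_lhs => rw [← h1.map_eq]
    exact integral_map h1.measurable.aemeasurable (by rw [h1.map_eq]; exact hG.1)
  refine h3.trans ((integral_prod _ h2).trans (integral_congr_ae ?_))
  filter_upwards [h2.prod_right_ae] with η hη
  rw [integral_countable hη]
  refine tsum_congr fun q => ?_
  rw [smul_eq_mul, measureReal_def]
  congr 1
  have : ({q} : Set (ℕ × ℕ)) = {q.1} ×ˢ {q.2} := by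
    ext
    simp [Prod.ext_iff]
  rw [this, Measure.prod_prod, ENNReal.toReal_mul, ← measureReal_def, ← measureReal_def,
    toMeasure_real_singleton, toMeasure_real_singleton]

theorem updateTwo_apply_fst {x y : X} (hxy : x ≠ y) (η : X → ℕ) (q : ℕ × ℕ) :
    updateTwo x y η q x = q.1 := by
  rw [updateTwo, Function.update_of_ne hxy, Function.update_self]

theorem updateTwo_apply_snd (x y : X) (η : X → ℕ) (q : ℕ × ℕ) :
    updateTwo x y η q y = q.2 := by
  rw [updateTwo, Function.update_self]

theorem updateTwo_apply_of_ne {x y z : X} (hx : z ≠ x) (hy : z ≠ y) (η : X → ℕ) (q : ℕ × ℕ) :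
    updateTwo x y η q z = η z := by
  rw [updateTwo, Function.update_of_ne hy, Function.update_of_ne hx]

theorem jump_updateTwo {x y : X} (hxy : x ≠ y) (η : X → ℕ) (m n : ℕ) {k : ℕ} (hk : k ≤ m) :
    jump x y k (updateTwo x y η (m, n)) = updateTwo x y η (m - k, n + k) := by
  funext z
  have hc : x ≠ y ∧ k ≤ updateTwo x y η (m, n) x := ⟨hxy, by rwa [updateTwo_apply_fst hxy]⟩
  simp only [jump]
  rw [if_pos hc]
  by_cases hzx : z = x
  · rw [hzx, if_pos rfl, updateTwo_apply_fst hxy, updateTwo_apply_fst hxy]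
  · rw [if_neg hzx]
    by_cases hzy : z = y
    · rw [hzy, if_pos rfl, updateTwo_apply_snd, updateTwo_apply_snd]
    · rw [if_neg hzy, updateTwo_apply_of_ne hzx hzy, updateTwo_apply_of_ne hzx hzy]

end Product

/-! ### The product measure on the state space -/

section StateSpace

variable {X : Type*} [Countable X] {a : X → ℝ} {p : X → X → ℝ} {μ : PMF ℕ}

theorem measurableSet_configSet (ha : ∀ x, 0 ≤ a x) : MeasurableSet (configSet a) := by
  have e : configSet a = {η : X → ℕ | ∑' x, ENNReal.ofReal ((η x : ℝ) * a x) ≠ ∞} := by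
    ext η
    constructor
    · intro h
      have h' : Summable fun x => (η x : ℝ) * a x := h
      rw [Set.mem_ofPred_eq, ← ENNReal.ofReal_tsum_of_nonneg
        (fun x => mul_nonneg (Nat.cast_nonneg _) (ha x)) h']
      exact ENNReal.ofReal_ne_top
    · intro h
      have h1 := ENNReal.summable_toReal h
      refine h1.congr fun x => ?_
      rw [ENNReal.toReal_ofReal (mul_nonneg (Nat.cast_nonneg _) (ha x))]
  rw [e]
  have hm : Measurable fun η : X → ℕ => ∑' x, ENNReal.ofReal ((η x : ℝ) * a x) := by
    refine Measurable.tsum fun x => ?_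
    exact (measurable_of_countable fun n : ℕ => ENNReal.ofReal ((n : ℝ) * a x)).comp
      (measurable_pi_apply x)
  exact hm (measurableSet_singleton _).compl

theorem supportedOn_productMeasure (ha : IsWeight p a) (hμ : FiniteMean μ) :
    SupportedOn a (productMeasure X μ) := by
  have hm : ∀ x, Measurable fun η : X → ℕ => ENNReal.ofReal ((η x : ℝ) * a x) := fun x =>
    (measurable_of_countable fun n : ℕ => ENNReal.ofReal ((n : ℝ) * a x)).comp
      (measurable_pi_apply x)
  have hfin : ∫⁻ η, ∑' x, ENNReal.ofReal ((η x : ℝ) * a x) ∂(productMeasure X μ) ≠ ∞ := by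
    rw [lintegral_tsum fun x => (hm x).aemeasurable]
    have e : ∀ x, ∫⁻ η, ENNReal.ofReal ((η x : ℝ) * a x) ∂(productMeasure X μ) =
        ENNReal.ofReal ((∫ n : ℕ, (n : ℝ) ∂μ.toMeasure) * a x) := by
      intro x
      rw [← integral_coord μ x, ← integral_mul_const,
        ofReal_integral_eq_lintegral_ofReal ((hμ.integrable_coord x).mul_const _)
        (Eventually.of_forall fun η => mul_nonneg (Nat.cast_nonneg _) (ha.nonneg x))]
    simp only [e]
    rw [← ENNReal.ofReal_tsum_of_nonneg (fun x => mul_nonneg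
      (integral_nonneg fun n => Nat.cast_nonneg _) (ha.nonneg x)) 
      (ha.summable.mul_left (∫ n : ℕ, (n : ℝ) ∂μ.toMeasure))]
    exact ENNReal.ofReal_ne_top
  filter_upwards [ae_lt_top' (Measurable.tsum hm).aemeasurable hfin] with η hη
  refine (ENNReal.summable_toReal hη.ne).congr fun x => ?_
  rw [ENNReal.toReal_ofReal (mul_nonneg (Nat.cast_nonneg _) (ha.nonneg x))]

/-- The product measure on the state space. -/
noncomputable abbrev configMeasure (a : X → ℝ) (μ : PMF ℕ) : Measure (Config a) :=
  (productMeasure X μ).comap Subtype.val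

theorem measurePreserving_val (ha : IsWeight p a) (hμ : FiniteMean μ) :
    MeasurePreserving (Subtype.val : Config a → X → ℕ) (configMeasure a μ)
      (productMeasure X μ) := by
  refine ⟨measurable_subtype_coe, ?_⟩
  rw [configMeasure, (MeasurableEmbedding.subtype_coe (measurableSet_configSet ha.nonneg)).map_comap,
    Subtype.range_coe]
  exact Measure.restrict_eq_self_of_ae_mem (supportedOn_productMeasure ha hμ)

theorem isProbabilityMeasure_configMeasure (ha : IsWeight p a) (hμ : FiniteMean μ) :
    IsProbabilityMeasure (configMeasure a μ) :=
  ⟨by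
    rw [← Set.preimage_univ (f := Subtype.val),
      (measurePreserving_val ha hμ).measure_preimage MeasurableSet.univ.nullMeasurableSet,
      measure_univ]⟩

theorem integral_configMeasure (ha : IsWeight p a) (hμ : FiniteMean μ) (G : (X → ℕ) → ℝ) :
    ∫ η : Config a, G η.1 ∂(configMeasure a μ) = ∫ η, G η ∂(productMeasure X μ) :=
  (measurePreserving_val ha hμ).integral_comp
    (MeasurableEmbedding.subtype_coe (measurableSet_configSet ha.nonneg)) G

theorem integrable_configMeasure (ha : IsWeight p a) (hμ : FiniteMean μ) {G : (X → ℕ) → ℝ}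
    (hG : Integrable G (productMeasure X μ)) :
    Integrable (fun η : Config a => G η.1) (configMeasure a μ) :=
  (measurePreserving_val ha hμ).integrable_comp_of_integrable hG

variable (hp : IsTransitionProbability p) (hq : IsTransitionProbability fun x y => p y x)

omit [Countable X] in
theorem integrable_pairBound (hμ : FiniteMean μ) (a : X → ℝ) (p : X → X → ℝ) (C : ℝ) (q : X × X) :
    Integrable (pairBound a p C q) (productMeasure X μ) :=
  (((((hμ.integrable_coord q.1).add (hμ.integrable_coord q.2)).mul_const _).const_mul _).const_mul
    _)

include hp hq

-- The mean occupation is the same at every site, so the mean bounds form the weighted pair series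
-- with constant s, summable because a is.
omit [Countable X] in
theorem summable_integral_pairBound (ha : IsWeight p a) (hμ : FiniteMean μ) (C : ℝ) :
    Summable fun q => ∫ η, pairBound a p C q η ∂(productMeasure X μ) := by
  set ρ := ∫ n : ℕ, (n : ℝ) ∂μ.toMeasure
  have h1 := summable_weight_pair hp hq ha (s := fun _ => ρ)
    (fun _ => integral_nonneg fun n => Nat.cast_nonneg _) (ha.summable.mul_left ρ)
  refine (h1.mul_left C).congr fun q => ?_
  simp only [pairBound]
  rw [integral_const_mul, integral_const_mul, integral_mul_const,
    integral_add (hμ.integrable_coord q.1) (hμ.integrable_coord q.2), integral_coord,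
    integral_coord]

theorem integrable_generatorBound (ha : IsWeight p a) (hμ : FiniteMean μ) {C : ℝ} (hC0 : 0 ≤ C) :
    Integrable (fun η : Config a => generatorBound a p C η.1) (configMeasure a μ) := by
  refine integrable_tsum_of_nonneg (f := fun q (η : Config a) => pairBound a p C q η.1)
    (fun q η => pairBound_nonneg hp.nonneg ha.nonneg hC0 q η.1)
    (fun q => integrable_configMeasure ha hμ (integrable_pairBound hμ a p C q))
    (fun η => summable_pairBound hp hq ha C η)
    ((summable_integral_pairBound hp hq ha hμ C).congr fun q => ?_)
  exact (integral_configMeasure ha hμ (pairBound a p C q)).symm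

end StateSpace

/-! ### Jumps between two sites under the product measure -/

section PairIntegral

variable {X : Type*} [DecidableEq X] {μ : PMF ℕ} {h : ℕ → ℕ → ℝ} {C : ℝ} {F : (X → ℕ) → ℝ} {m : ℝ}

/-- The change of `F` under jumps from `x` to `y`, weighted by their rates. -/
noncomputable def jumpChange (h : ℕ → ℕ → ℝ) (F : (X → ℕ) → ℝ) (x y : X) (η : X → ℕ) : ℝ :=
  ∑ k ∈ Finset.Icc 1 (η x), h k (η y) * (F (jump x y k η) - F η)

theorem measurable_jumpChange (hF : Measurable F) (x y : X) :
    Measurable (jumpChange h F x y) := by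
  have hterm : ∀ n b : ℕ, Measurable fun η : X → ℕ =>
      ∑ k ∈ Finset.Icc 1 n, h k b * (F (jump x y k η) - F η) := fun n b =>
    Finset.measurable_sum _ fun k _ =>
      ((hF.comp (measurable_jump x y k)).sub hF).const_mul _
  have hall : Measurable fun w : (ℕ × ℕ) × (X → ℕ) =>
      ∑ k ∈ Finset.Icc 1 w.1.1, h k w.1.2 * (F (jump x y k w.2) - F w.2) :=
    measurable_from_prod_countable_right fun nb => hterm nb.1 nb.2
  have hcoord : Measurable fun η : X → ℕ => ((η x, η y), η) :=
    ((measurable_pi_apply x).prodMk (measurable_pi_apply y)).prodMk measurable_id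
  exact hall.comp hcoord

omit [DecidableEq X] in
theorem abs_sub_le_two_mul (hm : ∀ η, |F η| ≤ m) (η ζ : X → ℕ) : |F η - F ζ| ≤ 2 * m := by
  have h3 := abs_le.mp (hm η)
  have h4 := abs_le.mp (hm ζ)
  rw [abs_le]
  constructor <;> linarith

variable (hμ : FiniteMean μ) (hh : ∀ k β, 1 ≤ k → 0 ≤ h k β)
  (hC : ∀ α β : ℕ, ∑ k ∈ Finset.Icc 1 α, (k : ℝ) * h k β ≤ C * ((α : ℝ) + β))
  (hF : Measurable F) (hm : ∀ η, |F η| ≤ m)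

include hμ hh hC hF hm

theorem integrable_jumpChange (x y : X) :
    Integrable (jumpChange h F x y) (productMeasure X μ) := by
  have hm0 : 0 ≤ m := (abs_nonneg _).trans (hm 0)
  refine Integrable.mono' ((((hμ.integrable_coord x).add (hμ.integrable_coord y)).const_mul
    C).mul_const (2 * m)) (measurable_jumpChange hF x y).aestronglyMeasurable
    (Eventually.of_forall fun η => ?_)
  rw [Real.norm_eq_abs, jumpChange]
  calc |∑ k ∈ Finset.Icc 1 (η x), h k (η y) * (F (jump x y k η) - F η)|
      ≤ ∑ k ∈ Finset.Icc 1 (η x), |h k (η y) * (F (jump x y k η) - F η)| :=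
        Finset.abs_sum_le_sum_abs _ _
    _ ≤ ∑ k ∈ Finset.Icc 1 (η x), h k (η y) * (2 * m) := by
        refine Finset.sum_le_sum fun k hk => ?_
        have hk0 := hh k (η y) (Finset.mem_Icc.mp hk).1
        rw [abs_mul, abs_of_nonneg hk0]
        exact mul_le_mul_of_nonneg_left (abs_sub_le_two_mul hm _ _) hk0
    _ = (∑ k ∈ Finset.Icc 1 (η x), h k (η y)) * (2 * m) := by rw [Finset.sum_mul]
    _ ≤ C * ((η x : ℝ) + η y) * (2 * m) :=
        mul_le_mul_of_nonneg_right (sum_rates_le hh hC _ _) (by positivity)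

/-- The two occupation numbers are resampled with the rest of the configuration frozen; the two-site
duality then moves the jump from F onto the weights. -/
theorem integral_jumpChange {x y : X} (hxy : x ≠ y) :
    ∫ η, jumpChange h F x y η ∂(productMeasure X μ) =
      ∫ η, (∑' q : ℕ × ℕ, netFlux (weight μ) h q.1 q.2 * F (updateTwo x y η q))
        ∂(productMeasure X μ) := by
  rw [integral_updateTwo (integrable_jumpChange hμ hh hC hF hm x y) x y]
  congr 1
  funext η
  rw [← tsum_jump_eq_tsum_netFlux (weight_nonneg μ) (hasSum_weight μ).summable hμ hh hC
    (φ := fun i j => F (updateTwo x y η (i, j))) (B := m) (fun i j => hm _)]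
  refine tsum_congr fun q => ?_
  congr 1
  rw [jumpChange, updateTwo_apply_fst hxy, updateTwo_apply_snd]
  refine Finset.sum_congr rfl fun k hk => ?_
  rw [← jump_updateTwo hxy η q.1 q.2 (Finset.mem_Icc.mp hk).2]

omit [DecidableEq X] hF hm in
theorem integrable_emptyRate : Integrable (emptyRate h) μ.toMeasure := by
  refine integrable_toMeasure_of_nonneg (emptyRate_nonneg hh) ?_
  refine Summable.of_nonneg_of_le
    (fun n => mul_nonneg (emptyRate_nonneg hh n) (weight_nonneg μ n)) (fun n => ?_)
    (Summable.mul_left C hμ)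
  have h1 : emptyRate h n ≤ C * ((n : ℝ) + (0 : ℕ)) := sum_rates_le hh hC n 0
  rw [Nat.cast_zero, add_zero] at h1
  rw [← mul_assoc]
  exact mul_le_mul_of_nonneg_right h1 (weight_nonneg μ n)

omit [DecidableEq X] in
theorem integrable_emptyRate_coord_mul (x : X) :
    Integrable (fun η => emptyRate h (η x) * F η) (productMeasure X μ) :=
  ((measurePreserving_coord μ x).integrable_comp_of_integrable
    (integrable_emptyRate hμ hh hC)).mul_bdd (c := m) hF.aestronglyMeasurable
    (Eventually.of_forall hm)

/-- The gradient form of the flux turns the pair contribution into a difference of one-site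
quantities, ready to telescope. -/
theorem IsGradientFlux.integral_jumpChange (hg : IsGradientFlux (weight μ) h) {x y : X}
    (hxy : x ≠ y) :
    ∫ η, jumpChange h F x y η ∂(productMeasure X μ) =
      ∫ η, emptyRate h (η y) * F η ∂(productMeasure X μ) -
        ∫ η, emptyRate h (η x) * F η ∂(productMeasure X μ) := by
  have hi := fun x => integrable_emptyRate_coord_mul hμ hh hC hF hm x
  rw [MMP.integral_jumpChange hμ hh hC hF hm hxy, ← integral_sub (hi y) (hi x),
    integral_updateTwo (G := fun η => emptyRate h (η y) * F η - emptyRate h (η x) * F η)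
      ((hi y).sub (hi x)) x y]
  congr 1
  funext η
  refine tsum_congr fun q => ?_
  rw [hg, updateTwo_apply_fst hxy, updateTwo_apply_snd]
  ring

/-- Independence of η(x) and F: resampling the site x does not affect F. -/
theorem integral_emptyRate_coord_mul_of_dependsOn {V : Finset X} (hV : DependsOn F (V : Set X))
    {x : X} (hx : x ∉ V) :
    ∫ η, emptyRate h (η x) * F η ∂(productMeasure X μ) =
      (∫ n, emptyRate h n ∂μ.toMeasure) * ∫ η, F η ∂(productMeasure X μ) := by
  rw [integral_update (integrable_emptyRate_coord_mul hμ hh hC hF hm x) x, ← integral_const_mul]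
  congr 1
  funext η
  rw [← integral_mul_const]
  congr 1
  funext n
  rw [Function.update_self]
  congr 1
  refine hV fun z hz => Function.update_of_ne ?_ _ _
  rintro rfl
  exact hx hz

end PairIntegral

/-! ### The generator integrated against the product measure -/

section GeneratorIntegral

variable {X : Type*} [DecidableEq X] [Countable X] {a : X → ℝ} {p : X → X → ℝ} {μ : PMF ℕ}
  {h : ℕ → ℕ → ℝ} {C K : ℝ} {f : Config a → ℝ}

theorem integral_pairTerm (ha : IsWeight p a) (hμ : FiniteMean μ) (F : (X → ℕ) → ℝ) (q : X × X) :
    ∫ η, pairTerm p h (fun ζ : Config a => F ζ.1) q η ∂(configMeasure a μ) =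
      p q.1 q.2 * ∫ η, jumpChange h F q.1 q.2 η ∂(productMeasure X μ) := by
  rw [← integral_configMeasure ha hμ, ← integral_const_mul]
  rfl

variable (hp : IsTransitionProbability p) (hq : IsTransitionProbability fun x y => p y x)
  (ha : IsWeight p a) (hμ : FiniteMean μ) (hh : ∀ k β, 1 ≤ k → 0 ≤ h k β) (hC0 : 0 ≤ C)
  (hC : ∀ α β : ℕ, ∑ k ∈ Finset.Icc 1 α, (k : ℝ) * h k β ≤ C * ((α : ℝ) + β))

include hp hq ha hμ hh hC0 hC

theorem integrable_generator (hK : 0 ≤ K) (hf : IsLip K f) :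
    Integrable (fun η => generator p (targetRates h) f η) (configMeasure a μ) :=
  Integrable.mono' ((integrable_generatorBound hp hq ha hμ hC0).const_mul K)
    (measurable_generator_of_isLip hp hq ha hh hC hK hf).aestronglyMeasurable
    (Eventually.of_forall fun η => abs_generator_le hp hq ha hh hC hK hf η)

theorem tendsto_integral_generator {ι : Type*} {l : Filter ι} [l.IsCountablyGenerated]
    {F : ι → Config a → ℝ} (hK : 0 ≤ K) (hF : ∀ᶠ n in l, IsLip K (F n))
    (hlim : ∀ η, Tendsto (fun n => F n η) l (𝓝 (f η))) :
    Tendsto (fun n => ∫ η, generator p (targetRates h) (F n) η ∂(configMeasure a μ)) l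
      (𝓝 (∫ η, generator p (targetRates h) f η ∂(configMeasure a μ))) := by
  refine tendsto_integral_filter_of_dominated_convergence
    (fun η => K * generatorBound a p C η.1) ?_ ?_
    ((integrable_generatorBound hp hq ha hμ hC0).const_mul K)
    (Eventually.of_forall fun η => tendsto_generator hp hq ha hh hC hK hF hlim η)
  · filter_upwards [hF] with n hn
    exact (measurable_generator_of_isLip hp hq ha hh hC hK hn).aestronglyMeasurable
  · filter_upwards [hF] with n hn
    exact Eventually.of_forall fun η => abs_generator_le hp hq ha hh hC hK hn η

omit hC0 in
theorem hasSum_integral_pairTerm (hK : 0 ≤ K) (hf : IsLip K f) :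
    HasSum (fun q => ∫ η, pairTerm p h f q η ∂(configMeasure a μ))
      (∫ η, generator p (targetRates h) f η ∂(configMeasure a μ)) := by
  have hbd : ∀ q, Integrable (fun η : Config a => K * pairBound a p C q η.1)
      (configMeasure a μ) := fun q =>
    (integrable_configMeasure ha hμ (integrable_pairBound hμ a p C q)).const_mul K
  have hle : ∀ q (η : Config a), ‖pairTerm p h f q η‖ ≤ K * pairBound a p C q η.1 := fun q η =>
    abs_pairTerm_le hp.nonneg ha.nonneg hh hC hK hf q η
  have hmeas : ∀ q, Measurable fun η : Config a => pairTerm p h f q η := fun q =>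
    (measurable_pairTerm (S := Unit) (F := fun _ => f) (p := p) (h := h)
      ((hf.measurable ha.nonneg).comp measurable_snd) q).comp
      (measurable_const.prodMk measurable_id : Measurable fun η : Config a => ((), η))
  have hint : ∀ q, Integrable (fun η => pairTerm p h f q η) (configMeasure a μ) := fun q =>
    Integrable.mono' (hbd q) (hmeas q).aestronglyMeasurable (Eventually.of_forall (hle q))
  simp only [generator_eq_tsum]
  refine hasSum_integral_of_summable_integral_norm hint ?_
  refine Summable.of_nonneg_of_le (fun q => integral_nonneg fun η => norm_nonneg _)
    (fun q => integral_mono (hint q).norm (hbd q) (hle q)) ?_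
  refine ((summable_integral_pairBound hp hq ha hμ C).mul_left K).congr fun q => ?_
  rw [integral_const_mul, integral_configMeasure ha hμ (pairBound a p C q)]

-- The pair contributions are p(x,y) (c_y - c_x) with c summable. Row sums and column sums of p are
-- both 1, so the two halves each sum to ∑ c and cancel.
omit hC0 in
theorem IsGradientFlux.integral_generator_of_dependsOn (hg : IsGradientFlux (weight μ) h)
    {F : (X → ℕ) → ℝ} {V : Finset X} (hV : DependsOn F (V : Set X)) {m : ℝ}
    (hm : ∀ η, |F η| ≤ m) :
    ∫ η : Config a, generator p (targetRates h) (fun ζ : Config a => F ζ.1) η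
      ∂(configMeasure a μ) = 0 := by
  have hF := measurable_of_dependsOn hV
  obtain ⟨K, hK, hL⟩ := isLip_of_dependsOn ha.pos hV hm
  have h1 := hasSum_integral_pairTerm hp hq ha hμ hh hC hK hL
  -- The subtracted constant drops out of differences; with it, c vanishes outside V by independence
  -- and is therefore summable.
  set c : X → ℝ := fun x => ∫ η, emptyRate h (η x) * F η ∂(productMeasure X μ) -
    (∫ n, emptyRate h n ∂μ.toMeasure) * ∫ η, F η ∂(productMeasure X μ) with hc
  have hcs : Summable c := by
    refine summable_of_ne_finset_zero (s := V) fun x hx => ?_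
    simp only [hc]
    rw [integral_emptyRate_coord_mul_of_dependsOn hμ hh hC hF hm hV hx, sub_self]
  have h2 := (hq.hasSum_snd hcs).sub (hp.hasSum_fst hcs)
  rw [sub_self] at h2
  refine h1.unique (h2.congr_fun ?_ |> id)
  rintro ⟨x, y⟩
  rw [integral_pairTerm ha hμ]
  by_cases hxy : x = y
  · subst hxy
    simp [jumpChange, jump_self]
  · rw [hg.integral_jumpChange hμ hh hC hF hm hxy]
    simp only [hc]
    ring

/-- A gradient flux makes the product measure invariant on the level of Lipschitz functions. -/
theorem IsGradientFlux.integral_generator (hg : IsGradientFlux (weight μ) h) (hK : 0 ≤ K)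
    (hf : IsLip K f) {m : ℝ} (hm : ∀ η, |f η| ≤ m) :
    ∫ η, generator p (targetRates h) f η ∂(configMeasure a μ) = 0 := by
  -- The cutoffs to finite sets keep the Lipschitz constant and the bound m, so dominated
  -- convergence carries the cylinder case over.
  have h1 := tendsto_integral_generator hp hq ha hμ hh hC0 hC (l := (atTop : Filter (Finset X)))
    (F := fun V η => f (restrictTo a V η.1)) hK
    (Eventually.of_forall fun V => hf.restrictTo ha.nonneg hK V)
    (fun η => hf.tendsto_restrictTo ha.nonneg η)
  refine tendsto_nhds_unique h1 ?_
  refine tendsto_const_nhds.congr fun V => ?_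
  exact (hg.integral_generator_of_dependsOn hp hq ha hμ hh hC
    (F := fun η => f (restrictTo a V η)) (dependsOn_restrictTo f V) (fun η => hm _)).symm

theorem IsGradientFlux.isInfinitesimallyInvariant (hg : IsGradientFlux (weight μ) h) :
    IsInfinitesimallyInvariant a p (targetRates h) (productMeasure X μ) := by
  refine ⟨supportedOn_productMeasure ha hμ, ?_⟩
  rintro F ⟨V, hV⟩ ⟨m, hm⟩
  obtain ⟨K, hK, hL⟩ := isLip_of_dependsOn ha.pos hV hm
  exact ⟨integrable_generator hp hq ha hμ hh hC0 hC hK hL,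
    hg.integral_generator_of_dependsOn hp hq ha hμ hh hC hV hm⟩

end GeneratorIntegral

/-! ### Invariance under the semigroup and infinitesimal invariance -/

section Semigroup

variable {X : Type*} [DecidableEq X] [Countable X] {a : X → ℝ} {p : X → X → ℝ} {μ : PMF ℕ}
  {h : ℕ → ℕ → ℝ} {C K m : ℝ} {f : Config a → ℝ}

/-- The semigroup applied to a function, extended constantly to negative times. -/
noncomputable def semigroupMap (S : MarkovSemigroup a p (targetRates h)) (f : Config a → ℝ) (s : ℝ)
    (ξ : Config a) : ℝ :=
  ∫ ζ, f ζ ∂(S.kernel (max s 0) ξ)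

variable (S : MarkovSemigroup a p (targetRates h))

omit [Countable X] in
theorem semigroupMap_of_nonneg {t : ℝ} (ht : 0 ≤ t) :
    semigroupMap S f t = fun ξ => ∫ ζ, f ζ ∂(S.kernel t ξ) := by
  funext ξ
  rw [semigroupMap, max_eq_left ht]

omit [Countable X] in
theorem semigroupMap_zero (hf : IsLip K f) : semigroupMap S f 0 = f := by
  rw [semigroupMap_of_nonneg S le_rfl]
  funext ξ
  have := (S.kolmogorov 0 le_rfl K f hf ξ).2
  rwa [intervalIntegral.integral_same, add_zero] at this

omit [Countable X] in
theorem abs_semigroupMap_le (hm : ∀ η, |f η| ≤ m) (s : ℝ) (ξ : Config a) :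
    |semigroupMap S f s ξ| ≤ m := by
  have := S.markov (max s 0) (le_max_right _ _)
  have h1 := norm_integral_le_of_norm_le_const (μ := S.kernel (max s 0) ξ) (f := f) (C := m)
    (Eventually.of_forall hm)
  simpa [semigroupMap] using h1

-- Kolmogorov's equation exhibits s ↦ S(s)f(ξ) as a primitive of a locally integrable function,
-- after constant extension to negative times.
omit [Countable X] in
theorem continuous_semigroupMap (hf : IsLip K f) (ξ : Config a) :
    Continuous fun s => semigroupMap S f s ξ := by
  set G : ℝ → ℝ := fun r => generator p (targetRates h) (semigroupMap S f r) ξ with hG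
  have hGeq : ∀ r, 0 ≤ r →
      G r = generator p (targetRates h) (fun ξ => ∫ ζ, f ζ ∂(S.kernel r ξ)) ξ := fun r hr => by
    simp only [hG, semigroupMap_of_nonneg S hr]
  have hint0 : ∀ t, IntervalIntegrable G volume 0 t := by
    intro t
    rcases le_total 0 t with ht | ht
    · refine (S.kolmogorov t ht K f hf ξ).1.congr ?_
      intro r hr
      rw [Set.uIoc_of_le ht] at hr
      exact (hGeq r hr.1.le).symm
    · refine (intervalIntegrable_const (c := G 0)).congr ?_
      intro r hr
      rw [Set.uIoc_of_ge ht] at hr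
      have e : semigroupMap S f r = semigroupMap S f 0 := by
        funext η
        rw [semigroupMap, semigroupMap, max_eq_right hr.2, max_self]
      simp only [hG, e]
  have hprim := intervalIntegral.continuous_primitive
    (fun b c => (hint0 b).symm.trans (hint0 c)) (0 : ℝ)
  have e : (fun s => semigroupMap S f s ξ) =
      fun s => f ξ + ∫ r in (0 : ℝ)..(max s 0), G r := by
    funext s
    have hs : 0 ≤ max s 0 := le_max_right _ _
    rw [semigroupMap, (S.kolmogorov (max s 0) hs K f hf ξ).2]
    congr 1
    refine intervalIntegral.integral_congr fun r hr => ?_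
    rw [Set.uIcc_of_le hs] at hr
    exact (hGeq r hr.1).symm
  rw [e]
  exact continuous_const.add (hprim.comp (continuous_id.max continuous_const))

variable (hp : IsTransitionProbability p) (hq : IsTransitionProbability fun x y => p y x)
  (ha : IsWeight p a) (hμ : FiniteMean μ) (hh : ∀ k β, 1 ≤ k → 0 ≤ h k β) (hC0 : 0 ≤ C)
  (hC : ∀ α β : ℕ, ∑ k ∈ Finset.Icc 1 α, (k : ℝ) * h k β ≤ C * ((α : ℝ) + β))

omit [Countable X] in
include ha in
theorem isLip_semigroupMap (hK : 0 ≤ K) (hf : IsLip K f) :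
    ∃ c : ℝ, 0 < c ∧ ∀ s t, s ≤ t → 0 ≤ t → IsLip (K * Real.exp (c * t)) (semigroupMap S f s) := by
  obtain ⟨c, hc, H⟩ := S.lip
  refine ⟨c, hc, fun s t hst ht => ?_⟩
  refine (H (max s 0) (le_max_right _ _) K f hf).mono ha.nonneg ?_
  refine mul_le_mul_of_nonneg_left (Real.exp_le_exp.mpr ?_) hK
  exact mul_le_mul_of_nonneg_left (max_le hst ht) hc.le

-- Continuity in time and measurability in the configuration give joint measurability, which is
-- needed to exchange the time integral with the integral over configurations.
include ha in
theorem measurable_uncurry_semigroupMap (hK : 0 ≤ K) (hf : IsLip K f) :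
    Measurable (Function.uncurry (semigroupMap S f)) := by
  obtain ⟨c, hc, H⟩ := isLip_semigroupMap S ha hK hf
  exact measurable_uncurry_of_continuous_of_measurable
    (fun ξ => continuous_semigroupMap S hf ξ)
    (fun s => (H s (max s 0) (le_max_left _ _) (le_max_right _ _)).measurable ha.nonneg)

include hp hq ha hμ hh hC0 hC

theorem continuous_integral_generator_semigroupMap (hK : 0 ≤ K) (hf : IsLip K f) :
    Continuous fun s => ∫ η, generator p (targetRates h) (semigroupMap S f s) η
      ∂(configMeasure a μ) := by
  obtain ⟨c, hc, H⟩ := isLip_semigroupMap S ha hK hf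
  rw [continuous_iff_continuousAt]
  intro s
  refine tendsto_integral_generator hp hq ha hμ hh hC0 hC
    (K := K * Real.exp (c * (max s 0 + 1))) (by positivity) ?_
    (fun η => (continuous_semigroupMap S hf η).continuousAt)
  filter_upwards [Iio_mem_nhds (lt_add_one s)] with r hr
  refine H r _ ?_ (by positivity)
  have h1 : r < s + 1 := hr
  have h2 := le_max_left s 0
  linarith

/-- Kolmogorov's equation integrated against the product measure. -/
theorem integral_semigroupMap (hK : 0 ≤ K) (hf : IsLip K f) (hm : ∀ η, |f η| ≤ m) {t : ℝ}
    (ht : 0 ≤ t) :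
    ∫ η, semigroupMap S f t η ∂(configMeasure a μ) = ∫ η, f η ∂(configMeasure a μ) +
      ∫ s in (0 : ℝ)..t, ∫ η, generator p (targetRates h) (semigroupMap S f s) η
        ∂(configMeasure a μ) := by
  have hprob := isProbabilityMeasure_configMeasure (μ := μ) ha hμ
  obtain ⟨c, hc, H⟩ := isLip_semigroupMap S ha hK hf
  have hmeas : Measurable fun z : ℝ × Config a =>
      generator p (targetRates h) (semigroupMap S f z.1) z.2 :=
    measurable_generator hp hq ha hh hC (measurable_uncurry_semigroupMap S ha hK hf)
      fun s => ⟨_, by positivity, H s (max s 0) (le_max_left _ _) (le_max_right _ _)⟩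
  have hfin : IsFiniteMeasure ((volume : Measure ℝ).restrict (Set.uIoc 0 t)) := by
    rw [Set.uIoc_of_le ht]
    infer_instance
  have hprod : Integrable (Function.uncurry fun (s : ℝ) (η : Config a) =>
      generator p (targetRates h) (semigroupMap S f s) η)
      ((volume.restrict (Set.uIoc 0 t)).prod (configMeasure a μ)) := by
    refine Integrable.mono' (g := fun z : ℝ × Config a =>
      K * Real.exp (c * t) * generatorBound a p C z.2.1)
      (((integrable_generatorBound hp hq ha hμ hC0).const_mul _).comp_snd _)
      hmeas.aestronglyMeasurable ?_
    -- For times in (0, t] the Lipschitz constants of S(s)f are at most K exp(ct), so one integrable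
    -- bound dominates the whole integrand.
    have h1 : ∀ᵐ z ∂((volume.restrict (Set.uIoc 0 t)).prod (configMeasure a μ)),
        z.1 ∈ Set.uIoc 0 t :=
      Measure.quasiMeasurePreserving_fst.ae (ae_restrict_mem measurableSet_uIoc)
    filter_upwards [h1] with z hz
    rw [Set.uIoc_of_le ht] at hz
    exact abs_generator_le hp hq ha hh hC (by positivity) (H z.1 t hz.2 ht) z.2
  have hint : Integrable f (configMeasure a μ) :=
    Integrable.mono' (integrable_const m) (hf.measurable ha.nonneg).aestronglyMeasurable
      (Eventually.of_forall hm)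
  rw [intervalIntegral_integral_swap hprod]
  have hint2 : Integrable (fun η => ∫ s in (0 : ℝ)..t,
      generator p (targetRates h) (semigroupMap S f s) η) (configMeasure a μ) := by
    have := hprod.integral_prod_right
    simpa only [intervalIntegral.integral_of_le ht, Set.uIoc_of_le ht, Function.uncurry] using this
  rw [← integral_add hint hint2]
  congr 1
  funext η
  rw [semigroupMap_of_nonneg S ht]
  refine (S.kolmogorov t ht K f hf η).2.trans ?_
  congr 1
  refine intervalIntegral.integral_congr fun r hr => ?_
  rw [Set.uIcc_of_le ht] at hr
  simp only [semigroupMap_of_nonneg S hr.1]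

/-- S(s)f need not be a cylinder function, but it stays bounded and Lipschitz. The integral of its
generator therefore vanishes at every time s, and the integrated Kolmogorov equation leaves the mean
of f unchanged. -/
theorem IsGradientFlux.isInvariantFor (hg : IsGradientFlux (weight μ) h) :
    IsInvariantFor S (productMeasure X μ) := by
  refine ⟨supportedOn_productMeasure ha hμ, ?_⟩
  rintro f ⟨K, hf⟩ ⟨m, hm⟩ t ht
  -- The given Lipschitz constant is not assumed nonnegative; its absolute value also works.
  have hf' := hf.mono ha.nonneg (le_abs_self K)
  have h1 := integral_semigroupMap S hp hq ha hμ hh hC0 hC (abs_nonneg K) hf' hm ht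
  obtain ⟨c, hc, H⟩ := isLip_semigroupMap S ha (abs_nonneg K) hf'
  have h2 : ∀ s, ∫ η, generator p (targetRates h) (semigroupMap S f s) η
      ∂(configMeasure a μ) = 0 := fun s =>
    hg.integral_generator hp hq ha hμ hh hC0 hC (by positivity)
      (H s (max s 0) (le_max_left _ _) (le_max_right _ _)) (abs_semigroupMap_le S hm s)
  simp only [h2, intervalIntegral.integral_zero, add_zero] at h1
  rwa [semigroupMap_of_nonneg S ht] at h1

/-- Invariance makes the time integral of Γ vanish on [0, t] for all t ≥ 0. As Γ is continuous, its
one-sided derivative at 0 gives Γ(0) = 0, which is the claim because S(0)f = f. -/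
theorem IsInvariantFor.isInfinitesimallyInvariant {S : MarkovSemigroup a p (targetRates h)}
    (hS : IsInvariantFor S (productMeasure X μ)) :
    IsInfinitesimallyInvariant a p (targetRates h) (productMeasure X μ) := by
  refine ⟨hS.1, ?_⟩
  rintro F ⟨V, hV⟩ ⟨m, hm⟩
  obtain ⟨K, hK, hL⟩ := isLip_of_dependsOn ha.pos hV hm
  refine ⟨integrable_generator hp hq ha hμ hh hC0 hC hK hL, ?_⟩
  set f : Config a → ℝ := fun η => F η.1
  set Γ : ℝ → ℝ := fun s => ∫ η, generator p (targetRates h) (semigroupMap S f s) η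
    ∂(configMeasure a μ) with hΓ
  have hΓc : Continuous Γ :=
    continuous_integral_generator_semigroupMap S hp hq ha hμ hh hC0 hC hK hL
  have hzero : ∀ t, 0 ≤ t → ∫ s in (0 : ℝ)..t, Γ s = 0 := by
    intro t ht
    have h1 := integral_semigroupMap S hp hq ha hμ hh hC0 hC hK hL (fun η => hm η.1) ht
    have h2 := hS.2 f ⟨K, hL⟩ ⟨m, fun η => hm η.1⟩ t ht
    rw [semigroupMap_of_nonneg S ht, h2] at h1
    linarith
  have hd1 : HasDerivWithinAt (fun t => ∫ s in (0 : ℝ)..t, Γ s) (Γ 0) (Set.Ici 0) 0 :=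
    (hΓc.integral_hasStrictDerivAt 0 0).hasDerivAt.hasDerivWithinAt
  have hd2 : HasDerivWithinAt (fun t => ∫ s in (0 : ℝ)..t, Γ s) 0 (Set.Ici 0) 0 :=
    (hasDerivWithinAt_const (0 : ℝ) (Set.Ici 0) (0 : ℝ)).congr (fun t ht => hzero t ht)
      (hzero 0 le_rfl)
  have h3 : Γ 0 = 0 := (uniqueDiffWithinAt_Ici (0 : ℝ)).eq_deriv _ hd1 hd2
  rw [hΓ] at h3
  simp only [semigroupMap_zero S hL] at h3
  exact h3

end Semigroup

/-! ### Necessity of the gradient condition -/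

/-- The indicator function of one occupation number. -/
def occ (α n : ℕ) : ℝ := if n = α then 1 else 0

theorem abs_occ_le (α n : ℕ) : |occ α n| ≤ 1 := by
  unfold occ
  split_ifs <;> simp

/-- The net flux into the states whose first occupation number is `α`. -/
noncomputable def fluxFst (v : ℕ → ℝ) (h : ℕ → ℕ → ℝ) (α : ℕ) : ℝ :=
  ∑' q : ℕ × ℕ, netFlux v h q.1 q.2 * occ α q.1

/-- The net flux into the states whose second occupation number is `β`. -/
noncomputable def fluxSnd (v : ℕ → ℝ) (h : ℕ → ℕ → ℝ) (β : ℕ) : ℝ :=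
  ∑' q : ℕ × ℕ, netFlux v h q.1 q.2 * occ β q.2

theorem tsum_netFlux_occ_mul_occ (v : ℕ → ℝ) (h : ℕ → ℕ → ℝ) (α β : ℕ) :
    ∑' q : ℕ × ℕ, netFlux v h q.1 q.2 * (occ α q.1 * occ β q.2) = netFlux v h α β := by
  rw [tsum_eq_single (α, β)]
  · simp [occ]
  · rintro ⟨i, j⟩ hij
    by_cases hi : i = α
    · have hj : j ≠ β := fun hj => hij (by rw [hi, hj])
      simp [occ, hj]
    · simp [occ, hi]

section Necessity

variable {X : Type*} [DecidableEq X] {a : X → ℝ} {p : X → X → ℝ} {μ : PMF ℕ}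
  {h : ℕ → ℕ → ℝ} {C : ℝ}

omit [DecidableEq X] in
theorem integral_occ (μ : PMF ℕ) (x : X) (α : ℕ) :
    ∫ η : X → ℕ, occ α (η x) ∂(productMeasure X μ) = weight μ α := by
  have h1 := measurePreserving_coord μ x
  have e : ∫ η : X → ℕ, occ α (η x) ∂(productMeasure X μ) = ∫ n, occ α n ∂μ.toMeasure := by
    rw [← h1.map_eq]
    exact (integral_map h1.measurable.aemeasurable
      (measurable_of_countable _).aestronglyMeasurable).symm
  have hint : Integrable (occ α) μ.toMeasure :=
    Integrable.mono' (integrable_const 1) (measurable_of_countable _).aestronglyMeasurable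
      (Eventually.of_forall (abs_occ_le α))
  rw [e, integral_countable hint, tsum_eq_single α]
  · simp [occ, toMeasure_real_singleton]
  · intro n hn
    simp [occ, hn]

omit [DecidableEq X] in
theorem dependsOn_occ (u : X) (α : ℕ) :
    DependsOn (fun η : X → ℕ => occ α (η u)) (({u} : Finset X) : Set X) := by
  intro η ζ H
  simp only [H u (by simp)]

theorem dependsOn_occ_mul_occ (u v : X) (α β : ℕ) :
    DependsOn (fun η : X → ℕ => occ α (η u) * occ β (η v)) (({u, v} : Finset X) : Set X) := by
  intro η ζ H
  simp only [H u (by simp), H v (by simp)]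

variable (hμ : FiniteMean μ) (hh : ∀ k β, 1 ≤ k → 0 ≤ h k β)
  (hC : ∀ α β : ℕ, ∑ k ∈ Finset.Icc 1 α, (k : ℝ) * h k β ≤ C * ((α : ℝ) + β))

include hμ hh hC

theorem integral_jumpChange_occ (u : X) (α : ℕ) {x y : X} (hxy : x ≠ y) :
    ∫ η, jumpChange h (fun η : X → ℕ => occ α (η u)) x y η ∂(productMeasure X μ) =
      (if x = u then fluxFst (weight μ) h α else 0) +
        (if y = u then fluxSnd (weight μ) h α else 0) := by
  rw [integral_jumpChange hμ hh hC (measurable_of_dependsOn (dependsOn_occ u α)) (m := 1)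
    (fun η => abs_occ_le _ _) hxy]
  by_cases hx : x = u
  · subst hx
    simp only [updateTwo_apply_fst hxy, if_true, if_neg hxy.symm]
    simp [fluxFst]
  · by_cases hy : y = u
    · subst hy
      simp only [updateTwo_apply_snd, if_true, if_neg hx]
      simp [fluxSnd]
    · simp only [updateTwo_apply_of_ne (Ne.symm hx) (Ne.symm hy), if_neg hx, if_neg hy,
        tsum_mul_right, tsum_netFlux (weight_nonneg μ) (hasSum_weight μ).summable hμ hh hC]
      simp

/-- A jump that touches just one of u, v sees the other site as an independent factor. Jumps between
u and v are entered as corrections to these generic terms, so that only two exceptional pairs remain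
when summing against p. -/
theorem integral_jumpChange_occ_mul_occ {u v : X} (huv : u ≠ v) (α β : ℕ) {x y : X}
    (hxy : x ≠ y) :
    ∫ η, jumpChange h (fun η : X → ℕ => occ α (η u) * occ β (η v)) x y η
        ∂(productMeasure X μ) =
      (if x = u then fluxFst (weight μ) h α * weight μ β else 0) +
      (if x = v then fluxFst (weight μ) h β * weight μ α else 0) +
      (if y = u then fluxSnd (weight μ) h α * weight μ β else 0) +
      (if y = v then fluxSnd (weight μ) h β * weight μ α else 0) +
      (if (x, y) = (u, v) then netFlux (weight μ) h α β - fluxFst (weight μ) h α * weight μ β -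
        fluxSnd (weight μ) h β * weight μ α else 0) +
      (if (x, y) = (v, u) then netFlux (weight μ) h β α - fluxFst (weight μ) h β * weight μ α -
        fluxSnd (weight μ) h α * weight μ β else 0) := by
  have hb : ∀ η : X → ℕ, |occ α (η u) * occ β (η v)| ≤ 1 := fun η => by
    rw [abs_mul]
    exact mul_le_one₀ (abs_occ_le _ _) (abs_nonneg _) (abs_occ_le _ _)
  rw [integral_jumpChange hμ hh hC (measurable_of_dependsOn (dependsOn_occ_mul_occ u v α β))
    (m := 1) hb hxy]
  have h0 := tsum_netFlux (weight_nonneg μ) (hasSum_weight μ).summable hμ hh hC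
  by_cases hxu : x = u
  · subst hxu
    by_cases hyv : y = v
    · subst hyv
      simp only [updateTwo_apply_fst hxy, updateTwo_apply_snd, tsum_netFlux_occ_mul_occ,
        integral_const, probReal_univ, one_smul, Prod.mk.injEq, hxy, hxy.symm, if_true, if_false,
        and_self]
      ring
    · simp only [updateTwo_apply_fst hxy, updateTwo_apply_of_ne huv.symm (Ne.symm hyv),
        ← mul_assoc, tsum_mul_right]
      rw [integral_const_mul, integral_occ]
      simp [huv, hyv, hxy.symm, fluxFst]
  · by_cases hxv : x = v
    · subst hxv
      by_cases hyu : y = u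
      · subst hyu
        have e : ∀ η : X → ℕ, ∑' q : ℕ × ℕ, netFlux (weight μ) h q.1 q.2 *
            (occ α (updateTwo x y η q y) * occ β (updateTwo x y η q x)) =
            netFlux (weight μ) h β α := by
          intro η
          rw [← tsum_netFlux_occ_mul_occ (weight μ) h β α]
          refine tsum_congr fun q => ?_
          rw [updateTwo_apply_fst hxy, updateTwo_apply_snd, mul_comm (occ α _)]
        simp only [e, integral_const, probReal_univ, one_smul, Prod.mk.injEq, hxy, hxy.symm,
          if_true, if_false, and_self]
        ring
      · have e : ∀ η : X → ℕ, ∑' q : ℕ × ℕ, netFlux (weight μ) h q.1 q.2 *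
            (occ α (updateTwo x y η q u) * occ β (updateTwo x y η q x)) =
            fluxFst (weight μ) h β * occ α (η u) := by
          intro η
          rw [fluxFst, ← tsum_mul_right]
          refine tsum_congr fun q => ?_
          rw [updateTwo_apply_fst hxy, updateTwo_apply_of_ne huv (Ne.symm hyu)]
          ring
        simp only [e]
        rw [integral_const_mul, integral_occ]
        simp [huv.symm, hyu, hxy.symm]
    · by_cases hyu : y = u
      · subst hyu
        simp only [updateTwo_apply_snd, updateTwo_apply_of_ne (Ne.symm hxv) huv.symm,
          ← mul_assoc, tsum_mul_right]
        rw [integral_const_mul, integral_occ]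
        simp [hxu, hxv, huv, fluxSnd]
      · by_cases hyv : y = v
        · subst hyv
          have e : ∀ η : X → ℕ, ∑' q : ℕ × ℕ, netFlux (weight μ) h q.1 q.2 *
              (occ α (updateTwo x y η q u) * occ β (updateTwo x y η q y)) =
              fluxSnd (weight μ) h β * occ α (η u) := by
            intro η
            rw [fluxSnd, ← tsum_mul_right]
            refine tsum_congr fun q => ?_
            rw [updateTwo_apply_snd, updateTwo_apply_of_ne (Ne.symm hxu) huv]
            ring
          simp only [e]
          rw [integral_const_mul, integral_occ]
          simp [hxu, hxv, hyu]
        · simp only [updateTwo_apply_of_ne (Ne.symm hxu) (Ne.symm hyu),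
            updateTwo_apply_of_ne (Ne.symm hxv) (Ne.symm hyv), tsum_mul_right, h0]
          simp [hxu, hxv, hyu, hyv]

omit hμ hh hC in
theorem hasSum_offDiag_fst (hp : IsTransitionProbability p) (u : X) (c : ℝ) :
    HasSum (fun q : X × X => p q.1 q.2 * (if q.1 = q.2 then 0 else if q.1 = u then c else 0))
      ((1 - p u u) * c) := by
  have h1 : HasSum (fun q : X × X => p q.1 q.2 * (if q.1 = u then c else 0)) c := by
    have hs : Summable fun x : X => if x = u then c else 0 := (hasSum_ite_eq u c).summable
    have := hp.hasSum_fst hs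
    rwa [tsum_ite_eq] at this
  have h2 : HasSum (fun q : X × X => if q = (u, u) then p u u * c else 0) (p u u * c) :=
    hasSum_ite_eq (u, u) (p u u * c)
  have h3 := h1.sub h2
  rw [sub_mul, one_mul]
  refine h3.congr_fun ?_ |> id
  rintro ⟨x, y⟩
  by_cases hx : x = u
  · subst hx
    by_cases hy : y = x
    · subst hy
      simp
    · simp [hy, Ne.symm hy]
  · simp [hx]

omit hμ hh hC in
theorem hasSum_offDiag_snd (hq : IsTransitionProbability fun x y => p y x) (u : X) (c : ℝ) :
    HasSum (fun q : X × X => p q.1 q.2 * (if q.1 = q.2 then 0 else if q.2 = u then c else 0))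
      ((1 - p u u) * c) := by
  have h1 := (Equiv.prodComm X X).hasSum_iff.mpr (hasSum_offDiag_fst hq u c)
  refine h1.congr_fun ?_ |> id
  rintro ⟨x, y⟩
  simp [eq_comm]

theorem IsInfinitesimallyInvariant.hasSum_integral_jumpChange [Countable X]
    (hp : IsTransitionProbability p) (hq : IsTransitionProbability fun x y => p y x)
    (ha : IsWeight p a) (H : IsInfinitesimallyInvariant a p (targetRates h) (productMeasure X μ))
    {F : (X → ℕ) → ℝ} {V : Finset X} (hV : DependsOn F (V : Set X)) {m : ℝ}
    (hm : ∀ η, |F η| ≤ m) :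
    HasSum (fun q : X × X => p q.1 q.2 * (if q.1 = q.2 then 0 else
      ∫ η, jumpChange h F q.1 q.2 η ∂(productMeasure X μ))) 0 := by
  obtain ⟨K, hK, hL⟩ := isLip_of_dependsOn ha.pos hV hm
  have h1 := hasSum_integral_pairTerm hp hq ha hμ hh hC hK hL
  rw [(H.2 F ⟨V, hV⟩ ⟨m, hm⟩).2] at h1
  refine h1.congr_fun ?_ |> id
  rintro ⟨x, y⟩
  rw [integral_pairTerm ha hμ]
  by_cases hxy : x = y
  · subst hxy
    simp [jumpChange, jump_self]
  · simp [hxy]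

/-- For an asymmetric transition probability, an invariant product measure has gradient flux. -/
theorem IsInfinitesimallyInvariant.isGradientFlux [Countable X]
    (hp : IsTransitionProbability p) (hq : IsTransitionProbability fun x y => p y x)
    (ha : IsWeight p a) (hfull : FullSupport μ) {u v : X} (hasym : p u v ≠ p v u)
    (H : IsInfinitesimallyInvariant a p (targetRates h) (productMeasure X μ)) :
    IsGradientFlux (weight μ) h := by
  have huv : u ≠ v := by
    rintro rfl
    exact hasym rfl
  -- Asymmetry makes p(u,v) or p(v,u) positive, and row and column sums are 1, so p(u,u) < 1.
  have hpu : 0 < 1 - p u u := by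
    have h1 : p u u + p u v ≤ 1 := by
      rw [← Finset.sum_pair huv]
      exact sum_le_hasSum _ (fun _ _ => hp.nonneg _ _) (hp.hasSum_one u)
    have h2 : p u u + p v u ≤ 1 := by
      have := Finset.sum_pair (f := fun x => p x u) huv
      rw [← this]
      exact sum_le_hasSum _ (fun _ _ => hp.nonneg _ _) (hq.hasSum_one u)
    have h3 := hp.nonneg u v
    have h4 := hp.nonneg v u
    rcases lt_or_gt_of_ne hasym with h5 | h5 <;> linarith
  -- The indicator of one occupation number at u sees in total the rate 1 - p(u,u) of departures and
  -- the same rate of arrivals.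
  have hflux : ∀ α, fluxSnd (weight μ) h α = -fluxFst (weight μ) h α := by
    intro α
    have h1 := H.hasSum_integral_jumpChange hμ hh hC hp hq ha (dependsOn_occ u α) (m := 1)
      (fun η => abs_occ_le _ _)
    have h2 := (hasSum_offDiag_fst hp u (fluxFst (weight μ) h α)).add
      (hasSum_offDiag_snd hq u (fluxSnd (weight μ) h α))
    have h3 := h1.unique (h2.congr_fun (fun q => by
      by_cases hxy : q.1 = q.2
      · simp [hxy]
      · simp only [if_neg hxy]
        rw [integral_jumpChange_occ hμ hh hC u α hxy]
        ring) |> id)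
    have h4 : (1 - p u u) * (fluxFst (weight μ) h α + fluxSnd (weight μ) h α) = 0 := by linarith
    have := (mul_eq_zero.mp h4).resolve_left hpu.ne'
    linarith
  set D : ℕ → ℕ → ℝ := fun α β => netFlux (weight μ) h α β -
    fluxFst (weight μ) h α * weight μ β + fluxFst (weight μ) h β * weight μ α with hD
  -- In the two-site test all one-site contributions cancel by `hflux`; only the jumps between u and
  -- v survive.
  have hpair : ∀ α β, p u v * D α β + p v u * D β α = 0 := by
    intro α β
    have h1 := H.hasSum_integral_jumpChange hμ hh hC hp hq ha
      (dependsOn_occ_mul_occ u v α β) (m := 1) (fun η => by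
        rw [abs_mul]
        exact mul_le_one₀ (abs_occ_le _ _) (abs_nonneg _) (abs_occ_le _ _))
    have hD1 : HasSum (fun q : X × X => if q = (u, v) then p u v * D α β else 0)
        (p u v * D α β) := hasSum_ite_eq (u, v) _
    have hD2 : HasSum (fun q : X × X => if q = (v, u) then p v u * D β α else 0)
        (p v u * D β α) := hasSum_ite_eq (v, u) _
    have h2 := (((((hasSum_offDiag_fst hp u (fluxFst (weight μ) h α * weight μ β)).add
      (hasSum_offDiag_fst hp v (fluxFst (weight μ) h β * weight μ α))).add
      (hasSum_offDiag_snd hq u (fluxSnd (weight μ) h α * weight μ β))).add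
      (hasSum_offDiag_snd hq v (fluxSnd (weight μ) h β * weight μ α))).add hD1).add hD2
    have h3 := h1.unique (h2.congr_fun (fun q => by
      obtain ⟨x, y⟩ := q
      by_cases hxy : x = y
      · subst hxy
        have e1 : ¬((x, x) = (u, v)) := by
          rintro ⟨⟩
          exact huv rfl
        have e2 : ¬((x, x) = (v, u)) := by
          rintro ⟨⟩
          exact huv rfl
        simp only [if_true, if_neg e1, if_neg e2]
        ring
      · simp only [if_neg hxy]
        rw [integral_jumpChange_occ_mul_occ hμ hh hC huv α β hxy]
        have e1 : (if (x, y) = (u, v) then p u v * D α β else 0) = p x y *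
            (if (x, y) = (u, v) then netFlux (weight μ) h α β -
              fluxFst (weight μ) h α * weight μ β -
              fluxSnd (weight μ) h β * weight μ α else 0) := by
          split_ifs with hc
          · obtain ⟨rfl, rfl⟩ := Prod.mk.inj hc
            simp only [hD, hflux]
            ring
          · ring
        have e2 : (if (x, y) = (v, u) then p v u * D β α else 0) = p x y *
            (if (x, y) = (v, u) then netFlux (weight μ) h β α -
              fluxFst (weight μ) h β * weight μ α -
              fluxSnd (weight μ) h α * weight μ β else 0) := by
          split_ifs with hc
          · obtain ⟨rfl, rfl⟩ := Prod.mk.inj hc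
            simp only [hD, hflux]
            ring
          · ring
        rw [e1, e2]
        ring) |> id)
    rw [hflux α, hflux β] at h3
    linarith
  have hD0 : ∀ α β, D α β = 0 := by
    intro α β
    have h1 := hpair α β
    have h2 := hpair β α
    -- With α and β exchanged, the two relations form a linear system whose determinant p(u,v)² -
    -- p(v,u)² is nonzero.
    have h3 : (p u v - p v u) * (p u v + p v u) * D α β = 0 := by
      linear_combination p u v * h1 - p v u * h2
    refine (mul_eq_zero.mp h3).resolve_left (mul_ne_zero (sub_ne_zero.mpr hasym) ?_)
    have h4 := hp.nonneg u v
    have h5 := hp.nonneg v u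
    rcases lt_or_gt_of_ne hasym with h6 | h6
    · exact (by linarith : 0 < p u v + p v u).ne'
    · exact (by linarith : 0 < p u v + p v u).ne'
  -- No jump ends on an empty site, so at β = 0 the net flux is pure out-flux. Thus D(α, 0) = 0
  -- gives the marginal flux up to a constant independent of α, which cancels in D(α, β) = 0.
  have hval : ∀ α, fluxFst (weight μ) h α =
      weight μ α * (fluxFst (weight μ) h 0 / weight μ 0 - emptyRate h α) := by
    intro α
    have h1 := hD0 α 0
    have h2 : netFlux (weight μ) h α 0 = -(weight μ α * weight μ 0 * emptyRate h α) := by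
      simp [netFlux, inFlux, outFlux, emptyRate]
    simp only [hD, h2] at h1
    have h3 := (hfull 0).ne'
    field_simp
    linarith
  intro α β
  have h1 := hD0 α β
  simp only [hD] at h1
  rw [hval α, hval β] at h1
  linear_combination h1

end Necessity

/-! ### Reference marginals -/

theorem exists_pmf_weight {f : ℕ → ℝ} (hf0 : ∀ n, 0 ≤ f n) (hf : HasSum f 1) :
    ∃ ν : PMF ℕ, ∀ n, weight ν n = f n := by
  refine ⟨⟨fun n => ENNReal.ofReal (f n), ?_⟩, fun n => ENNReal.toReal_ofReal (hf0 n)⟩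
  rw [← ENNReal.ofReal_one, ← hf.tsum_eq, ENNReal.ofReal_tsum_of_nonneg hf0 hf.summable]
  exact ENNReal.summable.hasSum

/-- The fugacity 1/(2B) pushes the weights below 2^(-n), so that both the normalization and the
first moment converge. -/
theorem exists_reference {h : ℕ → ℕ → ℝ} (hw : ∀ n, 0 < rateWeight h n) {B : ℝ} (hB : 0 < B)
    (hwB : ∀ n, rateWeight h n ≤ B ^ n) : ∃ μ : PMF ℕ, IsReference h μ ∧ FiniteMean μ := by
  set φ := 1 / (2 * B) with hφ
  have hφ0 : 0 < φ := by positivity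
  have hle : ∀ n, φ ^ n * rateWeight h n ≤ (1 / 2 : ℝ) ^ n := by
    intro n
    calc φ ^ n * rateWeight h n ≤ φ ^ n * B ^ n :=
          mul_le_mul_of_nonneg_left (hwB n) (by positivity)
      _ = (1 / 2 : ℝ) ^ n := by
          rw [← mul_pow, hφ]
          congr 1
          field_simp
  have hpos : ∀ n, 0 < φ ^ n * rateWeight h n := fun n => mul_pos (pow_pos hφ0 n) (hw n)
  have hs : Summable fun n => φ ^ n * rateWeight h n :=
    Summable.of_nonneg_of_le (fun n => (hpos n).le) hle
      (summable_geometric_of_lt_one (by norm_num) (by norm_num))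
  set Z := ∑' n, φ ^ n * rateWeight h n with hZ
  have hZ0 : 0 < Z := hs.tsum_pos (fun n => (hpos n).le) 0 (hpos 0)
  obtain ⟨μ, hμ⟩ := exists_pmf_weight (f := fun n => φ ^ n * rateWeight h n / Z)
    (fun n => div_nonneg (hpos n).le hZ0.le) (by
      have := hs.hasSum.div_const Z
      rwa [← hZ, div_self hZ0.ne'] at this)
  have h10 : 0 < h 1 0 := by
    rw [← rateWeight_one h]
    exact hw 1
  have hφt : phiTilde h μ = φ := by
    rw [phiTilde, hμ, hμ, rateWeight_zero, rateWeight_one]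
    have := h10.ne'
    have := hZ0.ne'
    field_simp
  refine ⟨μ, ⟨fun n => ?_, fun n => ?_⟩, ?_⟩
  · rw [hμ]
    exact div_pos (hpos n) hZ0
  · rw [hφt, hμ, hμ, rateWeight_zero]
    ring
  · have hg : Summable fun n : ℕ => (n : ℝ) ^ 1 * (1 / 2 : ℝ) ^ n :=
      summable_pow_mul_geometric_of_norm_lt_one 1 (by norm_num)
    refine Summable.of_nonneg_of_le
      (fun n => mul_nonneg n.cast_nonneg (weight_nonneg μ n)) (fun n => ?_) (hg.div_const Z)
    rw [hμ, ← mul_div_assoc, pow_one]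
    exact div_le_div_of_nonneg_right (mul_le_mul_of_nonneg_left (hle n) n.cast_nonneg) hZ0.le

/-- Strictly inside the radius some larger ψ gives convergence; then ψ^n m(n) is bounded and n
(φ/ψ)^n is summable. At the critical fugacity the claim is part of the membership. -/
theorem summable_mul_pow_of_mem_radPrime {m : ℕ → ℝ} (hm : ∀ n, 0 ≤ m n) {φ : ℝ}
    (hφ : φ ∈ radPrime m) : Summable fun n : ℕ => (n : ℝ) * φ ^ n * m n := by
  obtain ⟨hφ0, hlt | ⟨-, hs⟩⟩ := hφ
  · rw [criticalFugacity, lt_iSup_iff] at hlt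
    obtain ⟨ψ, hψ⟩ := hlt
    rw [lt_iSup_iff] at hψ
    obtain ⟨hs, hlt⟩ := hψ
    have hφψ : φ < ψ := by
      rw [ENNReal.ofReal, ENNReal.coe_lt_coe] at hlt
      exact (Real.toNNReal_lt_iff_lt_coe hφ0.le).mp hlt
    have hψ0 : (0 : ℝ) < ψ := hφ0.trans hφψ
    have hr : ‖φ / (ψ : ℝ)‖ < 1 := by
      rw [Real.norm_eq_abs, abs_of_pos (div_pos hφ0 hψ0), div_lt_one hψ0]
      exact hφψ
    have hg := (summable_pow_mul_geometric_of_norm_lt_one 1 hr).mul_right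
      (∑' n : ℕ, (ψ : ℝ) ^ n * m n)
    refine Summable.of_nonneg_of_le (fun n => by have := hm n; positivity) (fun n => ?_) hg
    have h1 : (ψ : ℝ) ^ n * m n ≤ ∑' n : ℕ, (ψ : ℝ) ^ n * m n :=
      hs.le_tsum n fun k _ => mul_nonneg (by positivity) (hm k)
    calc (n : ℝ) * φ ^ n * m n = (n : ℝ) ^ 1 * (φ / (ψ : ℝ)) ^ n * ((ψ : ℝ) ^ n * m n) := by
          rw [div_pow]
          field_simp
      _ ≤ _ := mul_le_mul_of_nonneg_left h1 (by positivity)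
  · exact hs

theorem summable_pow_mul_of_summable_mul_pow {m : ℕ → ℝ} (hm : ∀ n, 0 ≤ m n) {φ : ℝ}
    (hφ : 0 < φ) (hs : Summable fun n : ℕ => (n : ℝ) * φ ^ n * m n) :
    Summable fun n : ℕ => φ ^ n * m n := by
  rw [← summable_nat_add_iff 1]
  refine Summable.of_nonneg_of_le (fun n => mul_nonneg (by positivity) (hm _)) (fun n => ?_)
    ((summable_nat_add_iff 1).mpr hs)
  rw [mul_assoc]
  refine le_mul_of_one_le_left (mul_nonneg (by positivity) (hm _)) ?_
  push_cast
  linarith [n.cast_nonneg (α := ℝ)]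

theorem IsReference.phiTilde_pos {h : ℕ → ℕ → ℝ} (h10 : 0 < h 1 0) {μ : PMF ℕ}
    (hμ : IsReference h μ) : 0 < phiTilde h μ :=
  mul_pos (one_div_pos.mpr h10) (div_pos (hμ.1 1) (hμ.1 0))

/-- The tilted marginals with fugacity in `Rad(Z')`. -/
theorem IsReference.exists_tilted {h : ℕ → ℕ → ℝ} {μ : PMF ℕ}
    (hμ : IsReference h μ) {φ : ℝ} (hφ : φ ∈ radPrime (weight μ)) :
    Summable (fun n : ℕ => φ ^ n * weight μ n) ∧
      partitionFn (weight μ) φ =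
        weight μ 0 * ∑' n : ℕ, (φ * phiTilde h μ) ^ n * rateWeight h n ∧
      0 < partitionFn (weight μ) φ ∧
      ∃ ν : PMF ℕ, (∀ α, weight ν α = weight μ 0 / partitionFn (weight μ) φ *
        (φ * phiTilde h μ) ^ α * rateWeight h α) ∧ FiniteMean ν := by
  have hφ0 : 0 < φ := hφ.1
  have hsn := summable_mul_pow_of_mem_radPrime (weight_nonneg μ) hφ
  have hs := summable_pow_mul_of_summable_mul_pow (weight_nonneg μ) hφ0 hsn
  have hpos : ∀ n, 0 < φ ^ n * weight μ n := fun n => mul_pos (pow_pos hφ0 n) (hμ.1 n)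
  have hZ0 : 0 < partitionFn (weight μ) φ :=
    hs.tsum_pos (fun n => (hpos n).le) 0 (hpos 0)
  have hterm : ∀ n, φ ^ n * weight μ n =
      weight μ 0 * ((φ * phiTilde h μ) ^ n * rateWeight h n) := by
    intro n
    rw [hμ.2 n, mul_pow]
    ring
  refine ⟨hs, ?_, hZ0, ?_⟩
  · rw [partitionFn, ← tsum_mul_left]
    exact tsum_congr hterm
  · obtain ⟨ν, hν⟩ := exists_pmf_weight
      (f := fun n => φ ^ n * weight μ n / partitionFn (weight μ) φ)
      (fun n => div_nonneg (hpos n).le hZ0.le) (by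
        have := hs.hasSum.div_const (partitionFn (weight μ) φ)
        rwa [← partitionFn, div_self hZ0.ne'] at this)
    refine ⟨ν, fun n => ?_, ?_⟩
    · rw [hν, hterm]
      ring
    · refine (hsn.div_const (partitionFn (weight μ) φ)).congr fun n => ?_
      rw [hν]
      ring

end MMP

open MMP
theorem proposition3p14 (d : ℕ) (p : (Fin d → ℤ) → (Fin d → ℤ) → ℝ)
    (hp : IsTransitionProbability p) (hirr : IsIrreducibleWalk p) (htr : IsTranslationInvariant p)
    (a : (Fin d → ℤ) → ℝ) (ha : IsWeight p a) :
    -- (a) rates with a prescribed invariant product measure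
    (∀ (μ : PMF ℕ) (c : ℕ → ℝ), FullSupport μ → FiniteMean μ → (∀ α, 1 ≤ α → 0 < c α) →
      (∀ α β, 1 ≤ α → 0 ≤ recursiveRates μ c α β) →
      RateBound (targetRates (recursiveRates μ c)) →
      IsInfinitesimallyInvariant a p (targetRates (recursiveRates μ c))
          (productMeasure (Fin d → ℤ) μ) ∧
        ∀ S : MarkovSemigroup a p (targetRates (recursiveRates μ c)),
          IsInvariantFor S (productMeasure (Fin d → ℤ) μ)) ∧
    -- (a) sufficient condition for the rates to be nonnegative
    (∀ (μ : PMF ℕ), FullSupport μ →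
      ((∀ r s, 0 < r → 0 ≤ delta (weight μ) r s) ↔
        Monotone fun n : ℕ => weight μ (n + 1) / weight μ n) ∧
      ∀ c : ℕ → ℝ, (∀ α, 1 ≤ α → 0 < c α) → (∀ r s, 0 < r → 0 ≤ delta (weight μ) r s) →
        ∀ α β, 1 ≤ α → 0 ≤ recursiveRates μ c α β) ∧
    -- (b) the one-parameter family of invariant product measures
    (∀ h : ℕ → ℕ → ℝ, (∀ k β, 1 ≤ k → 0 ≤ h k β) → RateBound (targetRates h) →
      PositivityCondition h → CompatibilityCondition h →
      (∃ μ : PMF ℕ, IsReference h μ ∧ FiniteMean μ) ∧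
      ∀ μ : PMF ℕ, IsReference h μ → ∀ φ ∈ radPrime (weight μ),
        Summable (fun n : ℕ => φ ^ n * weight μ n) ∧
        partitionFn (weight μ) φ = weight μ 0 * ∑' n : ℕ, (φ * phiTilde h μ) ^ n * rateWeight h n ∧
        ∃ ν : PMF ℕ,
          (∀ α, weight ν α = weight μ 0 / partitionFn (weight μ) φ * (φ * phiTilde h μ) ^ α *
            rateWeight h α) ∧
          IsInfinitesimallyInvariant a p (targetRates h) (productMeasure (Fin d → ℤ) ν) ∧
          ∀ S : MarkovSemigroup a p (targetRates h), IsInvariantFor S (productMeasure (Fin d → ℤ) ν)) ∧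
    -- (b) necessity of the conditions on the rates in the asymmetric case
    ((∃ x y, p x y ≠ p y x) →
      ∀ h : ℕ → ℕ → ℝ, (∀ k β, 1 ≤ k → 0 ≤ h k β) → RateBound (targetRates h) → h 1 0 ≠ 0 →
        ∀ μ : PMF ℕ, FullSupport μ → FiniteMean μ →
          (IsInfinitesimallyInvariant a p (targetRates h) (productMeasure (Fin d → ℤ) μ) ∨
            ∃ S : MarkovSemigroup a p (targetRates h),
              IsInvariantFor S (productMeasure (Fin d → ℤ) μ)) →
          PositivityCondition h ∧ CompatibilityCondition h) := by
  have hq := hp.swap_of_translationInvariant htr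
  have hinv : ∀ (μ : PMF ℕ) (h : ℕ → ℕ → ℝ), FiniteMean μ → (∀ k β, 1 ≤ k → 0 ≤ h k β) →
      RateBound (targetRates h) → IsGradientFlux (weight μ) h →
      IsInfinitesimallyInvariant a p (targetRates h) (productMeasure (Fin d → ℤ) μ) ∧
        ∀ S : MarkovSemigroup a p (targetRates h),
          IsInvariantFor S (productMeasure (Fin d → ℤ) μ) := by
    intro μ h hμ hh hG hg
    obtain ⟨C, hC0, hC⟩ := hG.exists_target
    exact ⟨hg.isInfinitesimallyInvariant hp hq ha hμ hh hC0.le hC,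
      fun S => hg.isInvariantFor S hp hq ha hμ hh hC0.le hC⟩
  refine ⟨?_, ?_, ?_, ?_⟩
  · intro μ c hfull hμ _ hnn hG
    exact hinv μ _ hμ hnn hG
      ((recursiveRates_rateRecursion hfull c).isGradientFlux hfull)
  · intro μ hfull
    exact ⟨delta_nonneg_iff hfull, fun c hc hd α β hα => recursiveRates_nonneg hfull hc hd hα β⟩
  · intro h hh hG hpos hcomp
    have hw := fun n => hpos.rateWeight_pos hh n
    have h10 : 0 < h 1 0 := by
      rw [← rateWeight_one h]
      exact hw 1
    have hrec := (compatibilityCondition_iff hw).mp hcomp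
    obtain ⟨B, hB, hwB⟩ := rateWeight_le_pow hh hG hw (hrec.isGradientFlux hw)
    refine ⟨exists_reference hw hB hwB, fun μ hμ φ hφ => ?_⟩
    obtain ⟨hs, hZ, hZ0, ν, hν, hνm⟩ := hμ.exists_tilted hφ
    have hφt : 0 < φ * phiTilde h μ := mul_pos hφ.1 (hμ.phiTilde_pos h10)
    have hc : 0 < weight μ 0 / partitionFn (weight μ) φ := div_pos (hμ.1 0) hZ0
    have hνpos : ∀ n, 0 < weight ν n := fun n => by
      rw [hν]
      exact mul_pos (mul_pos hc (pow_pos hφt n)) (hw n)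
    -- The tilted weights are w times a geometric factor, so the recursion for w is also the
    -- recursion for ν.
    exact ⟨hs, hZ, ν, hν, hinv ν h hνm hh hG
      (((rateRecursion_geometric hc.ne' hφt.ne' hν h).mpr hrec).isGradientFlux hνpos)⟩
  · rintro ⟨u, v, hasym⟩ h hh hG h10 μ hfull hμ hinvar
    obtain ⟨C, hC0, hC⟩ := hG.exists_target
    have hinf : IsInfinitesimallyInvariant a p (targetRates h)
        (productMeasure (Fin d → ℤ) μ) := by
      rcases hinvar with H | ⟨S, hS⟩
      · exact H
      · exact hS.isInfinitesimallyInvariant hp hq ha hμ hh hC0.le hC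
    exact (hinf.isGradientFlux hμ hh hC hp hq ha hfull hasym).positivity_and_compatibility hfull
      (lt_of_le_of_ne (hh 1 0 le_rfl) h10.symm)
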